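/- **Setting.** Let $R(x,y)=(x,-y)$ and $\Sigma=\{y=0\}\subset\mathbb R^2$. Let $D\subset\mathbb R^2$ be open with $R(D)=D$, let $F=(F_1,F_2):D\to\mathbb R^2$ be of class $C^2$, and put $F^-=F$, $F^+(z)=-RF(Rz)$. Let $\Gamma(t,z)$ be the local flow of $\dot z=F(z)$ in $D$ and $Y(t,z)=D_z\Gamma(t,z)$. Assume: (h1) there are $x_i<x_v$ such that $p_i=(x_i,0)$ and $p_v=(x_v,0)$ lie in $D$, $F_2(p_v)=F_2(p_i)=0$, $\partial_xF_2(p_v)F_1(p_v)<0$, $\partial_xF_2(p_i)F_1(p_i)>0$, and $F_2(x,0)\ne0$ for $x_i<x<x_v$; (h2) for each $x\in(x_i,x_v]$ the solution $\Gamma(t,(x,0))$ exists for $0\le t\le\overline\sigma(x)$, with $\overline\sigma(x)>0$, satisfies $\Gamma_2(t,(x,0))<0$ for $0<t<\overline\sigma(x)$, and reaches $\Sigma$ transversely at $t=\overline\sigma(x)$: $\Gamma_2(\overline\sigma(x),(x,0))=0$ and $F_2(\Gamma(\overline\sigma(x),(x,0)))\ne0$. Put $\sigma_v=\overline\sigma(x_v)$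 and $q_v=\Gamma(\sigma_v,p_v)$. For $\varepsilon_0>0$ and functions $G^\pm(t,z)$, $H^\pm(t,z;\varepsilon)$, smooth on $\mathbb R\times D$ and $\mathbb R\times D\times(-\varepsilon_0,\varepsilon_0)$ and $2\sigma_v$-periodic in $t$, consider the Filippov system $$\dot z=Z_\varepsilon(t,z)=\begin{cases}X^+_\varepsilon(t,z),&y>0,\\ X^-_\varepsilon(t,z),&y<0,\end{cases}\qquad X^\pm_\varepsilon=F^\pm+\varepsilon G^\pm+\varepsilon^2H^\pm .$$ In the extended phase space of points $(t,z)$, the switching surface $y=0$ contains the crossing region $\Sigma^c$, where $X^+_{\varepsilon,2}X^-_{\varepsilon,2}>0$, the sliding region $\Sigma^s$, where $X^+_{\varepsilon,2}<0<X^-_{\varepsilon,2}$, and the escaping region $\Sigma^e$, where $X^-_{\varepsilon,2}<0<X^+_{\varepsilon,2}$; on $\Sigma^s\cup\Sigma^e$ the sliding vector field is $\dfrac{X^-_{\varepsilon,2}X^+_\varepsilon-X^+_{\varepsilon,2}X^-_\varepsilon}{X^-_{\varepsilon,2}-X^+_{\varepsilon,2}}$. A periodic solution is a continuous periodic curve in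 $D$ made up, over a period, of finitely many arcs, each of which follows $X_\varepsilon^+$ in $y>0$, or $X_\varepsilon^-$ in $y<0$, or the sliding vector field in $\Sigma^s\cup\Sigma^e$. It is a crossing periodic solution if it meets $y=0$, and only at points of $\Sigma^c$; it is a sliding periodic solution if at least one of its arcs slides and it visits both $y>0$ and $y<0$; it slides on $\Sigma^s$ (on $\Sigma^e$) if all its points in $\Sigma^s\cup\Sigma^e$ lie in $\Sigma^s$ (in $\Sigma^e$). With $(a_1,a_2)\wedge(b_1,b_2)=a_1b_2-a_2b_1$, let, for $\theta\in\mathbb R$ and $x_i<x\le x_v$, $$M(\theta,x)=F\big(\Gamma(\overline\sigma(x),(x,0))\big)\wedge\Big(Y(\overline\sigma(x),(x,0))\int_0^{\overline\sigma(x)}Y(t,(x,0))^{-1}\big(G^-(t+\theta,\Gamma(t,(x,0)))+RG^+(-t+\theta,R\Gamma(t,(x,0)))\big)dt\Big),$$ $$g_\theta=D_z\Gamma_2(\sigma_v,p_v)\int_0^{\sigma_v}Y(t,p_v)^{-1}\big(G^-(t+\theta,\Gamma(t,p_v))-RG^+(-t+\theta,R\Gamma(t,p_v))\big)dt,$$ $$\tau_\theta=\frac{2F_2(q_v)}{F_1(p_v)\,\partial_xF_2(p_v)}\max\{G_2^+(\theta,p_v),G_2^-(\theta,p_v)\}.$$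 **Theorem B.** Suppose that $M(\theta^*,x_v)=0$ and $\dfrac{\partial M}{\partial\theta}(\theta^*,x_v)\ne0$. (a) If $G_2^+(\theta^*,p_v)\ne G_2^-(\theta^*,p_v)$ and $g_{\theta^*}>\tau_{\theta^*}$, then there are $C,\varepsilon_1>0$ such that for every $\varepsilon\in(0,\varepsilon_1)$ the system $Z_\varepsilon$ has a sliding $2\sigma_v$-periodic solution $w$ and a time $t_0$ with $|t_0-\theta^*|\le C\varepsilon$ and $\|w(t_0)-p_v\|\le C\varepsilon$. This solution slides on $\Sigma^s$ if $G_2^+(\theta^*,p_v)<G_2^-(\theta^*,p_v)$, and on $\Sigma^e$ if $G_2^+(\theta^*,p_v)>G_2^-(\theta^*,p_v)$. (b) If $g_{\theta^*}<\tau_{\theta^*}$, then there are $C,\varepsilon_1>0$ such that for every $\varepsilon\in(0,\varepsilon_1)$ the system $Z_\varepsilon$ has a crossing $2\sigma_v$-periodic solution $w$ and a time $t_0$ with $|t_0-\theta^*|\le C\varepsilon$ and $\|w(t_0)-p_v\|\le C\varepsilon$. -/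

import Mathlib

open Set
open scoped ContDiff

namespace TwoFold

/-- The plane; a point is `z = (x, y)` and the switching line is `y = 0`. -/
abbrev Plane : Type := ℝ × ℝ

/-- The involution `R (x, y) = (x, -y)`. -/
def R (z : Plane) : Plane := (z.1, -z.2)

/-- `(a₁, a₂) ∧ (b₁, b₂) = ⟨(-a₂, a₁), (b₁, b₂)⟩`. -/
def wedge (a b : Plane) : ℝ := -a.2 * b.1 + a.1 * b.2

/-- `w` solves `z' = F z`, with values in `D`, on the set of times `s`. -/
def IsSolutionOn (F : Plane → Plane) (D : Set Plane) (w : ℝ → Plane) (s : Set ℝ) : Prop :=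
  ∀ t ∈ s, w t ∈ D ∧ HasDerivWithinAt w (F (w t)) s t

/-- The solution of `z' = F z` in `D` that starts at `z` reaches `p` at time `t`. -/
def Reaches (F : Plane → Plane) (D : Set Plane) (t : ℝ) (z p : Plane) : Prop :=
  ∃ w : ℝ → Plane, IsSolutionOn F D w (uIcc 0 t) ∧ w 0 = z ∧ w t = p

/-- The solution of `z' = F z` in `D` that starts at `z` exists up to time `t`. -/
def FlowDefined (F : Plane → Plane) (D : Set Plane) (t : ℝ) (z : Plane) : Prop :=
  ∃ p, Reaches F D t z p

open Classical in
/-- The local flow `Γ(t, z)` of `z' = F z` in `D`: the value at time `t` of the solution starting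
at `z` (unique when `F` is locally Lipschitz on the open set `D`); it has the value `z` where that
solution does not exist. -/
noncomputable def flow (F : Plane → Plane) (D : Set Plane) (t : ℝ) (z : Plane) : Plane :=
  if h : FlowDefined F D t z then h.choose else z

/-- `Y(t, z) = D_z Γ(t, z)`. -/
noncomputable def flowDeriv (F : Plane → Plane) (D : Set Plane) (t : ℝ) (z : Plane) :
    Plane →L[ℝ] Plane :=
  fderiv ℝ (fun z' => flow F D t z') z

/-- `∂F₂/∂x (x, 0)`. -/
noncomputable def dxF₂ (F : Plane → Plane) (x : ℝ) : ℝ :=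
  deriv (fun s : ℝ => (F (s, 0)).2) x

/-- A visible fold `(xv, 0)` and an invisible fold `(xi, 0)`, with no tangency between them. -/
structure TwoFolds (D : Set Plane) (F : Plane → Plane) (xi xv : ℝ) : Prop where
  lt : xi < xv
  mem_v : ((xv, 0) : Plane) ∈ D
  mem_i : ((xi, 0) : Plane) ∈ D
  tangent_v : (F (xv, 0)).2 = 0
  tangent_i : (F (xi, 0)).2 = 0
  visible : dxF₂ F xv * (F (xv, 0)).1 < 0
  invisible : 0 < dxF₂ F xi * (F (xi, 0)).1
  transverse : ∀ x ∈ Ioo xi xv, (F (x, 0)).2 ≠ 0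

/-- For every `x ∈ (xi, xv]` the solution of `z' = F z` starting at `(x, 0)` stays in `y < 0` for
`0 < t < σ x` and reaches the line `y = 0` transversely at the time `σ x > 0`. -/
structure ReturnTime (D : Set Plane) (F : Plane → Plane) (xi xv : ℝ) (σ : ℝ → ℝ) : Prop where
  pos : ∀ x ∈ Ioc xi xv, 0 < σ x
  defined : ∀ x ∈ Ioc xi xv, FlowDefined F D (σ x) (x, 0)
  below : ∀ x ∈ Ioc xi xv, ∀ t ∈ Ioo 0 (σ x), (flow F D t (x, 0)).2 < 0
  hit : ∀ x ∈ Ioc xi xv, (flow F D (σ x) (x, 0)).2 = 0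
  transverse : ∀ x ∈ Ioc xi xv, (F (flow F D (σ x) (x, 0))).2 ≠ 0

/-- `Fplus z = -R F (R z)`. -/
def reversed (F : Plane → Plane) (z : Plane) : Plane := -R (F (R z))

/-- `X_ε(t, z) = F z + ε G(t, z) + ε² H(t, z; ε)`. -/
def perturb (F : Plane → Plane) (G : ℝ → Plane → Plane) (H : ℝ → Plane → ℝ → Plane) (ε : ℝ)
    (t : ℝ) (z : Plane) : Plane :=
  F z + ε • G t z + ε ^ 2 • H t z ε

/-- `G` and `H` are smooth on `ℝ × D` and `ℝ × D × (-ε₀, ε₀)`, and `T`-periodic in time. -/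
structure PeriodicPerturbation (D : Set Plane) (ε₀ T : ℝ) (G : ℝ → Plane → Plane)
    (H : ℝ → Plane → ℝ → Plane) : Prop where
  smooth_G : ContDiffOn ℝ ∞ (fun p : ℝ × Plane => G p.1 p.2) (univ ×ˢ D)
  smooth_H : ContDiffOn ℝ ∞ (fun p : ℝ × Plane × ℝ => H p.1 p.2.1 p.2.2)
    (univ ×ˢ D ×ˢ Ioo (-ε₀) ε₀)
  periodic_G : ∀ t, ∀ z ∈ D, G (t + T) z = G t z
  periodic_H : ∀ t, ∀ z ∈ D, ∀ ε ∈ Ioo (-ε₀) ε₀, H (t + T) z ε = H t z ε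

/-- The Melnikov function
`M(θ, x) = F(Γ(σ)) ∧ (Y(σ) ∫₀^σ Y(t)⁻¹ (Gm(t + θ, Γ(t)) + R Gp(-t + θ, R Γ(t))) dt)`, with
`σ = σ x`, `Γ(t) = Γ(t, (x, 0))` and `Y(t) = Y(t, (x, 0))`. -/
noncomputable def melnikov (D : Set Plane) (F : Plane → Plane) (Gp Gm : ℝ → Plane → Plane)
    (σ : ℝ → ℝ) (θ x : ℝ) : ℝ :=
  wedge (F (flow F D (σ x) (x, 0)))
    (flowDeriv F D (σ x) (x, 0)
      (∫ t in (0 : ℝ)..(σ x), (flowDeriv F D t (x, 0)).inverse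
        (Gm (t + θ) (flow F D t (x, 0)) + R (Gp (-t + θ) (R (flow F D t (x, 0)))))))

/-- The number
`g_θ = D_zΓ₂(σ, p) ∫₀^σ Y(t)⁻¹ (Gm(t + θ, Γ(t)) - R Gp(-t + θ, R Γ(t))) dt`, with `p = (xv, 0)`,
`σ = σ xv`, `Γ(t) = Γ(t, p)` and `Y(t) = Y(t, p)`. -/
noncomputable def gNumber (D : Set Plane) (F : Plane → Plane) (Gp Gm : ℝ → Plane → Plane)
    (σ : ℝ → ℝ) (xv θ : ℝ) : ℝ :=
  (flowDeriv F D (σ xv) (xv, 0)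
    (∫ t in (0 : ℝ)..(σ xv), (flowDeriv F D t (xv, 0)).inverse
      (Gm (t + θ) (flow F D t (xv, 0)) - R (Gp (-t + θ) (R (flow F D t (xv, 0))))))).2

/-- `2 F₂(q) / (F₁(p) ∂ₓF₂(p)) * max {Gp₂(θ, p), Gm₂(θ, p)}`, with `p = (xv, 0)` and
`q = Γ(σ xv, p)`. -/
noncomputable def threshold (D : Set Plane) (F : Plane → Plane) (Gp Gm : ℝ → Plane → Plane)
    (σ : ℝ → ℝ) (xv θ : ℝ) : ℝ :=
  2 * (F (flow F D (σ xv) (xv, 0))).2 / ((F (xv, 0)).1 * dxF₂ F xv) *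
    max (Gp θ (xv, 0)).2 (Gm θ (xv, 0)).2

/-! ### Filippov systems `z' = Xp(t, z)` for `y > 0`, `z' = Xm(t, z)` for `y < 0`, in the extended
phase space of points `(t, z)` with switching surface `y = 0` -/

/-- The crossing region of the switching surface. -/
def crossingRegion (Xp Xm : ℝ → Plane → Plane) : Set (ℝ × Plane) :=
  {p | p.2.2 = 0 ∧ 0 < (Xp p.1 p.2).2 * (Xm p.1 p.2).2}

/-- The (stable) sliding region: both fields point towards the switching surface. -/
def slidingRegion (Xp Xm : ℝ → Plane → Plane) : Set (ℝ × Plane) :=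
  {p | p.2.2 = 0 ∧ (Xp p.1 p.2).2 < 0 ∧ 0 < (Xm p.1 p.2).2}

/-- The escaping region: both fields point away from the switching surface. -/
def escapingRegion (Xp Xm : ℝ → Plane → Plane) : Set (ℝ × Plane) :=
  {p | p.2.2 = 0 ∧ 0 < (Xp p.1 p.2).2 ∧ (Xm p.1 p.2).2 < 0}

/-- The sliding vector field `(Xm₂ Xp - Xp₂ Xm) / (Xm₂ - Xp₂)`. -/
noncomputable def slidingField (Xp Xm : ℝ → Plane → Plane) (t : ℝ) (z : Plane) : Plane :=
  ((Xm t z).2 - (Xp t z).2)⁻¹ • ((Xm t z).2 • Xp t z - (Xp t z).2 • Xm t z)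

/-- On `(a, b)` the curve `w` slides: it lies in the sliding or escaping region and follows the
sliding vector field. -/
def SlidesDuring (Xp Xm : ℝ → Plane → Plane) (w : ℝ → Plane) (a b : ℝ) : Prop :=
  ∀ t ∈ Ioo a b, (t, w t) ∈ slidingRegion Xp Xm ∪ escapingRegion Xp Xm ∧
    HasDerivAt w (slidingField Xp Xm t (w t)) t

/-- On `(a, b)` the curve `w` follows `Xp` in `y > 0`, or `Xm` in `y < 0`, or slides. -/
def IsArc (Xp Xm : ℝ → Plane → Plane) (w : ℝ → Plane) (a b : ℝ) : Prop :=
  (∀ t ∈ Ioo a b, 0 < (w t).2 ∧ HasDerivAt w (Xp t (w t)) t) ∨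
  (∀ t ∈ Ioo a b, (w t).2 < 0 ∧ HasDerivAt w (Xm t (w t)) t) ∨
  SlidesDuring Xp Xm w a b

/-- `w : ℝ → D` is a `T`-periodic solution of the Filippov system: a continuous `T`-periodic curve
that is an arc just after and just before every time (so that, by compactness, a period is made up
of finitely many arcs). -/
def IsPeriodicSolution (Xp Xm : ℝ → Plane → Plane) (D : Set Plane) (T : ℝ) (w : ℝ → Plane) :
    Prop :=
  Continuous w ∧ (∀ t, w t ∈ D) ∧ Function.Periodic w T ∧
    ∀ a, (∃ b, a < b ∧ IsArc Xp Xm w a b) ∧ (∃ b, b < a ∧ IsArc Xp Xm w b a)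

/-- A crossing periodic solution: it meets the switching surface, and only at crossing points. -/
def IsCrossingPeriodicSolution (Xp Xm : ℝ → Plane → Plane) (D : Set Plane) (T : ℝ)
    (w : ℝ → Plane) : Prop :=
  IsPeriodicSolution Xp Xm D T w ∧ (∃ t, (w t).2 = 0) ∧
    ∀ t, (w t).2 = 0 → (t, w t) ∈ crossingRegion Xp Xm

/-- A sliding periodic solution: it slides during some time interval. A solution that never leaves
the switching surface is not counted: it has to visit both `y > 0` and `y < 0`. -/
def IsSlidingPeriodicSolution (Xp Xm : ℝ → Plane → Plane) (D : Set Plane) (T : ℝ)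
    (w : ℝ → Plane) : Prop :=
  IsPeriodicSolution Xp Xm D T w ∧ (∃ a b, a < b ∧ SlidesDuring Xp Xm w a b) ∧
    (∃ t, 0 < (w t).2) ∧ (∃ t, (w t).2 < 0)

/-- All the sliding or escaping points of `w` lie in `S`. -/
def SlidesOn (Xp Xm : ℝ → Plane → Plane) (S : Set (ℝ × Plane)) (w : ℝ → Plane) : Prop :=
  ∀ t, (t, w t) ∈ slidingRegion Xp Xm ∪ escapingRegion Xp Xm → (t, w t) ∈ S

end TwoFold

open TwoFold

/-! Write `p = (xv, 0)`, `q = Γ(S, p)`, `a = F₁(p)`, `b = ∂ₓF₂(p)`. Everything is decided at the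
scale `ε` around the visible fold `p`. Follow `X⁻` forwards from `(xv + ε ξ₁, 0)` at time `t₀`, and
`X⁺` backwards from `(xv + ε ξ₂, 0)` at time `t₀ - ε η`. After the reflection `R`, the second curve
is again a trajectory below `y = 0` of a perturbation of `F`, with `rev Gp` in place of the upper
perturbation. With durations `S (1 + ε ρ)` and `S (1 - ε ρ) - ε η`, the two curves end at `q + ε P`
and `q + ε Q`.

For `ε = 0` variation of constants gives `P = (ρ S + ξ₁ / a) F(q) + I(θ)` and `Q = (-ρ S - η + ξ₂ /
a) F(q) + J(-θ)`, with `I`, `J` the integrals `duhamel` of the two perturbations. Indeed the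
displacement `(ξ, 0)` is parallel to `F(p)`, hence is carried to a multiple of `F(q)`, and so is the
effect of a change of duration. Meeting on `y = 0` amounts to three equations: `F(q) ∧ (P - Q) = 0`,
whose limit is `M(θ) = 0`; `(P + Q)₂ = 0`, whose limit is `F₂(q) (-η + (ξ₁ + ξ₂) / a) + g_θ = 0`;
and `P₂ = 0`, which fixes `ρ`. If `ξ₁, ξ₂, η` depend on one more parameter `κ`, the Jacobian in `(θ,
κ, ρ)` is triangular and the implicit function theorem applies (`exists_matching`).

Crossing solutions come from `ξ₁ = ξ₂ = κ`, `η = 0`. The vertical components at the start are `ε (b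
κ + G₂^±)` to first order, and `g_θ < τ_θ` says exactly that both are negative for the limit value
of `κ` (`VisibleLoop.exists_crossing`). If `g_θ > τ_θ` and `G₂⁺ < G₂⁻`, the lower arc leaves instead
from the fold of `X⁻`, and the upper arc lands in the sliding region and slides to that fold during
a time `ε κ`. At this scale sliding is an explicit linear scalar equation, and the intermediate
value theorem supplies the limit of `κ` (`exists_slide_time`, `VisibleLoop.exists_sliding`). The
escaping case is the image of the sliding one under `(t, z) ↦ (-t, R z)`.

Since `F` is only of class `C²`, dividing by `ε` needs care. The state is split as `z = x + ε w`
along the unperturbed trajectory `x`, and `(F(x + ε w) - F(x)) / ε` extends to a `C¹` function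
across `ε = 0` (`contDiffAt_hadamard`). The equation for `w` thus has a `C¹` field, and dependence
of its solutions on parameters follows from the implicit function theorem in `C([0, 1], E)`
(`exists_solution_family`). Strict differentiability at the limit point suffices for all later
implicit function arguments. The sign argument `neg_of_fold` keeps the perturbed arcs below `y = 0`.
-/

open Filter Topology

namespace TwoFold

set_option linter.unusedSectionVars false

/-! ### Superposition operators on spaces of continuous curves -/

section Superposition

variable {K : Type*} [TopologicalSpace K] [CompactSpace K]
  {E F : Type*} [NormedAddCommGroup E] [NormedSpace ℝ E] [NormedAddCommGroup F] [NormedSpace ℝ F]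

/-- A property that holds near the graph of a curve holds along all nearby curves. -/
theorem eventually_forall_curve {Q : K → E → Prop} {u₀ : C(K, E)}
    (h : ∀ t, ∀ᶠ p : K × E in 𝓝 (t, u₀ t), Q p.1 p.2) :
    ∀ᶠ u in 𝓝 u₀, ∀ t, Q t (u t) := by
  have := isCompact_univ.eventually_forall_of_forall_eventually (x₀ := u₀)
    (P := fun (u : C(K, E)) (t : K) => Q t (u t)) (K := univ) (by
      intro t _
      have hc : Continuous fun z : C(K, E) × K => (z.2, z.1 z.2) := by fun_prop
      exact (hc.tendsto (u₀, t)).eventually (h t))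
  simpa using this

/-- The superposition operator `u ↦ f ∘ u` (zero where `f ∘ u` is not continuous). -/
noncomputable def superpos (f : E → F) (u : C(K, E)) : C(K, F) :=
  ContinuousMap.mkD (fun t => f (u t)) 0

theorem superpos_apply {f : E → F} {u : C(K, E)} (h : ∀ t, ContinuousAt f (u t)) (t : K) :
    superpos f u t = f (u t) := by
  have : Continuous fun t => f (u t) :=
    continuous_iff_continuousAt.2 fun t => (h t).comp (u.continuous.continuousAt)
  rw [superpos, ContinuousMap.mkD_apply_of_continuous this]

theorem eventually_forall_of_eventually {p : E → Prop} {u₀ : C(K, E)}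
    (h : ∀ t, ∀ᶠ x in 𝓝 (u₀ t), p x) : ∀ᶠ u in 𝓝 u₀, ∀ t, p (u t) :=
  eventually_forall_curve (Q := fun _ x => p x) fun t => by
    rw [nhds_prod_eq]; exact (h t).prod_inr _

theorem eventually_superpos_apply {f : E → F} {u₀ : C(K, E)}
    (h : ∀ t, ∀ᶠ x in 𝓝 (u₀ t), ContinuousAt f x) :
    ∀ᶠ u in 𝓝 u₀, ∀ t, superpos f u t = f (u t) :=
  (eventually_forall_of_eventually h).mono fun _ hu t => superpos_apply hu t

theorem continuousAt_superpos {f : E → F} {u₀ : C(K, E)}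
    (h : ∀ t, ∀ᶠ x in 𝓝 (u₀ t), ContinuousAt f x) : ContinuousAt (superpos (K := K) f) u₀ := by
  rw [Metric.continuousAt_iff']
  intro ε hε
  have h0 := eventually_superpos_apply h
  have hself := h0.self_of_nhds
  have h1 : ∀ᶠ u in 𝓝 u₀, ∀ t, dist (f (u t)) (f (u₀ t)) < ε := by
    refine eventually_forall_curve (Q := fun t x => dist (f x) (f (u₀ t)) < ε) fun t => ?_
    have hc : ContinuousAt f (u₀ t) := (h t).self_of_nhds
    have h2 : Tendsto (fun p : K × E => dist (f p.2) (f (u₀ p.1))) (𝓝 (t, u₀ t)) (𝓝 0) := by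
      have e1 : Tendsto (fun p : K × E => f p.2) (𝓝 (t, u₀ t)) (𝓝 (f (u₀ t))) :=
        hc.tendsto.comp continuousAt_snd
      have e2 : Tendsto (fun p : K × E => f (u₀ p.1)) (𝓝 (t, u₀ t)) (𝓝 (f (u₀ t))) :=
        hc.tendsto.comp ((u₀.continuous.tendsto t).comp continuousAt_fst)
      simpa using e1.dist e2
    exact h2.eventually (gt_mem_nhds hε)
  filter_upwards [h0, h1] with u hu hu1
  rw [ContinuousMap.dist_lt_iff hε]
  intro t
  rw [hu, hself]
  exact hu1 t

/-- Pointwise application of a curve of operators to a curve of vectors. -/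
noncomputable def pointwiseApply : C(K, E →L[ℝ] F) →L[ℝ] C(K, E) →L[ℝ] C(K, F) :=
  LinearMap.mkContinuous₂
    (LinearMap.mk₂ ℝ
      (fun (B : C(K, E →L[ℝ] F)) (v : C(K, E)) => (⟨fun t => B t (v t), by fun_prop⟩ : C(K, F)))
      (fun _ _ _ => by ext; simp) (fun _ _ _ => by ext; simp)
      (fun _ _ _ => by ext; simp) (fun _ _ _ => by ext; simp)) 1
    (fun B v => by
      rw [ContinuousMap.norm_le _ (by positivity)]
      intro t
      rw [one_mul]
      exact (B t).le_of_opNorm_le_of_le (B.norm_coe_le_norm t) (v.norm_coe_le_norm t))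

@[simp] theorem pointwiseApply_apply (B : C(K, E →L[ℝ] F)) (v : C(K, E)) (t : K) :
    pointwiseApply B v t = B t (v t) := rfl

theorem continuousAt_fderiv_of_contDiffAt {f : E → F} {x : E} (h : ContDiffAt ℝ 1 f x) :
    ContinuousAt (fderiv ℝ f) x :=
  (h.fderiv_right (m := 0) (by norm_num)).continuousAt

theorem eventually_contDiffAt_one {f : E → F} {x : E} (h : ContDiffAt ℝ 1 f x) :
    ∀ᶠ y in 𝓝 x, ContDiffAt ℝ 1 f y := h.eventually (by simp)

/-- Compactness of `K` makes the first order expansions of `f` at the points of the curve uniform,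
so they add up to an expansion in the sup norm. -/
theorem hasFDerivAt_superpos {f : E → F} {u₀ : C(K, E)} (h : ∀ t, ContDiffAt ℝ 1 f (u₀ t)) :
    HasFDerivAt (superpos (K := K) f) (pointwiseApply (superpos (fderiv ℝ f) u₀)) u₀ := by
  rw [hasFDerivAt_iff_isLittleO, Asymptotics.isLittleO_iff]
  intro c hc
  have hev := fun t => (eventually_contDiffAt_one (h t)).mono fun _ => ContDiffAt.continuousAt
  have h0 := eventually_superpos_apply hev
  have h0self := h0.self_of_nhds
  have hd : ∀ t, superpos (fderiv ℝ f) u₀ t = fderiv ℝ f (u₀ t) :=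
    fun t => superpos_apply (fun t => continuousAt_fderiv_of_contDiffAt (h t)) t
  have h1 : ∀ᶠ u in 𝓝 u₀, ∀ t,
      ‖f (u t) - f (u₀ t) - fderiv ℝ f (u₀ t) (u t - u₀ t)‖ ≤ c * ‖u t - u₀ t‖ := by
    refine eventually_forall_curve (Q := fun t x =>
      ‖f x - f (u₀ t) - fderiv ℝ f (u₀ t) (x - u₀ t)‖ ≤ c * ‖x - u₀ t‖) fun t => ?_
    -- The base point `u₀ s` moves with `s`, so an expansion at the single point `u₀ t` must
    -- tolerate moving base points: this is strict differentiability. Half of `c` pays for it, half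
    -- for replacing the derivative at `u₀ t` by the one at `u₀ s`.
    have hs := ((h t).hasStrictFDerivAt (by simp)).isLittleO
    rw [Asymptotics.isLittleO_iff] at hs
    have hs2 := hs (half_pos hc)
    have hcont : Tendsto (fun p : K × E => (p.2, u₀ p.1)) (𝓝 (t, u₀ t)) (𝓝 (u₀ t, u₀ t)) := by
      have : Continuous fun p : K × E => (p.2, u₀ p.1) := by fun_prop
      exact this.tendsto (t, u₀ t)
    have e1 := hcont.eventually hs2
    have e2 : ∀ᶠ p : K × E in 𝓝 (t, u₀ t),
        dist (fderiv ℝ f (u₀ p.1)) (fderiv ℝ f (u₀ t)) < c / 2 := by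
      have : Tendsto (fun p : K × E => fderiv ℝ f (u₀ p.1)) (𝓝 (t, u₀ t))
          (𝓝 (fderiv ℝ f (u₀ t))) :=
        (continuousAt_fderiv_of_contDiffAt (h t)).tendsto.comp
          ((u₀.continuous.tendsto t).comp continuousAt_fst)
      exact this.eventually (Metric.ball_mem_nhds _ (half_pos hc))
    filter_upwards [e1, e2] with p hp1 hp2
    rw [dist_eq_norm] at hp2
    have : f p.2 - f (u₀ p.1) - fderiv ℝ f (u₀ p.1) (p.2 - u₀ p.1) =
        (f p.2 - f (u₀ p.1) - fderiv ℝ f (u₀ t) (p.2 - u₀ p.1)) -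
        (fderiv ℝ f (u₀ p.1) - fderiv ℝ f (u₀ t)) (p.2 - u₀ p.1) := by
      simp
    rw [this]
    refine (norm_sub_le _ _).trans ?_
    have := ContinuousLinearMap.le_of_opNorm_le _ hp2.le (p.2 - u₀ p.1)
    linarith
  filter_upwards [h0, h1] with u hu hu1
  rw [ContinuousMap.norm_le _ (by positivity)]
  intro t
  have := hu1 t
  have h3 := (u - u₀).norm_coe_le_norm t
  simp only [ContinuousMap.sub_apply, pointwiseApply_apply, hu, h0self, hd] at h3 ⊢
  exact this.trans (by gcongr)

/-- The hypothesis persists for all nearby curves, and the derivative is itself a superposition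
operator, applied to `fderiv ℝ f`, hence continuous. -/
theorem contDiffAt_superpos {f : E → F} {u₀ : C(K, E)} (h : ∀ t, ContDiffAt ℝ 1 f (u₀ t)) :
    ContDiffAt ℝ 1 (superpos (K := K) f) u₀ := by
  rw [contDiffAt_one_iff]
  have hev := eventually_forall_of_eventually fun t => eventually_contDiffAt_one (h t)
  refine ⟨fun u => pointwiseApply (superpos (fderiv ℝ f) u), _, hev, ?_, ?_⟩
  · intro u hu
    refine (pointwiseApply.continuous.continuousAt.comp
      (continuousAt_superpos fun t => ?_)).continuousWithinAt
    exact (eventually_contDiffAt_one (hu t)).mono fun _ => continuousAt_fderiv_of_contDiffAt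
  · intro u hu
    exact hasFDerivAt_superpos hu

/-- The constant curves. -/
noncomputable def constCurve : E →L[ℝ] C(K, E) :=
  LinearMap.mkContinuous
    { toFun := fun x => ContinuousMap.const K x
      map_add' := fun _ _ => rfl
      map_smul' := fun _ _ => rfl } 1 (fun x => by
      rw [ContinuousMap.norm_le _ (by positivity)]
      intro t
      exact (one_mul ‖x‖).ge)

@[simp] theorem constCurve_apply (x : E) (t : K) : constCurve (K := K) x t = x := rfl

end Superposition

/-! ### Linear Volterra operators -/

section Volterra

open unitInterval

variable {E : Type*} [NormedAddCommGroup E] [NormedSpace ℝ E]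

/-- The extension to `ℝ` of a curve on `[0, 1]`. -/
noncomputable def ext (v : C(I, E)) (s : ℝ) : E := v (projIcc 0 1 zero_le_one s)

theorem continuous_ext (v : C(I, E)) : Continuous (ext v) :=
  v.continuous.comp continuous_projIcc

theorem ext_of_mem (v : C(I, E)) {s : ℝ} (hs : s ∈ Icc (0 : ℝ) 1) : ext v s = v ⟨s, hs⟩ := by
  rw [ext, projIcc_of_mem _ hs]

theorem norm_ext_le (v : C(I, E)) (s : ℝ) : ‖ext v s‖ ≤ ‖v‖ := v.norm_coe_le_norm _

/-- Integration from `0`. -/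
noncomputable def primitive : C(I, E) →L[ℝ] C(I, E) :=
  LinearMap.mkContinuous
    { toFun := fun v => ⟨fun t => ∫ s in (0 : ℝ)..t, ext v s,
        (intervalIntegral.continuous_primitive
          (fun a b => (continuous_ext v).intervalIntegrable a b) 0).comp continuous_subtype_val⟩
      map_add' := fun v w => by
        ext t
        exact intervalIntegral.integral_add ((continuous_ext v).intervalIntegrable _ _)
          ((continuous_ext w).intervalIntegrable _ _)
      map_smul' := fun c v => by
        ext t
        exact intervalIntegral.integral_smul c _ } 1 (fun v => by
      rw [ContinuousMap.norm_le _ (by positivity)]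
      intro t
      refine (intervalIntegral.norm_integral_le_of_norm_le_const
        (fun s _ => norm_ext_le v s)).trans ?_
      rw [sub_zero, abs_of_nonneg t.2.1, one_mul]
      exact mul_le_of_le_one_right (norm_nonneg _) t.2.2)

theorem primitive_apply (v : C(I, E)) (t : I) : primitive v t = ∫ s in (0 : ℝ)..t, ext v s := rfl

/-- Each further integration turns `s ^ n` into `t ^ (n + 1) / (n + 1)`; the resulting factorial
beats any size of `B`. -/
theorem norm_volterra_iterate_le (B : C(I, E →L[ℝ] E)) (n : ℕ) (v : C(I, E)) (t : I) :
    ‖((primitive ∘L pointwiseApply B) ^ n) v t‖ ≤ ‖B‖ ^ n * t ^ n / n.factorial * ‖v‖ := by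
  induction n generalizing t with
  | zero => simpa using v.norm_coe_le_norm t
  | succ n ih =>
    rw [pow_succ', mul_apply_eq_comp, ContinuousLinearMap.comp_apply, primitive_apply]
    set w := ((primitive ∘L pointwiseApply B) ^ n) v
    have hb : ∀ s ∈ Ioc (0 : ℝ) t,
        ‖ext (pointwiseApply B w) s‖ ≤ ‖B‖ ^ (n + 1) / n.factorial * ‖v‖ * s ^ n := by
      intro s hs
      have hs' : s ∈ Icc (0 : ℝ) 1 := ⟨hs.1.le, hs.2.trans t.2.2⟩
      rw [ext_of_mem _ hs', pointwiseApply_apply]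
      refine ((B ⟨s, hs'⟩).le_of_opNorm_le_of_le (B.norm_coe_le_norm _) (ih ⟨s, hs'⟩)).trans
        (le_of_eq ?_)
      simp only
      ring
    refine (intervalIntegral.norm_integral_le_of_norm_le t.2.1
      (Filter.Eventually.of_forall hb) (Continuous.intervalIntegrable (by fun_prop) _ _)).trans (le_of_eq ?_)
    rw [intervalIntegral.integral_const_mul, integral_pow, Nat.factorial_succ]
    push_cast
    have : (n.factorial : ℝ) ≠ 0 := by positivity
    have : (n + 1 : ℝ) ≠ 0 := by positivity
    field_simp
    simp

/-- Some power of the operator is a strict contraction although the operator itself need not be.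
This inverts the linearised integral equation on the whole of `[0, 1]`, without subdividing the
interval. -/
theorem isUnit_one_sub_volterra [CompleteSpace E] (B : C(I, E →L[ℝ] E)) :
    IsUnit (1 - primitive ∘L pointwiseApply B : C(I, E) →L[ℝ] C(I, E)) := by
  set T : C(I, E) →L[ℝ] C(I, E) := primitive ∘L pointwiseApply B
  obtain ⟨n, hn⟩ : ∃ n : ℕ, ‖B‖ ^ n / n.factorial < 1 :=
    ((FloorSemiring.tendsto_pow_div_factorial_atTop ‖B‖).eventually (gt_mem_nhds one_pos)).exists
  have hT : ‖T ^ n‖ < 1 := by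
    refine lt_of_le_of_lt (ContinuousLinearMap.opNorm_le_bound _ (by positivity) fun v => ?_) hn
    rw [ContinuousMap.norm_le _ (by positivity)]
    intro t
    refine (norm_volterra_iterate_le B n v t).trans ?_
    gcongr
    exact mul_le_of_le_one_right (by positivity) (pow_le_one₀ t.2.1 t.2.2)
  have hu : IsUnit (1 - T ^ n) := (isUnit_one_sub_of_norm_lt_one (R := C(I, E) →L[ℝ] C(I, E)) hT)
  -- `1 - T ^ n` is the product of `1 - T` and a geometric sum that commutes with it, so both
  -- factors are units.
  rw [← mul_neg_geom_sum T n] at hu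
  have hc : Commute (1 - T) (∑ i ∈ Finset.range n, T ^ i) :=
    Commute.sum_right _ _ _ fun i _ =>
      ((Commute.one_left T).sub_left (Commute.refl T)).pow_right i
  exact (hc.isUnit_mul_iff.1 hu).1

end Volterra

end TwoFold

namespace TwoFold

set_option linter.unusedSectionVars false

/-! ### Existence, uniqueness and differentiable dependence for differential equations -/

section Dependence

open unitInterval

variable {E : Type*} [NormedAddCommGroup E] [NormedSpace ℝ E] [CompleteSpace E]

/-- The restriction to `[0, 1]` of a function that is continuous there. -/
noncomputable def restrictCurve (w : ℝ → E) (hw : ContinuousOn w (Icc 0 1)) : C(I, E) :=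
  ⟨fun t => w t, hw.domRestrict⟩

theorem hasDerivWithinAt_ext_primitive (v : C(I, E)) (y : E) {u : C(I, E)}
    (h : u = constCurve y + primitive v) {t : ℝ} (ht : t ∈ Icc (0 : ℝ) 1) :
    HasDerivWithinAt (ext u) (ext v t) (Icc 0 1) t := by
  have h1 : HasDerivAt (fun t => y + ∫ s in (0 : ℝ)..t, ext v s) (ext v t) t :=
    (intervalIntegral.integral_hasDerivAt_right ((continuous_ext v).intervalIntegrable _ _)
      ((continuous_ext v).stronglyMeasurableAtFilter _ _)
      (continuous_ext v).continuousAt).const_add y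
  refine h1.hasDerivWithinAt.congr_of_mem (fun s hs => ?_) ht
  rw [ext_of_mem _ hs, h]
  rfl

theorem eq_constCurve_add_primitive {w : ℝ → E} {v : C(I, E)}
    (h : ∀ t ∈ Icc (0 : ℝ) 1, HasDerivWithinAt w (ext v t) (Icc 0 1) t)
    (hw : ContinuousOn w (Icc 0 1)) :
    restrictCurve w hw = constCurve (w 0) + primitive v := by
  ext t
  have : ∫ s in (0 : ℝ)..t, ext v s = w t - w 0 := by
    refine intervalIntegral.integral_eq_sub_of_hasDerivAt_of_le t.2.1
      (hw.mono (Icc_subset_Icc_right t.2.2)) (fun s hs => ?_)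
      ((continuous_ext v).intervalIntegrable _ _)
    exact (h s ⟨hs.1.le, hs.2.le.trans t.2.2⟩).hasDerivAt
      (Icc_mem_nhds hs.1 (hs.2.trans_le t.2.2))
  change w t = w 0 + ∫ s in (0 : ℝ)..t, ext v s
  rw [this, add_sub_cancel]

/-- Differentiable dependence of solutions on the initial value. -/
theorem exists_solution_family {V : E → E} {w : ℝ → E}
    (hw : ∀ t ∈ Icc (0 : ℝ) 1, HasDerivWithinAt w (V (w t)) (Icc 0 1) t)
    (hV : ∀ t ∈ Icc (0 : ℝ) 1, ContDiffAt ℝ 1 V (w t)) :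
    ∃ (U : E → C(I, E)) (U' : E →L[ℝ] C(I, E)), HasStrictFDerivAt U U' (w 0) ∧
      (∀ t ∈ Icc (0 : ℝ) 1, ext (U (w 0)) t = w t) ∧
      (∀ h, ∀ t ∈ Icc (0 : ℝ) 1, HasDerivWithinAt (ext (U' h))
        (fderiv ℝ V (w t) (ext (U' h) t)) (Icc 0 1) t) ∧ (∀ h, ext (U' h) 0 = h) ∧
      ∀ᶠ y in 𝓝 (w 0), ext (U y) 0 = y ∧ ∀ t ∈ Icc (0 : ℝ) 1,
        HasDerivWithinAt (ext (U y)) (V (ext (U y) t)) (Icc 0 1) t := by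
  have hc : ContinuousOn w (Icc 0 1) := fun t ht => (hw t ht).continuousWithinAt
  set u₀ : C(I, E) := restrictCurve w hc with hu₀
  have hu₀t : ∀ t, u₀ t = w t := fun t => rfl
  have hVu : ∀ t, ContDiffAt ℝ 1 V (u₀ t) := fun t => hV t t.2
  have hN := hasFDerivAt_superpos hVu
  set B := superpos (fderiv ℝ V) u₀ with hB
  have hBt : ∀ t, B t = fderiv ℝ V (u₀ t) :=
    superpos_apply fun t => continuousAt_fderiv_of_contDiffAt (hVu t)
  have hNs : HasStrictFDerivAt (superpos V) (pointwiseApply B) u₀ :=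
    (contDiffAt_superpos hVu).hasStrictFDerivAt' hN (by simp)
  -- The zeros of `Ψ` are the pairs of an initial value and a solution of the integral equation. Its
  -- partial derivative in the curve is the identity minus a Volterra operator, hence invertible.
  let Ψ : E × C(I, E) → C(I, E) := fun p => p.2 - constCurve p.1 - primitive (superpos V p.2)
  let Ψ' : E × C(I, E) →L[ℝ] C(I, E) := .snd ℝ E C(I, E) - constCurve ∘L .fst ℝ E C(I, E) -
    primitive ∘L pointwiseApply B ∘L .snd ℝ E C(I, E)
  have hΨ : HasStrictFDerivAt Ψ Ψ' (w 0, u₀) := by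
    refine (hasStrictFDerivAt_snd.sub
      (constCurve ∘L .fst ℝ E C(I, E)).hasStrictFDerivAt).sub ?_
    have h2 : HasStrictFDerivAt (fun p : E × C(I, E) => superpos V p.2)
        (pointwiseApply B ∘L .snd ℝ E C(I, E)) (w 0, u₀) :=
      HasStrictFDerivAt.comp (w 0, u₀) hNs hasStrictFDerivAt_snd
    have h3 : HasStrictFDerivAt (primitive (E := E)) primitive (superpos V u₀) :=
      (primitive (E := E)).hasStrictFDerivAt
    exact HasStrictFDerivAt.comp (w 0, u₀) h3 h2
  have hinr : Ψ' ∘L .inr ℝ E C(I, E) = 1 - primitive ∘L pointwiseApply B := by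
    ext v
    simp [Ψ']
  have hinv : (Ψ' ∘L .inr ℝ E C(I, E)).IsInvertible := by
    rw [hinr]
    obtain ⟨e, he⟩ := isUnit_one_sub_volterra B
    rw [← he]
    exact ⟨ContinuousLinearEquiv.unitsEquiv ℝ _ e, rfl⟩
  have hV0 : ∀ᶠ u in 𝓝 u₀, ∀ t, superpos V u t = V (u t) :=
    eventually_superpos_apply fun t =>
      (eventually_contDiffAt_one (hVu t)).mono fun _ => ContDiffAt.continuousAt
  have hΨ0 : Ψ (w 0, u₀) = 0 := by
    have : u₀ = constCurve (w 0) + primitive (superpos V u₀) := by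
      refine eq_constCurve_add_primitive (fun t ht => ?_) hc
      rw [ext_of_mem _ ht, hV0.self_of_nhds]
      exact hw t ht
    simp only [Ψ]
    rw [sub_sub, sub_eq_zero]
    exact this
  set U := hΨ.implicitFunctionOfProdDomain hinv
  have hU0 : U (w 0) = u₀ :=
    (hΨ.eventually_apply_eq_iff_implicitFunctionOfProdDomain hinv).self_of_nhds.1 rfl
  have hUd := hΨ.hasStrictFDerivAt_implicitFunctionOfProdDomain hinv
  set U' := -(Ψ' ∘L .inr ℝ E C(I, E)).inverse ∘L (Ψ' ∘L .inl ℝ E C(I, E))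
  -- The derivative given by the implicit function theorem satisfies the integrated variational
  -- equation.
  have hU' : ∀ h, U' h = constCurve h + primitive (pointwiseApply B (U' h)) := by
    intro h
    have h1 : (Ψ' ∘L .inr ℝ E C(I, E)) (U' h) = constCurve h := by
      obtain ⟨e, he⟩ := hinv
      simp only [U', ← he]
      simp [Ψ']
    rw [hinr] at h1
    rw [← h1]
    simp
  refine ⟨U, U', hUd, fun t ht => ?_, fun h t ht => ?_, fun h => ?_, ?_⟩
  · rw [hU0, ext_of_mem _ ht, hu₀t]
  · have := hasDerivWithinAt_ext_primitive _ _ (hU' h) ht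
    rw [ext_of_mem _ ht, pointwiseApply_apply, hBt] at this
    rwa [ext_of_mem _ ht]
  · rw [hU' h, ext_of_mem _ ⟨le_rfl, zero_le_one⟩]
    simp [primitive_apply]
  · have ht := hΨ.tendsto_implicitFunctionOfProdDomain hinv
    filter_upwards [hΨ.eventually_apply_implicitFunctionOfProdDomain hinv, ht.eventually hV0]
      with y hy hyV
    have hy' : U y = constCurve y + primitive (superpos V (U y)) := by
      rw [hΨ0] at hy
      simp only [Ψ] at hy
      rwa [sub_sub, sub_eq_zero] at hy
    refine ⟨?_, fun t ht => ?_⟩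
    · rw [hy', ext_of_mem _ ⟨le_rfl, zero_le_one⟩]
      simp [primitive_apply]
    · have := hasDerivWithinAt_ext_primitive _ _ hy' ht
      rw [ext_of_mem _ ht, hyV] at this
      rwa [ext_of_mem _ ht]

/-- Solutions of linear equations exist. -/
theorem exists_linear_solution {B : ℝ → E →L[ℝ] E} {g : ℝ → E}
    (hB : ContinuousOn B (Icc 0 1)) (hg : ContinuousOn g (Icc 0 1)) (y : E) :
    ∃ w : ℝ → E, w 0 = y ∧ ∀ t ∈ Icc (0 : ℝ) 1,
      HasDerivWithinAt w (B t (w t) + g t) (Icc 0 1) t := by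
  obtain ⟨e, he⟩ := isUnit_one_sub_volterra (restrictCurve B hB)
  set v := constCurve y + primitive (restrictCurve g hg)
  obtain ⟨u, hu⟩ : ∃ u, (1 - primitive ∘L pointwiseApply (restrictCurve B hB)) u = v := by
    refine ⟨(↑e⁻¹ : C(I, E) →L[ℝ] C(I, E)) v, ?_⟩
    rw [← he, ← mul_apply_eq_comp, Units.mul_inv]
    rfl
  have hu' : u = constCurve y +
      primitive (pointwiseApply (restrictCurve B hB) u + restrictCurve g hg) := by
    have : u - primitive (pointwiseApply (restrictCurve B hB) u) = v := hu
    rw [map_add, add_comm (primitive _), ← add_assoc]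
    exact sub_eq_iff_eq_add.1 this
  refine ⟨ext u, ?_, fun t ht => ?_⟩
  · rw [hu', ext_of_mem _ ⟨le_rfl, zero_le_one⟩]
    simp [primitive_apply]
  · have := hasDerivWithinAt_ext_primitive _ _ hu' ht
    rw [ext_of_mem _ ht] at this
    rw [ext_of_mem _ ht]
    exact this

/-- Solutions of linear equations are unique. -/
theorem eq_of_linear {B : ℝ → E →L[ℝ] E} {g w₁ w₂ : ℝ → E} {a b : ℝ}
    (hB : ContinuousOn B (Icc a b))
    (h₁ : ∀ t ∈ Icc a b, HasDerivWithinAt w₁ (B t (w₁ t) + g t) (Icc a b) t)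
    (h₂ : ∀ t ∈ Icc a b, HasDerivWithinAt w₂ (B t (w₂ t) + g t) (Icc a b) t)
    (h0 : w₁ a = w₂ a) : EqOn w₁ w₂ (Icc a b) := by
  obtain ⟨C, hC⟩ := isCompact_Icc.exists_bound_of_continuousOn hB
  have hC' : ∀ t ∈ Ico a b, LipschitzOnWith C.toNNReal (fun x => B t x + g t) univ := by
    intro t ht
    refine LipschitzOnWith.of_dist_le_mul fun x _ y _ => ?_
    rw [dist_add_right, dist_eq_norm, dist_eq_norm, ← map_sub]
    refine ((B t).le_opNorm _).trans ?_
    gcongr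
    exact (hC t (Ico_subset_Icc_self ht)).trans (Real.le_coe_toNNReal C)
  have aux : ∀ w : ℝ → E,
      (∀ t ∈ Icc a b, HasDerivWithinAt w (B t (w t) + g t) (Icc a b) t) → ∀ t ∈ Ico a b,
      HasDerivWithinAt w (B t (w t) + g t) (Ici t) t := fun w h t ht =>
    ((h t (Ico_subset_Icc_self ht)).mono (Icc_subset_Icc_left ht.1)).mono_of_mem_nhdsWithin
      (Icc_mem_nhdsGE ht.2)
  exact ODE_solution_unique_of_mem_Icc_right hC' (fun t ht => (h₁ t ht).continuousWithinAt)
    (aux _ h₁) (fun _ _ => mem_univ _) (fun t ht => (h₂ t ht).continuousWithinAt)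
    (aux _ h₂) (fun _ _ => mem_univ _) h0

/-- Solutions of autonomous equations with a continuously differentiable field are unique. -/
theorem eq_of_contDiffAt {V : E → E} {w₁ w₂ : ℝ → E} {a b : ℝ}
    (hV : ∀ t ∈ Icc a b, ContDiffAt ℝ 1 V (w₁ t)) (hV₂ : ∀ t ∈ Icc a b, ContDiffAt ℝ 1 V (w₂ t))
    (h₁ : ∀ t ∈ Icc a b, HasDerivWithinAt w₁ (V (w₁ t)) (Icc a b) t)
    (h₂ : ∀ t ∈ Icc a b, HasDerivWithinAt w₂ (V (w₂ t)) (Icc a b) t)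
    (h0 : w₁ a = w₂ a) : EqOn w₁ w₂ (Icc a b) := by
  have c₁ : ContinuousOn w₁ (Icc a b) := fun t ht => (h₁ t ht).continuousWithinAt
  have c₂ : ContinuousOn w₂ (Icc a b) := fun t ht => (h₂ t ht).continuousWithinAt
  -- The two trajectories form a compact set, on which a locally Lipschitz field is Lipschitz; no
  -- convexity is required.
  have hl : LocallyLipschitzOn (w₁ '' Icc a b ∪ w₂ '' Icc a b) V := by
    rintro x (⟨t, ht, rfl⟩ | ⟨t, ht, rfl⟩)
    · obtain ⟨K, s, hs, hK⟩ := (hV t ht).exists_lipschitzOnWith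
      exact ⟨K, s, mem_nhdsWithin_of_mem_nhds hs, hK⟩
    · obtain ⟨K, s, hs, hK⟩ := (hV₂ t ht).exists_lipschitzOnWith
      exact ⟨K, s, mem_nhdsWithin_of_mem_nhds hs, hK⟩
  obtain ⟨K, hK⟩ := hl.exists_lipschitzOnWith_of_compact
    ((isCompact_Icc.image_of_continuousOn c₁).union (isCompact_Icc.image_of_continuousOn c₂))
  have aux : ∀ w : ℝ → E,
      (∀ t ∈ Icc a b, HasDerivWithinAt w (V (w t)) (Icc a b) t) → ∀ t ∈ Ico a b,
      HasDerivWithinAt w (V (w t)) (Ici t) t := fun w h t ht =>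
    ((h t (Ico_subset_Icc_self ht)).mono (Icc_subset_Icc_left ht.1)).mono_of_mem_nhdsWithin
      (Icc_mem_nhdsGE ht.2)
  exact ODE_solution_unique_of_mem_Icc_right (v := fun _ => V) (s := fun _ => _) (fun _ _ => hK)
    c₁ (aux _ h₁) (fun t ht => Or.inl (mem_image_of_mem _ (Ico_subset_Icc_self ht))) c₂
    (aux _ h₂) (fun t ht => Or.inr (mem_image_of_mem _ (Ico_subset_Icc_self ht))) h0

end Dependence

/-! ### Difference quotients as differentiable functions -/

section Hadamard

open unitInterval

variable {E F : Type*} [NormedAddCommGroup E] [NormedSpace ℝ E] [NormedAddCommGroup F]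
  [NormedSpace ℝ F] [CompleteSpace F]

/-- The segment from `x` to `x + ε w`. -/
noncomputable def segmentCurve (p : E × ℝ × E) : C(I, E) :=
  constCurve p.1 + p.2.1 • pointwiseApply (K := I) ⟨fun s => (s : ℝ) • .id ℝ E, by fun_prop⟩
      (constCurve p.2.2)

theorem segmentCurve_apply (p : E × ℝ × E) (s : I) :
    segmentCurve p s = p.1 + p.2.1 • (s : ℝ) • p.2.2 := rfl

theorem contDiff_segmentCurve : ContDiff ℝ 1 (segmentCurve (E := E)) := by
  unfold segmentCurve
  fun_prop

theorem segmentCurve_zero (x w : E) : segmentCurve (x, 0, w) = constCurve x := by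
  ext s
  simp [segmentCurve_apply]

/-- `(f (x + ε w) - f x) / ε`, extended to `ε = 0`, as a function of `(x, ε, w)`. -/
noncomputable def hadamard (f : E → F) (p : E × ℝ × E) : F :=
  primitive (superpos (fderiv ℝ f) (segmentCurve p)) 1 p.2.2

theorem hadamard_zero {f : E → F} {x : E} (h : ContDiffAt ℝ 1 f x) (w : E) :
    hadamard f (x, 0, w) = fderiv ℝ f x w := by
  have : superpos (fderiv ℝ f) (segmentCurve (x, 0, w)) = constCurve (K := I) (fderiv ℝ f x) := by
    ext1 s
    rw [superpos_apply (fun s => ?_)] <;> rw [segmentCurve_zero]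
    · rfl
    · exact continuousAt_fderiv_of_contDiffAt h
  rw [hadamard, this, primitive_apply]
  have h2 : ∀ s, ext (constCurve (K := I) (fderiv ℝ f x)) s = fderiv ℝ f x := fun s => rfl
  simp [h2]

/-- The quotient is `∫₀¹ Df(x + s ε w) w ds`, and `Df` is `C¹`. The superposition operator with `Df`
is therefore `C¹` on the curves near the constant `x`. -/
theorem contDiffAt_hadamard {f : E → F} {x : E} (h : ContDiffAt ℝ 2 f x) (w : E) :
    ContDiffAt ℝ 1 (hadamard f) (x, 0, w) := by
  have h1 : ContDiffAt ℝ 1 (fderiv ℝ f) x := h.fderiv_right (by norm_num)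
  have h2 : ContDiffAt ℝ 1 (superpos (K := I) (fderiv ℝ f)) (segmentCurve (x, 0, w)) :=
    contDiffAt_superpos fun s => by rwa [segmentCurve_zero]
  have h3 : ContDiffAt ℝ 1 (fun p : E × ℝ × E => superpos (K := I) (fderiv ℝ f) (segmentCurve p))
    (x, 0, w) := ContDiffAt.comp _ h2 contDiff_segmentCurve.contDiffAt
  have h4 : ContDiffAt ℝ 1 (fun p : E × ℝ × E =>
      (ContinuousMap.evalCLM ℝ (1 : I) ∘L primitive)
      (superpos (fderiv ℝ f) (segmentCurve p))) (x, 0, w) :=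
    (ContinuousLinearMap.contDiff (ContinuousMap.evalCLM ℝ (1 : I) ∘L
      primitive (E := E →L[ℝ] F))).contDiffAt.comp _
      h3
  exact h4.clm_apply (by fun_prop)

theorem apply_add_smul {f : E → F} {p : E × ℝ × E}
    (h : ∀ s, ContDiffAt ℝ 1 f (segmentCurve p s)) :
    f (p.1 + p.2.1 • p.2.2) = f p.1 + p.2.1 • hadamard f p := by
  obtain ⟨x, ε, w⟩ := p
  have hd : ∀ s ∈ uIcc (0 : ℝ) 1, HasDerivAt (fun s : ℝ => f (x + ε • s • w))
      (ε • ext (superpos (fderiv ℝ f) (segmentCurve (x, ε, w))) s w) s := by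
    intro s hs
    rw [uIcc_of_le zero_le_one] at hs
    rw [ext_of_mem _ hs, superpos_apply fun s => continuousAt_fderiv_of_contDiffAt (h s)]
    have h1 : HasDerivAt (fun s : ℝ => x + ε • s • w) (ε • (1 : ℝ) • w) s :=
      (((hasDerivAt_id s).smul_const w).const_smul ε).const_add x
    have h2 := ((h ⟨s, hs⟩).differentiableAt (by simp)).hasFDerivAt
    have := HasFDerivAt.comp_hasDerivAt s h2 h1
    simpa [Function.comp_def] using this
  have hi := intervalIntegral.integral_eq_sub_of_hasDerivAt hd
    (((continuous_ext _).clm_apply continuous_const).const_smul ε |>.intervalIntegrable _ _)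
  simp only [one_smul, zero_smul, smul_zero, add_zero] at hi
  rw [intervalIntegral.integral_smul] at hi
  simp only
  rw [← sub_eq_iff_eq_add', ← hi, hadamard, primitive_apply]
  congr 1
  exact (ContinuousLinearMap.intervalIntegral_apply ((continuous_ext _).intervalIntegrable _ _) w).symm

/-- At `ε = 0` the segment from `x` to `x + ε w` degenerates to `x`, so nearby segments lie entirely
where `f` is `C¹`. -/
theorem eventually_apply_add_smul {f : E → F} {x : E} (h : ContDiffAt ℝ 1 f x) (w : E) :
    ∀ᶠ p : E × ℝ × E in 𝓝 (x, 0, w),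
      f (p.1 + p.2.1 • p.2.2) = f p.1 + p.2.1 • hadamard f p := by
  have h1 : ∀ᶠ u in 𝓝 (segmentCurve (x, 0, w)), ∀ s, ContDiffAt ℝ 1 f (u s) :=
    eventually_forall_of_eventually fun s => by
      rw [segmentCurve_zero]
      exact eventually_contDiffAt_one h
  exact ((contDiff_segmentCurve.continuous.tendsto _).eventually h1).mono fun p hp =>
    apply_add_smul hp

end Hadamard

end TwoFold

namespace TwoFold

/-! ### Time rescaling, the local flow and its variational equation -/

section Rescale

variable {E : Type*} [NormedAddCommGroup E] [NormedSpace ℝ E]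

theorem hasDerivWithinAt_comp_div {w : ℝ → E} {w' : E} {c t : ℝ} (hc : 0 < c)
    (h : HasDerivWithinAt w w' (Icc 0 1) (t / c)) :
    HasDerivWithinAt (fun s => w (s / c)) (c⁻¹ • w') (Icc 0 c) t := by
  have h1 : HasDerivWithinAt (fun s : ℝ => s / c) c⁻¹ (Icc 0 c) t := by
    simpa using ((hasDerivAt_id t).div_const c).hasDerivWithinAt
  exact HasDerivWithinAt.scomp (t' := Icc 0 1) t h h1
    fun s hs => ⟨div_nonneg hs.1 hc.le, (div_le_one hc).2 hs.2⟩

theorem hasDerivWithinAt_comp_mul {w : ℝ → E} {w' : E} {c t : ℝ} (hc : 0 ≤ c)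
    (h : HasDerivWithinAt w w' (Icc 0 c) (c * t)) :
    HasDerivWithinAt (fun s => w (c * s)) (c • w') (Icc 0 1) t := by
  have h1 : HasDerivWithinAt (fun s : ℝ => c * s) c (Icc 0 1) t := by
    simpa using ((hasDerivAt_id t).const_mul c).hasDerivWithinAt
  exact HasDerivWithinAt.scomp (t' := Icc 0 c) t h h1
    fun s hs => ⟨mul_nonneg hc hs.1, mul_le_of_le_one_right hc hs.2⟩

theorem exists_linear_solution_Icc [CompleteSpace E] {B : ℝ → E →L[ℝ] E} {g : ℝ → E} {c : ℝ}
    (hc : 0 < c) (hB : ContinuousOn B (Icc 0 c)) (hg : ContinuousOn g (Icc 0 c)) (y : E) :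
    ∃ w : ℝ → E, w 0 = y ∧ ∀ t ∈ Icc (0 : ℝ) c,
      HasDerivWithinAt w (B t (w t) + g t) (Icc 0 c) t := by
  have hm : MapsTo (fun s : ℝ => c * s) (Icc 0 1) (Icc 0 c) :=
    fun s hs => ⟨mul_nonneg hc.le hs.1, mul_le_of_le_one_right hc.le hs.2⟩
  obtain ⟨w, hw0, hw⟩ := exists_linear_solution (B := fun s => c • B (c * s))
    (g := fun s => c • g (c * s)) ((hB.comp (by fun_prop) hm).const_smul c)
    ((hg.comp (by fun_prop) hm).const_smul c) y
  refine ⟨fun t => w (t / c), by simpa using hw0, fun t ht => ?_⟩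
  have := hasDerivWithinAt_comp_div hc (hw (t / c) ⟨div_nonneg ht.1 hc.le, (div_le_one hc).2 ht.2⟩)
  convert! this using 1
  rw [mul_div_cancel₀ _ hc.ne']
  simp [smul_smul, inv_mul_cancel₀ hc.ne']

end Rescale

section Flow

variable {D : Set Plane} {F : Plane → Plane}

/-- Uniqueness removes the choice in `flow`: any solution in `D` computes it. -/
theorem flow_eq (hD : IsOpen D) (hF : ContDiffOn ℝ 2 F D) {w : ℝ → Plane} {t : ℝ} (ht : 0 ≤ t)
    (hw : ∀ s ∈ Icc 0 t, w s ∈ D ∧ HasDerivWithinAt w (F (w s)) (Icc 0 t) s) :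
    flow F D t (w 0) = w t := by
  have hdef : FlowDefined F D t (w 0) := ⟨w t, w, by rwa [uIcc_of_le ht], rfl, rfl⟩
  have hc : ∀ z ∈ D, ContDiffAt ℝ 1 F z := fun z hz =>
    (hF.contDiffAt (hD.mem_nhds hz)).of_le (by norm_num)
  rw [flow, dif_pos hdef]
  obtain ⟨v, hv, hv0, hvt⟩ := hdef.choose_spec
  rw [← hvt]
  rw [uIcc_of_le ht] at hv
  exact eq_of_contDiffAt (fun s hs => hc _ (hv s hs).1) (fun s hs => hc _ (hw s hs).1)
    (fun s hs => (hv s hs).2) (fun s hs => (hw s hs).2) hv0 (right_mem_Icc.2 ht)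

theorem flow_spec (hD : IsOpen D) (hF : ContDiffOn ℝ 2 F D) {S : ℝ} {z : Plane}
    (hS : 0 ≤ S) (h : FlowDefined F D S z) :
    flow F D 0 z = z ∧ ∀ t ∈ Icc 0 S, flow F D t z ∈ D ∧
      HasDerivWithinAt (fun t => flow F D t z) (F (flow F D t z)) (Icc 0 S) t := by
  obtain ⟨_, w, hw, hw0, -⟩ := h
  rw [uIcc_of_le hS] at hw
  have he : ∀ t ∈ Icc 0 S, flow F D t z = w t := fun t ht => by
    rw [← hw0]
    refine flow_eq hD hF ht.1 fun s hs => ?_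
    have hs' : s ∈ Icc 0 S := ⟨hs.1, hs.2.trans ht.2⟩
    exact ⟨(hw s hs').1, (hw s hs').2.mono (Icc_subset_Icc_right ht.2)⟩
  refine ⟨by rw [he 0 ⟨le_rfl, hS⟩, hw0], fun t ht => ?_⟩
  rw [he t ht]
  exact ⟨(hw t ht).1, (hw t ht).2.congr_of_mem he ht⟩

theorem eventually_forall_ext {E : Type*} [NormedAddCommGroup E] [NormedSpace ℝ E]
    {Y : Type*} [TopologicalSpace Y] {U : Y → C(unitInterval, E)}
    {y₀ : Y} (hU : ContinuousAt U y₀) {Q : E → Prop} {a b : ℝ}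
    (h : ∀ t ∈ Icc a b, ∀ᶠ x in 𝓝 (ext (U y₀) t), Q x) :
    ∀ᶠ y in 𝓝 y₀, ∀ t ∈ Icc a b, Q (ext (U y) t) := by
  refine isCompact_Icc.eventually_forall_of_forall_eventually
    (P := fun y t => Q (ext (U y) t)) fun t ht => ?_
  have hc : Continuous fun p : C(unitInterval, E) × ℝ => ext p.1 p.2 := by
    have : Continuous fun p : C(unitInterval, E) × ℝ =>
        p.1 (projIcc 0 1 zero_le_one p.2) := by
      have := continuous_projIcc (a := (0 : ℝ)) (b := 1) (h := zero_le_one)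
      fun_prop
    exact this
  have h2 : Tendsto (fun p : Y × ℝ => (U p.1, p.2)) (𝓝 (y₀, t)) (𝓝 (U y₀, t)) := by
    rw [nhds_prod_eq, nhds_prod_eq]
    exact hU.tendsto.prodMap tendsto_id
  exact ((hc.tendsto (U y₀, t)).comp h2).eventually (h t ht)

/-- With time scaled to `[0, 1]`, the flow agrees near `z` with the family of
`exists_solution_family`. It is therefore differentiable there, and its derivative solves the
linearised equation. -/
theorem flowDeriv_apply (hD : IsOpen D) (hF : ContDiffOn ℝ 2 F D) {S : ℝ} {z : Plane}
    (hS : 0 < S) (h : FlowDefined F D S z) (v : Plane) :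
    flowDeriv F D 0 z v = v ∧ ∀ t ∈ Icc 0 S, HasDerivWithinAt (fun t => flowDeriv F D t z v)
      (fderiv ℝ F (flow F D t z) (flowDeriv F D t z v)) (Icc 0 S) t := by
  obtain ⟨h0, hγ⟩ := flow_spec hD hF hS.le h
  have hc : ∀ x ∈ D, ContDiffAt ℝ 1 F x := fun x hx =>
    (hF.contDiffAt (hD.mem_nhds hx)).of_le (by norm_num)
  have hm : ∀ s ∈ Icc (0 : ℝ) 1, S * s ∈ Icc 0 S :=
    fun s hs => ⟨mul_nonneg hS.le hs.1, mul_le_of_le_one_right hS.le hs.2⟩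
  obtain ⟨U, U', hU, hU0, hU'd, hU'0, hUe⟩ :=
    exists_solution_family (V := fun x => S • F x) (w := fun s => flow F D (S * s) z)
      (fun s hs => hasDerivWithinAt_comp_mul hS.le (hγ _ (hm s hs)).2)
      (fun s hs => (hc _ (hγ _ (hm s hs)).1).const_smul S)
  simp only [mul_zero, h0] at hU hU0 hUe
  have hUD : ∀ᶠ y in 𝓝 z, ∀ t ∈ Icc (0 : ℝ) 1, ext (U y) t ∈ D := by
    refine eventually_forall_ext hU.continuousAt (Q := fun x => x ∈ D) fun t ht => ?_
    rw [hU0 t ht]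
    exact hD.mem_nhds (hγ _ (hm t ht)).1
  have hflow : ∀ᶠ y in 𝓝 z, ∀ t ∈ Icc (0 : ℝ) 1, flow F D (S * t) y = ext (U y) t := by
    filter_upwards [hUe, hUD] with y hy hyD t ht
    have := flow_eq hD hF (w := fun s => ext (U y) (s / S)) (mul_nonneg hS.le ht.1) (fun s hs => by
      have hs1 : s / S ∈ Icc (0 : ℝ) 1 := ⟨div_nonneg hs.1 hS.le, (div_le_one hS).2
        (hs.2.trans (hm t ht).2)⟩
      refine ⟨hyD _ hs1, ?_⟩
      have := hasDerivWithinAt_comp_div hS (hy.2 _ hs1)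
      rw [smul_smul, inv_mul_cancel₀ hS.ne', one_smul] at this
      exact this.mono (Icc_subset_Icc_right (hm t ht).2))
    simpa [hy.1, mul_div_cancel_left₀ _ hS.ne'] using this
  have hderiv : ∀ t ∈ Icc (0 : ℝ) 1, flowDeriv F D (S * t) z v = ext (U' v) t := by
    intro t ht
    have h1 : HasFDerivAt (fun y => ext (U y) t)
        (ContinuousMap.evalCLM ℝ (⟨t, ht⟩ : unitInterval) ∘L U') z := by
      have := ((ContinuousMap.evalCLM ℝ (⟨t, ht⟩ : unitInterval)).hasFDerivAt (x := U z)).comp z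
        hU.hasFDerivAt
      refine this.congr_of_eventuallyEq (Eventually.of_forall fun y => ?_)
      exact ext_of_mem _ ht
    have h2 : HasFDerivAt (fun y => flow F D (S * t) y)
        (ContinuousMap.evalCLM ℝ (⟨t, ht⟩ : unitInterval) ∘L U') z :=
      h1.congr_of_eventuallyEq (hflow.mono fun y hy => hy t ht)
    rw [flowDeriv, h2.fderiv, ext_of_mem _ ht]
    rfl
  have hderiv' : ∀ t ∈ Icc (0 : ℝ) S, flowDeriv F D t z v = ext (U' v) (t / S) := fun t ht => by
    rw [← hderiv _ ⟨div_nonneg ht.1 hS.le, (div_le_one hS).2 ht.2⟩, mul_div_cancel₀ _ hS.ne']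
  refine ⟨by rw [hderiv' 0 ⟨le_rfl, hS.le⟩, zero_div, hU'0], fun t ht => ?_⟩
  have ht1 : t / S ∈ Icc (0 : ℝ) 1 := ⟨div_nonneg ht.1 hS.le, (div_le_one hS).2 ht.2⟩
  have h3 := hasDerivWithinAt_comp_div hS (hU'd v _ ht1)
  have h4 : HasFDerivAt (fun x => S • F x) (S • fderiv ℝ F (flow F D t z)) (flow F D t z) :=
    ((hc _ (hγ t ht).1).differentiableAt (by simp)).hasFDerivAt.const_smul S
  rw [mul_div_cancel₀ _ hS.ne', h4.fderiv] at h3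
  rw [hderiv' t ht]
  refine HasDerivWithinAt.congr_of_mem ?_ hderiv' ht
  simpa [smul_smul, inv_mul_cancel₀ hS.ne'] using h3

/-- The inverse is built as the solution of the adjoint equation `Z' = -Z DF(Γ)`, which shows its
regularity in time at once; `Z Y` has derivative zero and starts at the identity. -/
theorem flowDeriv_spec (hD : IsOpen D) (hF : ContDiffOn ℝ 2 F D) {S : ℝ} {z : Plane}
    (hS : 0 < S) (h : FlowDefined F D S z) :
    ∃ Z : ℝ → Plane →L[ℝ] Plane,
      ∀ t ∈ Icc 0 S, (flowDeriv F D t z).inverse = Z t ∧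
        HasDerivWithinAt Z (-(Z t ∘L fderiv ℝ F (flow F D t z))) (Icc 0 S) t ∧
        flowDeriv F D t z ∘L Z t = .id ℝ Plane := by
  obtain ⟨h0, hγ⟩ := flow_spec hD hF hS.le h
  have hB : ContinuousOn (fun t => fderiv ℝ F (flow F D t z)) (Icc 0 S) := fun t ht =>
    ContinuousAt.comp_continuousWithinAt (continuousAt_fderiv_of_contDiffAt
      ((hF.contDiffAt (hD.mem_nhds (hγ t ht).1)).of_le (by norm_num)))
      (hγ t ht).2.continuousWithinAt
  obtain ⟨Z, hZ0, hZ⟩ := exists_linear_solution_Icc (E := Plane →L[ℝ] Plane)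
    (B := fun t => -(ContinuousLinearMap.compL ℝ Plane Plane Plane).flip
      (fderiv ℝ F (flow F D t z))) (g := fun _ => 0) hS
    (((ContinuousLinearMap.compL ℝ Plane Plane Plane).flip.continuous.comp_continuousOn hB).neg)
    continuousOn_const (.id ℝ Plane)
  have hZ' : ∀ t ∈ Icc 0 S,
      HasDerivWithinAt Z (-(Z t ∘L fderiv ℝ F (flow F D t z))) (Icc 0 S) t := fun t ht => by
    simpa using hZ t ht
  have hZY : ∀ t ∈ Icc 0 S, Z t ∘L flowDeriv F D t z = .id ℝ Plane := by
    intro t ht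
    refine ContinuousLinearMap.ext fun v => ?_
    have hd : ∀ s ∈ Icc 0 S, HasDerivWithinAt (fun s => Z s (flowDeriv F D s z v)) 0 (Icc 0 S) s :=
      fun s hs => by
      have := (hZ' s hs).clm_apply ((flowDeriv_apply hD hF hS h v).2 s hs)
      simpa using this
    have := eq_of_linear (B := fun _ => 0) (g := fun _ => 0) (w₂ := fun _ => v) continuousOn_const
      (by simpa using hd) (fun s _ => by simpa using hasDerivWithinAt_const s _ v)
      (by simp [(flowDeriv_apply hD hF hS h v).1, hZ0]) ht
    exact this
  refine ⟨Z, fun t ht => ⟨?_, hZ' t ht, ?_⟩⟩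
  · have h1 := hZY t ht
    -- In finite dimension a left inverse is also a right inverse.
    have h2 : flowDeriv F D t z ∘L Z t = .id ℝ Plane := by
      have e : (Z t : Plane →ₗ[ℝ] Plane) * (flowDeriv F D t z : Plane →ₗ[ℝ] Plane) = 1 :=
        congrArg ContinuousLinearMap.toLinearMap h1
      have e2 := mul_eq_one_comm.1 e
      refine ContinuousLinearMap.ext fun v => ?_
      exact LinearMap.congr_fun e2 v
    have hl : Function.LeftInverse (Z t) (flowDeriv F D t z) := fun v =>
      DFunLike.congr_fun h1 v
    have hr : Function.RightInverse (Z t) (flowDeriv F D t z) := fun v =>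
      DFunLike.congr_fun h2 v
    have := ContinuousLinearMap.inverse_equiv
      (ContinuousLinearEquiv.equivOfInverse (flowDeriv F D t z) (Z t) hl hr)
    exact this
  · have e : (Z t : Plane →ₗ[ℝ] Plane) * (flowDeriv F D t z : Plane →ₗ[ℝ] Plane) = 1 :=
      congrArg ContinuousLinearMap.toLinearMap (hZY t ht)
    have e2 := mul_eq_one_comm.1 e
    refine ContinuousLinearMap.ext fun v => ?_
    exact LinearMap.congr_fun e2 v

/-- Variation of constants. -/
theorem variation_of_constants (hD : IsOpen D) (hF : ContDiffOn ℝ 2 F D) {S : ℝ} {z : Plane}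
    (hS : 0 < S) (h : FlowDefined F D S z) {g w : ℝ → Plane} (hg : ContinuousOn g (Icc 0 S))
    (hw : ∀ t ∈ Icc 0 S,
      HasDerivWithinAt w (fderiv ℝ F (flow F D t z) (w t) + g t) (Icc 0 S) t) :
    w S = flowDeriv F D S z (w 0) +
      flowDeriv F D S z (∫ t in (0 : ℝ)..S, (flowDeriv F D t z).inverse (g t)) := by
  obtain ⟨Z, hZ⟩ := flowDeriv_spec hD hF hS h
  have hSm : S ∈ Icc 0 S := ⟨hS.le, le_rfl⟩
  have h0m : (0 : ℝ) ∈ Icc 0 S := ⟨le_rfl, hS.le⟩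
  have hZ0 : Z 0 = .id ℝ Plane := by
    have e : flowDeriv F D 0 z = .id ℝ Plane := by
      refine ContinuousLinearMap.ext fun v => ?_
      exact (flowDeriv_apply hD hF hS h v).1
    have := (hZ 0 h0m).2.2
    rw [e] at this
    simpa using this
  have hZc : ContinuousOn Z (Icc 0 S) := fun t ht => (hZ t ht).2.1.continuousWithinAt
  have hint : ∫ t in (0 : ℝ)..S, (flowDeriv F D t z).inverse (g t) = Z S (w S) - Z 0 (w 0) := by
    rw [intervalIntegral.integral_congr (g := fun t => Z t (g t)) (fun t ht => by
      rw [uIcc_of_le hS.le] at ht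
      simp only [(hZ t ht).1])]
    have hd : ∀ t ∈ Icc 0 S, HasDerivWithinAt (fun t => Z t (w t)) (Z t (g t)) (Icc 0 S) t := by
      intro t ht
      have := (hZ t ht).2.1.clm_apply (hw t ht)
      simpa using this
    refine intervalIntegral.integral_eq_sub_of_hasDerivAt_of_le hS.le
      (fun t ht => (hd t ht).continuousWithinAt) (fun t ht => ?_) ?_
    · exact (hd t (Ioo_subset_Icc_self ht)).hasDerivAt (Icc_mem_nhds ht.1 ht.2)
    · refine ContinuousOn.intervalIntegrable ?_
      rw [uIcc_of_le hS.le]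
      exact hZc.clm_apply hg
  rw [hint, hZ0, ← map_add]
  have := DFunLike.congr_fun (hZ S hSm).2.2 (w S)
  simpa using this.symm

/-- The velocity `F(Γ(t))` solves the unforced variational equation. -/
theorem flowDeriv_apply_field (hD : IsOpen D) (hF : ContDiffOn ℝ 2 F D) {S : ℝ} {z : Plane}
    (hS : 0 < S) (h : FlowDefined F D S z) :
    flowDeriv F D S z (F z) = F (flow F D S z) := by
  obtain ⟨h0, hγ⟩ := flow_spec hD hF hS.le h
  have := variation_of_constants hD hF hS h (g := fun _ => 0) (w := fun t => F (flow F D t z))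
    continuousOn_const (fun t ht => by
      have := (((hF.contDiffAt (hD.mem_nhds (hγ t ht).1)).differentiableAt
        (by simp)).hasFDerivAt).comp_hasDerivWithinAt t (hγ t ht).2
      simpa [Function.comp_def] using this)
  simpa [h0] using this.symm

end Flow

end TwoFold

/-! ### The blow-up `z = x + ε w` along the visible loop -/

namespace TwoFold

/-- A trajectory of `z' = F z` that starts at a visible fold of the line `y = 0`, stays in `y < 0`
for `0 < t < S` and comes back to `y = 0` transversely at the time `S`. -/
structure VisibleLoop (D : Set Plane) (F : Plane → Plane) (xv S : ℝ) : Prop where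
  isOpen : IsOpen D
  contDiffOn : ContDiffOn ℝ 2 F D
  mem : ((xv, 0) : Plane) ∈ D
  tangent : (F (xv, 0)).2 = 0
  visible : dxF₂ F xv * (F (xv, 0)).1 < 0
  pos : 0 < S
  defined : FlowDefined F D S (xv, 0)
  below : ∀ t ∈ Ioo 0 S, (flow F D t (xv, 0)).2 < 0
  hit : (flow F D S (xv, 0)).2 = 0
  exit : 0 < (F (flow F D S (xv, 0))).2

/-- A trajectory of `z' = X (t, z)` on `[θ, θ + ℓ]` (with time counted from `θ`) that starts on
`y = 0`, and that stays in `y < 0` as soon as it does not start upwards and ends on `y = 0`. -/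
structure IsLowerArc (D : Set Plane) (X : ℝ → Plane → Plane) (θ ℓ : ℝ) (z : ℝ → Plane) :
    Prop where
  pos : 0 < ℓ
  sol : ∀ s ∈ Icc 0 ℓ, z s ∈ D ∧ HasDerivWithinAt z (X (θ + s) (z s)) (Icc 0 ℓ) s
  start : (z 0).2 = 0
  below : (X θ (z 0)).2 ≤ 0 → (z ℓ).2 = 0 → ∀ s ∈ Ioo 0 ℓ, (z s).2 < 0
  exit : 0 < (X (θ + ℓ) (z ℓ)).2

/-- The states `(x, w, t, ρ, ε)` of the equation for `z = x + ε w`. -/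
abbrev BlowUp : Type := Plane × Plane × ℝ × ℝ × ℝ

namespace BlowUp

/-- The point `z = x + ε w`. -/
def point (y : BlowUp) : Plane := y.1 + y.2.2.2.2 • y.2.1

/-- The field on blown up states; time runs at the speed `S (1 + ε ρ)`. -/
noncomputable def field (F : Plane → Plane) (G : ℝ → Plane → Plane) (H : ℝ → Plane → ℝ → Plane)
    (S : ℝ) (y : BlowUp) : BlowUp :=
  (S • F y.1,
    S • (hadamard F (y.1, y.2.2.2.2, y.2.1) + y.2.2.2.1 • F y.point +
      (1 + y.2.2.2.2 * y.2.2.2.1) • (G y.2.2.1 y.point +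
        y.2.2.2.2 • H y.2.2.1 y.point y.2.2.2.2)),
    S * (1 + y.2.2.2.2 * y.2.2.2.1), 0, 0)

/-- The original field at a blown up state. -/
noncomputable def value (F : Plane → Plane) (G : ℝ → Plane → Plane) (H : ℝ → Plane → ℝ → Plane)
    (y : BlowUp) : Plane :=
  perturb F G H y.2.2.2.2 y.2.2.1 y.point

variable {D : Set Plane} {F : Plane → Plane} {G : ℝ → Plane → Plane} {H : ℝ → Plane → ℝ → Plane}
  {xv S ε₀ T : ℝ}

theorem contDiff_point : ContDiff ℝ 1 point := by
  unfold point
  fun_prop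

theorem point_zero (x w : Plane) (t ρ : ℝ) : point (x, w, t, ρ, 0) = x := by simp [point]

theorem contDiffAt_comp_point {f : Plane → Plane} {x : Plane} (hf : ContDiffAt ℝ 1 f x)
    (w : Plane) (t ρ : ℝ) : ContDiffAt ℝ 1 (fun y : BlowUp => f y.point) (x, w, t, ρ, 0) := by
  have := point_zero x w t ρ
  exact ContDiffAt.comp (x, w, t, ρ, (0 : ℝ)) (by rwa [this]) contDiff_point.contDiffAt

theorem contDiffAt_G (hD : IsOpen D) (hP : PeriodicPerturbation D ε₀ T G H) {x : Plane}
    (hx : x ∈ D) (w : Plane) (t ρ : ℝ) :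
    ContDiffAt ℝ 1 (fun y : BlowUp => G y.2.2.1 y.point) (x, w, t, ρ, 0) := by
  have h1 : ContDiffAt ℝ 1 (fun p : ℝ × Plane => G p.1 p.2) (t, x) :=
    (hP.smooth_G.contDiffAt ((isOpen_univ.prod hD).mem_nhds ⟨mem_univ _, hx⟩)).of_le (by norm_cast)
  have h2 : ContDiffAt ℝ 1 (fun y : BlowUp => (y.2.2.1, y.point)) (x, w, t, ρ, 0) :=
    ContDiffAt.prodMk (by fun_prop) contDiff_point.contDiffAt
  refine ContDiffAt.comp (g := fun p : ℝ × Plane => G p.1 p.2) (x, w, t, ρ, (0 : ℝ)) ?_ h2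
  simpa only [point_zero] using h1

theorem contDiffAt_H (hD : IsOpen D) (hε₀ : 0 < ε₀) (hP : PeriodicPerturbation D ε₀ T G H)
    {x : Plane} (hx : x ∈ D) (w : Plane) (t ρ : ℝ) :
    ContDiffAt ℝ 1 (fun y : BlowUp => H y.2.2.1 y.point y.2.2.2.2) (x, w, t, ρ, 0) := by
  have h1 : ContDiffAt ℝ 1 (fun p : ℝ × Plane × ℝ => H p.1 p.2.1 p.2.2) (t, x, 0) :=
    (hP.smooth_H.contDiffAt ((isOpen_univ.prod (hD.prod isOpen_Ioo)).mem_nhds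
      ⟨mem_univ _, hx, by simpa using hε₀, hε₀⟩)).of_le (by norm_cast)
  have h2 : ContDiffAt ℝ 1 (fun y : BlowUp => (y.2.2.1, y.point, y.2.2.2.2)) (x, w, t, ρ, 0) :=
    ContDiffAt.prodMk (by fun_prop) (contDiff_point.contDiffAt.prodMk (by fun_prop))
  refine ContDiffAt.comp (g := fun p : ℝ × Plane × ℝ => H p.1 p.2.1 p.2.2)
    (x, w, t, ρ, (0 : ℝ)) ?_ h2
  simpa only [point_zero] using h1

/-- Only the difference quotient of `F` costs a derivative. The state carries `t`, `ρ` and `ε` so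
that dependence on them becomes dependence on the initial value of an autonomous equation. -/
theorem contDiffAt_field (hD : IsOpen D) (hF : ContDiffOn ℝ 2 F D) (hε₀ : 0 < ε₀)
    (hP : PeriodicPerturbation D ε₀ T G H) {x : Plane} (hx : x ∈ D) (w : Plane) (t ρ : ℝ) :
    ContDiffAt ℝ 1 (field F G H S) (x, w, t, ρ, 0) := by
  have hF2 : ContDiffAt ℝ 2 F x := hF.contDiffAt (hD.mem_nhds hx)
  have hF1 : ContDiffAt ℝ 1 F x := hF2.of_le (by norm_num)
  have h0 : ContDiffAt ℝ 1 (fun y : BlowUp => F y.1) (x, w, t, ρ, (0 : ℝ)) :=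
    ContDiffAt.comp (x, w, t, ρ, (0 : ℝ)) hF1 contDiffAt_fst
  have h1 : ContDiffAt ℝ 1 (fun y : BlowUp => hadamard F (y.1, y.2.2.2.2, y.2.1))
      (x, w, t, ρ, (0 : ℝ)) :=
    ContDiffAt.comp (g := hadamard F) (x, w, t, ρ, (0 : ℝ)) (contDiffAt_hadamard hF2 w)
      (by fun_prop)
  have h2 := contDiffAt_comp_point hF1 w t ρ
  have h3 := contDiffAt_G hD hP hx w t ρ
  have h4 := contDiffAt_H hD hε₀ hP hx w t ρ
  have h5 : ContDiffAt ℝ 1 (fun y : BlowUp => y.2.2.2.1) (x, w, t, ρ, (0 : ℝ)) := by fun_prop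
  have h6 : ContDiffAt ℝ 1 (fun y : BlowUp => y.2.2.2.2) (x, w, t, ρ, (0 : ℝ)) := by fun_prop
  have h7 : ContDiffAt ℝ 1 (fun y : BlowUp => 1 + y.2.2.2.2 * y.2.2.2.1)
    (x, w, t, ρ, (0 : ℝ)) := by fun_prop
  unfold field
  refine (h0.const_smul S).prodMk (ContDiffAt.prodMk ?_ ?_)
  · refine ContDiffAt.const_smul S ((h1.add (h5.smul h2)).add (h7.smul (h3.add (h6.smul h4))))
  · fun_prop

theorem contDiffAt_value (hD : IsOpen D) (hF : ContDiffOn ℝ 2 F D) (hε₀ : 0 < ε₀)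
    (hP : PeriodicPerturbation D ε₀ T G H) {x : Plane} (hx : x ∈ D) (w : Plane) (t ρ : ℝ) :
    ContDiffAt ℝ 1 (value F G H) (x, w, t, ρ, 0) := by
  have hF1 : ContDiffAt ℝ 1 F x := (hF.contDiffAt (hD.mem_nhds hx)).of_le (by norm_num)
  have h2 := contDiffAt_comp_point hF1 w t ρ
  have h3 := contDiffAt_G hD hP hx w t ρ
  have h4 := contDiffAt_H hD hε₀ hP hx w t ρ
  have h6 : ContDiffAt ℝ 1 (fun y : BlowUp => y.2.2.2.2) (x, w, t, ρ, (0 : ℝ)) := by fun_prop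
  exact (h2.add (h6.smul h3)).add ((h6.pow 2).smul h4)

theorem value_zero (x w : Plane) (t ρ : ℝ) : value F G H (x, w, t, ρ, 0) = F x := by
  simp [value, perturb, point_zero]

/-- The velocity of the point of a blown up state. -/
theorem field_point {y : BlowUp}
    (h : F (y.1 + y.2.2.2.2 • y.2.1) = F y.1 + y.2.2.2.2 • hadamard F (y.1, y.2.2.2.2, y.2.1)) :
    (field F G H S y).1 + y.2.2.2.2 • (field F G H S y).2.1 =
      (S * (1 + y.2.2.2.2 * y.2.2.2.1)) • value F G H y := by
  have h' : F y.1 = F y.point - y.2.2.2.2 • hadamard F (y.1, y.2.2.2.2, y.2.1) :=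
    eq_sub_of_add_eq h.symm
  simp only [field, value, perturb, h']
  module

end BlowUp

/-- `Y(S) ∫₀^S Y(t)⁻¹ G(t + θ, Γ(t)) dt`. -/
noncomputable def duhamel (D : Set Plane) (F : Plane → Plane) (G : ℝ → Plane → Plane) (S : ℝ)
    (z : Plane) (θ : ℝ) : Plane :=
  flowDeriv F D S z (∫ t in (0 : ℝ)..S, (flowDeriv F D t z).inverse (G (t + θ) (flow F D t z)))

namespace VisibleLoop

variable {D : Set Plane} {F : Plane → Plane} {G : ℝ → Plane → Plane} {H : ℝ → Plane → ℝ → Plane}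
  {xv S ε₀ T : ℝ}

theorem field_ne_zero (L : VisibleLoop D F xv S) : (F (xv, 0)).1 ≠ 0 := fun h => by
  have := L.visible
  simp [h] at this

theorem dxF₂_eq (L : VisibleLoop D F xv S) : dxF₂ F xv = (fderiv ℝ F (xv, 0) (1, 0)).2 := by
  have h1 : HasFDerivAt F (fderiv ℝ F (xv, 0)) (xv, 0) :=
    ((L.contDiffOn.contDiffAt (L.isOpen.mem_nhds L.mem)).differentiableAt (by simp)).hasFDerivAt
  have h2 : HasDerivAt (fun s : ℝ => ((s, 0) : Plane)) (1, 0) xv :=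
    (hasDerivAt_id xv).prodMk (hasDerivAt_const xv 0)
  exact (HasFDerivAt.comp_hasDerivAt xv h1.snd h2).deriv

theorem continuousOn_G (L : VisibleLoop D F xv S) (hP : PeriodicPerturbation D ε₀ T G H) (θ : ℝ) :
    ContinuousOn (fun t => G (t + θ) (flow F D t (xv, 0))) (Icc 0 S) := by
  obtain ⟨-, hγ⟩ := flow_spec L.isOpen L.contDiffOn L.pos.le L.defined
  have h1 : ContinuousOn (fun t => (t + θ, flow F D t (xv, 0))) (Icc 0 S) :=
    ContinuousOn.prodMk (by fun_prop) fun t ht => (hγ t ht).2.continuousWithinAt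
  exact hP.smooth_G.continuousOn.comp (g := fun p : ℝ × Plane => G p.1 p.2) h1
    fun t ht => ⟨mem_univ _, (hγ t ht).1⟩

/-- The first order deviation from the loop at the time `S`. -/
theorem linear_value (L : VisibleLoop D F xv S) (hP : PeriodicPerturbation D ε₀ T G H)
    {w : ℝ → Plane} {θ ξ ρ : ℝ} (hw0 : w 0 = (ξ, 0))
    (hw : ∀ τ ∈ Icc (0 : ℝ) 1, HasDerivWithinAt w
      (S • (fderiv ℝ F (flow F D (S * τ) (xv, 0)) (w τ) + ρ • F (flow F D (S * τ) (xv, 0)) +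
        G (θ + S * τ) (flow F D (S * τ) (xv, 0)))) (Icc 0 1) τ) :
    w 1 = (ρ * S + ξ / (F (xv, 0)).1) • F (flow F D S (xv, 0)) + duhamel D F G S (xv, 0) θ := by
  have hS := L.pos
  obtain ⟨h0, hγ⟩ := flow_spec L.isOpen L.contDiffOn L.pos.le L.defined
  -- The forcing `ρ F(Γ)` has the particular solution `ρ t F(Γ(t))`; subtracting it leaves `G` as
  -- the only forcing.
  have hd : ∀ t ∈ Icc 0 S, HasDerivWithinAt
      (fun t => w (t / S) - (ρ * t) • F (flow F D t (xv, 0)))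
      (fderiv ℝ F (flow F D t (xv, 0)) (w (t / S) - (ρ * t) • F (flow F D t (xv, 0))) +
        G (t + θ) (flow F D t (xv, 0))) (Icc 0 S) t := by
    intro t ht
    have h1 := hasDerivWithinAt_comp_div hS
      (hw (t / S) ⟨div_nonneg ht.1 hS.le, (div_le_one hS).2 ht.2⟩)
    rw [mul_div_cancel₀ _ hS.ne', smul_smul, inv_mul_cancel₀ hS.ne', one_smul] at h1
    have h2 : HasDerivWithinAt (fun t => F (flow F D t (xv, 0)))
        (fderiv ℝ F (flow F D t (xv, 0)) (F (flow F D t (xv, 0)))) (Icc 0 S) t :=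
      ((L.contDiffOn.contDiffAt (L.isOpen.mem_nhds (hγ t ht).1)).differentiableAt
        (by simp)).hasFDerivAt.comp_hasDerivWithinAt t (hγ t ht).2
    have h3 : HasDerivWithinAt (fun t : ℝ => ρ * t) ρ (Icc 0 S) t := by
      simpa using ((hasDerivAt_id t).const_mul ρ).hasDerivWithinAt
    refine (h1.sub (h3.smul h2)).congr_deriv ?_
    rw [map_sub, map_smul, add_comm θ t]
    abel
  have := variation_of_constants L.isOpen L.contDiffOn hS L.defined
    (L.continuousOn_G hP θ) hd
  simp only [div_self hS.ne', mul_zero, zero_div, zero_smul, sub_zero, hw0] at this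
  -- At the fold the field is horizontal, so a displacement along the line is a displacement along
  -- the orbit.
  have hp : ((ξ, 0) : Plane) = (ξ / (F (xv, 0)).1) • F (xv, 0) := by
    ext
    · simp [div_mul_cancel₀ _ L.field_ne_zero]
    · simp [L.tangent]
  rw [hp, map_smul, flowDeriv_apply_field L.isOpen L.contDiffOn hS L.defined, sub_eq_iff_eq_add]
    at this
  rw [this, duhamel]
  module

end VisibleLoop

end TwoFold

namespace TwoFold

/-- Here `ζ` is the height and `χ` the vertical velocity up to the factor `c`. Near the fold `χ`
decreases from a nonpositive value, so `ζ` falls from `0`; near the exit `ζ` increases to `0`; in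
between its sign is given. -/
theorem neg_of_fold {ζ χ χ' : ℝ → ℝ} {c δ η : ℝ} (hc : 0 < c) (hδ : δ ∈ Ioo (0 : ℝ) 1)
    (hη : η ∈ Ioo (0 : ℝ) 1)
    (hζ : ∀ t ∈ Icc (0 : ℝ) 1, HasDerivWithinAt ζ (c * χ t) (Icc 0 1) t)
    (hχ : ∀ t ∈ Icc (0 : ℝ) δ, HasDerivWithinAt χ (χ' t) (Icc 0 1) t)
    (hχ' : ∀ t ∈ Icc (0 : ℝ) δ, χ' t < 0) (hmid : ∀ t ∈ Icc δ η, ζ t < 0)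
    (hend : ∀ t ∈ Icc η 1, 0 < χ t) (h0 : ζ 0 = 0) (hχ0 : χ 0 ≤ 0) (h1 : ζ 1 = 0) :
    ∀ t ∈ Ioo (0 : ℝ) 1, ζ t < 0 := by
  have hζc : ContinuousOn ζ (Icc 0 1) := fun t ht => (hζ t ht).continuousWithinAt
  have hδ1 : Icc 0 δ ⊆ Icc (0 : ℝ) 1 := Icc_subset_Icc_right hδ.2.le
  have hη1 : Icc η 1 ⊆ Icc (0 : ℝ) 1 := Icc_subset_Icc_left hη.1.le
  have hanti : StrictAntiOn χ (Icc 0 δ) := by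
    refine strictAntiOn_of_hasDerivWithinAt_neg (f' := χ') (convex_Icc _ _)
      (fun t ht => ((hχ t ht).continuousWithinAt).mono hδ1) (fun t ht => ?_) (fun t ht => ?_)
    · rw [interior_Icc] at ht ⊢
      exact (hχ t (Ioo_subset_Icc_self ht)).mono (Ioo_subset_Icc_self.trans hδ1)
    · rw [interior_Icc] at ht
      exact hχ' t (Ioo_subset_Icc_self ht)
  have hanti2 : StrictAntiOn ζ (Icc 0 δ) := by
    refine strictAntiOn_of_hasDerivWithinAt_neg (f' := fun t => c * χ t) (convex_Icc _ _)
      (hζc.mono hδ1) (fun t ht => ?_) (fun t ht => ?_)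
    · rw [interior_Icc] at ht ⊢
      exact (hζ t (hδ1 (Ioo_subset_Icc_self ht))).mono (Ioo_subset_Icc_self.trans hδ1)
    · rw [interior_Icc] at ht
      have := hanti (left_mem_Icc.2 hδ.1.le) (Ioo_subset_Icc_self ht) ht.1
      exact mul_neg_of_pos_of_neg hc (this.trans_le hχ0)
  have hmono : StrictMonoOn ζ (Icc η 1) := by
    refine strictMonoOn_of_hasDerivWithinAt_pos (f' := fun t => c * χ t) (convex_Icc _ _)
      (hζc.mono hη1) (fun t ht => ?_) (fun t ht => ?_)
    · rw [interior_Icc] at ht ⊢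
      exact (hζ t (hη1 (Ioo_subset_Icc_self ht))).mono (Ioo_subset_Icc_self.trans hη1)
    · rw [interior_Icc] at ht
      exact mul_pos hc (hend t (Ioo_subset_Icc_self ht))
  intro t ht
  rcases le_total t δ with h | h
  · rw [← h0]
    exact hanti2 (left_mem_Icc.2 hδ.1.le) ⟨ht.1.le, h⟩ ht.1
  rcases le_total t η with h' | h'
  · exact hmid t ⟨h, h'⟩
  · rw [← h1]
    exact hmono ⟨h', ht.2.le⟩ (right_mem_Icc.2 hη.2.le) ht.2

theorem eq_add_mul_of_hasDerivWithinAt {f : ℝ → ℝ} {c a b : ℝ}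
    (h : ∀ t ∈ Icc a b, HasDerivWithinAt f c (Icc a b) t) :
    ∀ t ∈ Icc a b, f t = f a + c * (t - a) :=
  eq_of_linear (B := fun _ => 0) (g := fun _ => c) (w₂ := fun t => f a + c * (t - a))
    continuousOn_const (by simpa using h) (fun t _ => by
      simpa using (((hasDerivAt_id t).sub_const a).const_mul c).const_add (f a)
        |>.hasDerivWithinAt) (by simp)

namespace VisibleLoop

open BlowUp

variable {D : Set Plane} {F : Plane → Plane} {G : ℝ → Plane → Plane} {H : ℝ → Plane → ℝ → Plane}
  {xv S ε₀ T : ℝ}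

/-- Blown up trajectories near the loop, as differentiable functions of the perturbation size, the
initial time, the blown up initial position and the time scale. -/
theorem exists_blowUp_family (L : VisibleLoop D F xv S) (hε₀ : 0 < ε₀)
    (hP : PeriodicPerturbation D ε₀ T G H) (θ ξ ρ : ℝ) :
    ∃ (U : ℝ × ℝ × ℝ × ℝ → C(unitInterval, BlowUp))
      (U' : ℝ × ℝ × ℝ × ℝ →L[ℝ] C(unitInterval, BlowUp)),
      HasStrictFDerivAt U U' (0, θ, ξ, ρ) ∧
      (∀ τ ∈ Icc (0 : ℝ) 1, ∃ w, ext (U (0, θ, ξ, ρ)) τ =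
        (flow F D (S * τ) (xv, 0), w, θ + S * τ, ρ, 0)) ∧
      (∀ τ ∈ Icc (0 : ℝ) 1, HasDerivWithinAt (ext (U (0, θ, ξ, ρ)))
        (field F G H S (ext (U (0, θ, ξ, ρ)) τ)) (Icc 0 1) τ) ∧
      ∀ᶠ a in 𝓝 (0, θ, ξ, ρ), ∀ τ ∈ Icc (0 : ℝ) 1,
        HasDerivWithinAt (ext (U a)) (field F G H S (ext (U a) τ)) (Icc 0 1) τ ∧
        ext (U a) 0 = ((xv, 0), (a.2.2.1, 0), a.2.1, a.2.2.2, a.1) ∧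
        ∃ w, ext (U a) τ = (flow F D (S * τ) (xv, 0), w,
          a.2.1 + S * (1 + a.1 * a.2.2.2) * τ, a.2.2.2, a.1) := by
  have hS := L.pos
  obtain ⟨h0, hγ⟩ := flow_spec L.isOpen L.contDiffOn L.pos.le L.defined
  have hm : ∀ s ∈ Icc (0 : ℝ) 1, S * s ∈ Icc 0 S :=
    fun s hs => ⟨mul_nonneg hS.le hs.1, mul_le_of_le_one_right hS.le hs.2⟩
  have hc : ∀ x ∈ D, ContDiffAt ℝ 1 F x := fun x hx =>
    (L.contDiffOn.contDiffAt (L.isOpen.mem_nhds hx)).of_le (by norm_num)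
  set γ : ℝ → Plane := fun s => flow F D (S * s) (xv, 0) with hγdef
  have hγ' : ∀ s ∈ Icc (0 : ℝ) 1, γ s ∈ D ∧ HasDerivWithinAt γ (S • F (γ s)) (Icc 0 1) s :=
    fun s hs => ⟨(hγ _ (hm s hs)).1, hasDerivWithinAt_comp_mul hS.le (hγ _ (hm s hs)).2⟩
  have hγc : ContinuousOn γ (Icc 0 1) := fun s hs => (hγ' s hs).2.continuousWithinAt
  have hFγ : ContinuousOn (fun s => F (γ s)) (Icc 0 1) := fun s hs =>
    (hc _ (hγ' s hs).1).continuousAt.comp_continuousWithinAt (hγc s hs)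
  have hBγ : ContinuousOn (fun s => fderiv ℝ F (γ s)) (Icc 0 1) := fun s hs =>
    (continuousAt_fderiv_of_contDiffAt (hc _ (hγ' s hs).1)).comp_continuousWithinAt (hγc s hs)
  have hGγ : ContinuousOn (fun s => G (θ + S * s) (γ s)) (Icc 0 1) := by
    have h1 : ContinuousOn (fun s => (θ + S * s, γ s)) (Icc 0 1) :=
      ContinuousOn.prodMk (by fun_prop) hγc
    exact hP.smooth_G.continuousOn.comp (g := fun p : ℝ × Plane => G p.1 p.2) h1
      fun t ht => ⟨mem_univ _, (hγ' t ht).1⟩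
  -- For `ε = 0` the deviation obeys a linear equation along the loop, so the limit trajectory lives
  -- on all of `[0, 1]` whatever `ξ` and `ρ` are.
  obtain ⟨w₀, hw0, hw⟩ := exists_linear_solution (B := fun s => S • fderiv ℝ F (γ s))
    (g := fun s => S • (ρ • F (γ s) + G (θ + S * s) (γ s))) (hBγ.const_smul S)
    (((hFγ.const_smul ρ).add hGγ).const_smul S) ((ξ, 0) : Plane)
  let y₀ : ℝ → BlowUp := fun s => (γ s, w₀ s, θ + S * s, ρ, 0)
  have hy₀ : ∀ s ∈ Icc (0 : ℝ) 1, HasDerivWithinAt y₀ (field F G H S (y₀ s)) (Icc 0 1) s := by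
    intro s hs
    have h1 : HasDerivWithinAt (fun s : ℝ => θ + S * s) S (Icc 0 1) s := by
      simpa using (((hasDerivAt_id s).const_mul S).const_add θ).hasDerivWithinAt
    have := (hγ' s hs).2.prodMk ((hw s hs).prodMk (h1.prodMk
      ((hasDerivWithinAt_const s (Icc (0 : ℝ) 1) ρ).prodMk
        (hasDerivWithinAt_const s (Icc (0 : ℝ) 1) (0 : ℝ)))))
    refine this.congr_deriv ?_
    simp [y₀, field, hadamard_zero (hc _ (hγ' s hs).1), point_zero, add_assoc]
  obtain ⟨V, V', hV, hV0, -, -, hVe⟩ := exists_solution_family hy₀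
    (fun s hs => contDiffAt_field L.isOpen L.contDiffOn hε₀ hP (hγ' s hs).1 _ _ _)
  let init : ℝ × ℝ × ℝ × ℝ → BlowUp := fun a => ((xv, 0), (a.2.2.1, 0), a.2.1, a.2.2.2, a.1)
  have hγ0 : γ 0 = (xv, 0) := by simp [hγdef, h0]
  have hinit0 : init (0, θ, ξ, ρ) = y₀ 0 := by simp [init, y₀, hγ0, hw0]
  have hinit : ContDiffAt ℝ 1 init (0, θ, ξ, ρ) := by fun_prop
  have hU : HasStrictFDerivAt (fun a => V (init a)) (V' ∘L fderiv ℝ init (0, θ, ξ, ρ))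
      (0, θ, ξ, ρ) := by
    rw [← hinit0] at hV
    exact HasStrictFDerivAt.comp (0, θ, ξ, ρ) hV (hinit.hasStrictFDerivAt (by simp))
  have hE : ∀ s ∈ Icc (0 : ℝ) 1, ext (V (init (0, θ, ξ, ρ))) s = y₀ s := by
    rw [hinit0]
    exact hV0
  refine ⟨fun a => V (init a), _, hU, fun τ hτ => ⟨w₀ τ, hE τ hτ⟩, fun τ hτ => ?_, ?_⟩
  · simp only
    rw [hE τ hτ]
    exact (hy₀ τ hτ).congr_of_mem hE hτ
  have hUD : ∀ᶠ a in 𝓝 (0, θ, ξ, ρ), ∀ t ∈ Icc (0 : ℝ) 1, (ext (V (init a)) t).1 ∈ D := by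
    refine eventually_forall_ext hU.continuousAt (Q := fun x => x.1 ∈ D) fun t ht => ?_
    rw [hE t ht]
    exact continuousAt_fst.eventually (L.isOpen.mem_nhds (hγ' t ht).1)
  have hVe' : ∀ᶠ a in 𝓝 (0, θ, ξ, ρ), ext (V (init a)) 0 = init a ∧ ∀ t ∈ Icc (0 : ℝ) 1,
      HasDerivWithinAt (ext (V (init a))) (field F G H S (ext (V (init a)) t)) (Icc 0 1) t := by
    rw [← hinit0] at hVe
    exact hinit.continuousAt.eventually hVe
  filter_upwards [hUD, hVe'] with a haD ha τ hτ
  refine ⟨ha.2 τ hτ, ha.1, (ext (V (init a)) τ).2.1, ?_⟩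
  set u := ext (V (init a))
  have hu : ∀ t ∈ Icc (0 : ℝ) 1, HasDerivWithinAt u (field F G H S (u t)) (Icc 0 1) t := ha.2
  -- The first component does not feel the others and starts at the fold, so it stays on the
  -- unperturbed loop also for `ε ≠ 0`.
  have e1 : ∀ t ∈ Icc (0 : ℝ) 1, (u t).1 = γ t := by
    refine eq_of_contDiffAt (V := fun x => S • F x)
      (fun t ht => (hc _ (haD t ht)).const_smul S)
      (fun t ht => (hc _ (hγ' t ht).1).const_smul S) (fun t ht => ?_) (fun t ht => (hγ' t ht).2) ?_
    · exact hasFDerivAt_fst.comp_hasDerivWithinAt t (hu t ht)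
    · rw [ha.1, hγ0]
  have e4 : ∀ t ∈ Icc (0 : ℝ) 1, (u t).2.2.2.1 = a.2.2.2 := fun t ht => by
    have := eq_add_mul_of_hasDerivWithinAt (f := fun t => (u t).2.2.2.1) (c := 0) (fun t ht =>
      (ContinuousLinearMap.hasFDerivAt ((.fst ℝ ℝ ℝ) ∘L (.snd ℝ ℝ (ℝ × ℝ)) ∘L
        (.snd ℝ Plane (ℝ × ℝ × ℝ)) ∘L .snd ℝ Plane (Plane × ℝ × ℝ × ℝ))).comp_hasDerivWithinAt t
        (hu t ht)) t ht
    simpa [ha.1, init] using this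
  have e5 : ∀ t ∈ Icc (0 : ℝ) 1, (u t).2.2.2.2 = a.1 := fun t ht => by
    have := eq_add_mul_of_hasDerivWithinAt (f := fun t => (u t).2.2.2.2) (c := 0) (fun t ht =>
      (ContinuousLinearMap.hasFDerivAt ((.snd ℝ ℝ ℝ) ∘L (.snd ℝ ℝ (ℝ × ℝ)) ∘L
        (.snd ℝ Plane (ℝ × ℝ × ℝ)) ∘L .snd ℝ Plane (Plane × ℝ × ℝ × ℝ))).comp_hasDerivWithinAt t
        (hu t ht)) t ht
    simpa [ha.1, init] using this
  have e3 : ∀ t ∈ Icc (0 : ℝ) 1, (u t).2.2.1 = a.2.1 + S * (1 + a.1 * a.2.2.2) * t :=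
    fun t ht => by
    have := eq_add_mul_of_hasDerivWithinAt (f := fun t => (u t).2.2.1)
      (c := S * (1 + a.1 * a.2.2.2)) (fun t ht => by
      have := (ContinuousLinearMap.hasFDerivAt ((.fst ℝ ℝ (ℝ × ℝ)) ∘L
        (.snd ℝ Plane (ℝ × ℝ × ℝ)) ∘L .snd ℝ Plane (Plane × ℝ × ℝ × ℝ))).comp_hasDerivWithinAt t
        (hu t ht)
      refine this.congr_deriv ?_
      simp [field, e4 t ht, e5 t ht]) t ht
    simpa [ha.1, init] using this
  rw [← e3 τ hτ, ← e4 τ hτ, ← e5 τ hτ]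
  change u τ = (γ τ, _)
  rw [← e1 τ hτ]

end VisibleLoop

end TwoFold

namespace TwoFold

namespace VisibleLoop

open BlowUp

variable {D : Set Plane} {F : Plane → Plane} {G : ℝ → Plane → Plane} {H : ℝ → Plane → ℝ → Plane}
  {xv S ε₀ T : ℝ}

theorem hasDerivWithinAt_point {u : ℝ → BlowUp} {u' : BlowUp} {ε τ : ℝ} {s : Set ℝ}
    (hu : HasDerivWithinAt u u' s τ) (hε : ∀ t ∈ s, (u t).2.2.2.2 = ε) (hτ : τ ∈ s) :
    HasDerivWithinAt (fun t => (u t).point) (u'.1 + ε • u'.2.1) s τ := by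
  have h1 : HasDerivWithinAt (fun t => (u t).1) u'.1 s τ :=
    (hasFDerivAt_fst (p := u τ)).comp_hasDerivWithinAt τ hu
  have h2 : HasDerivWithinAt (fun t => (u t).2.1) u'.2.1 s τ :=
    (ContinuousLinearMap.hasFDerivAt ((.fst ℝ Plane (ℝ × ℝ × ℝ)) ∘L
      .snd ℝ Plane (Plane × ℝ × ℝ × ℝ))).comp_hasDerivWithinAt τ hu
  refine (h1.add (h2.const_smul ε)).congr_of_mem (fun t ht => ?_) hτ
  simp [point, hε t ht]

/-- For `ε = 0` the vertical velocity has derivative `S F₁ ∂ₓF₂ < 0` at the visible fold, the loop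
is below the line in between, and it exits upwards. These open conditions hold on compact time
intervals, hence persist; they are the input of `neg_of_fold`. -/
theorem eventually_lowerArc_signs (L : VisibleLoop D F xv S) (hε₀ : 0 < ε₀)
    (hP : PeriodicPerturbation D ε₀ T G H) {θ ξ ρ : ℝ}
    {U : ℝ × ℝ × ℝ × ℝ → C(unitInterval, BlowUp)} (hU : ContinuousAt U (0, θ, ξ, ρ))
    (hU0 : ∀ τ ∈ Icc (0 : ℝ) 1, ∃ w, ext (U (0, θ, ξ, ρ)) τ =
        (flow F D (S * τ) (xv, 0), w, θ + S * τ, ρ, 0))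
    (hU0d : ∀ τ ∈ Icc (0 : ℝ) 1, HasDerivWithinAt (ext (U (0, θ, ξ, ρ)))
        (field F G H S (ext (U (0, θ, ξ, ρ)) τ)) (Icc 0 1) τ) :
    ∃ δ ∈ Ioo (0 : ℝ) 1, ∃ η ∈ Ioo (0 : ℝ) 1, ∀ᶠ a in 𝓝 (0, θ, ξ, ρ),
      (∀ τ ∈ Icc 0 δ, DifferentiableAt ℝ (value F G H) (ext (U a) τ) ∧
        (fderiv ℝ (value F G H) (ext (U a) τ) (field F G H S (ext (U a) τ))).2 < 0) ∧
      (∀ τ ∈ Icc δ η, (ext (U a) τ).point.2 < 0) ∧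
      ∀ τ ∈ Icc η 1, 0 < (value F G H (ext (U a) τ)).2 := by
  have hS := L.pos
  obtain ⟨h0, hγ⟩ := flow_spec L.isOpen L.contDiffOn L.pos.le L.defined
  have hm : ∀ s ∈ Icc (0 : ℝ) 1, S * s ∈ Icc 0 S :=
    fun s hs => ⟨mul_nonneg hS.le hs.1, mul_le_of_le_one_right hS.le hs.2⟩
  set u := ext (U (0, θ, ξ, ρ)) with hu
  have hcont : Continuous u := continuous_ext _
  have hval : ∀ τ ∈ Icc (0 : ℝ) 1, ContDiffAt ℝ 1 (value F G H) (u τ) := fun τ hτ => by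
    obtain ⟨w, hw⟩ := hU0 τ hτ
    rw [hw]
    exact contDiffAt_value L.isOpen L.contDiffOn hε₀ hP (hγ _ (hm τ hτ)).1 _ _ _
  have hfield : ∀ τ ∈ Icc (0 : ℝ) 1, ContDiffAt ℝ 1 (field F G H S) (u τ) := fun τ hτ => by
    obtain ⟨w, hw⟩ := hU0 τ hτ
    rw [hw]
    exact contDiffAt_field L.isOpen L.contDiffOn hε₀ hP (hγ _ (hm τ hτ)).1 _ _ _
  have hval0 : ∀ τ ∈ Icc (0 : ℝ) 1, value F G H (u τ) = F (flow F D (S * τ) (xv, 0)) :=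
    fun τ hτ => by
    obtain ⟨w, hw⟩ := hU0 τ hτ
    rw [hw, value_zero]
  have m0 : (0 : ℝ) ∈ Icc (0 : ℝ) 1 := ⟨le_rfl, zero_le_one⟩
  have m1 : (1 : ℝ) ∈ Icc (0 : ℝ) 1 := ⟨zero_le_one, le_rfl⟩
  have hψ0 : (fderiv ℝ (value F G H) (u 0) (field F G H S (u 0))).2 < 0 := by
    have d1 : HasDerivWithinAt (fun τ => value F G H (u τ))
        (fderiv ℝ (value F G H) (u 0) (field F G H S (u 0))) (Icc 0 1) 0 :=
      ((hval 0 m0).differentiableAt (by simp)).hasFDerivAt.comp_hasDerivWithinAt 0 (hU0d 0 m0)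
    have d2 : HasDerivWithinAt (fun τ => F (flow F D (S * τ) (xv, 0)))
        (fderiv ℝ F (xv, 0) (S • F (xv, 0))) (Icc 0 1) 0 := by
      have e1 := hasDerivWithinAt_comp_mul hS.le (hγ _ (hm 0 m0)).2
      have e2 : HasFDerivAt F (fderiv ℝ F (xv, 0)) (flow F D (S * 0) (xv, 0)) := by
        rw [mul_zero, h0]
        exact ((L.contDiffOn.contDiffAt (L.isOpen.mem_nhds L.mem)).differentiableAt
          (by simp)).hasFDerivAt
      have := e2.comp_hasDerivWithinAt 0 e1
      rw [mul_zero, h0] at this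
      exact this
    have := UniqueDiffWithinAt.eq_deriv _ (uniqueDiffOn_Icc zero_lt_one 0 m0) d1
      (d2.congr_of_mem hval0 m0)
    have hp : F (xv, 0) = (F (xv, 0)).1 • ((1, 0) : Plane) := by
      ext
      · simp
      · simp [L.tangent]
    rw [this, hp, map_smul, map_smul]
    simp only [Prod.smul_snd, smul_eq_mul]
    rw [← L.dxF₂_eq]
    have := L.visible
    nlinarith
  have hval1 : 0 < (value F G H (u 1)).2 := by
    rw [hval0 1 m1, mul_one]
    exact L.exit
  have E0 : ∀ᶠ y in 𝓝 (u 0), DifferentiableAt ℝ (value F G H) y ∧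
      (fderiv ℝ (value F G H) y (field F G H S y)).2 < 0 := by
    refine ((eventually_contDiffAt_one (hval 0 m0)).mono fun y hy =>
      hy.differentiableAt (by simp)).and ?_
    have : ContinuousAt (fun y => (fderiv ℝ (value F G H) y (field F G H S y)).2) (u 0) :=
      ((continuousAt_fderiv_of_contDiffAt (hval 0 m0)).clm_apply (hfield 0 m0).continuousAt).snd
    exact this.eventually (gt_mem_nhds hψ0)
  have E1 : ∀ᶠ y in 𝓝 (u 1), 0 < (value F G H y).2 :=
    (hval 1 m1).continuousAt.snd.eventually (lt_mem_nhds hval1)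
  obtain ⟨δ, hδ, hδ'⟩ : ∃ δ ∈ Ioo (0 : ℝ) 1, ∀ τ ∈ Icc 0 δ, ∀ᶠ y in 𝓝 (u τ),
      DifferentiableAt ℝ (value F G H) y ∧
      (fderiv ℝ (value F G H) y (field F G H S y)).2 < 0 := by
    obtain ⟨r, hr, hball⟩ := Metric.eventually_nhds_iff.1
      (hcont.continuousAt.eventually E0.eventually_nhds)
    refine ⟨min (r / 2) (1 / 2), ⟨by positivity, by
      exact (min_le_right _ _).trans_lt (by norm_num)⟩, fun τ hτ => hball ?_⟩
    rw [Real.dist_eq, sub_zero, abs_of_nonneg hτ.1]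
    linarith [hτ.2, min_le_left (r / 2) (1 / 2 : ℝ)]
  obtain ⟨η, hη, hη'⟩ : ∃ η ∈ Ioo (0 : ℝ) 1, ∀ τ ∈ Icc η 1, ∀ᶠ y in 𝓝 (u τ),
      0 < (value F G H y).2 := by
    obtain ⟨r, hr, hball⟩ := Metric.eventually_nhds_iff.1
      (hcont.continuousAt.eventually E1.eventually_nhds)
    have := min_le_left (r / 2) (1 / 2 : ℝ)
    have h2 := min_le_right (r / 2) (1 / 2 : ℝ)
    have h3 : 0 < min (r / 2) (1 / 2 : ℝ) := by positivity
    refine ⟨1 - min (r / 2) (1 / 2), ⟨by linarith, by linarith⟩, fun τ hτ => hball ?_⟩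
    rw [Real.dist_eq, abs_sub_comm, abs_of_nonneg (by linarith [hτ.2])]
    linarith [hτ.1]
  refine ⟨δ, hδ, η, hη, (eventually_forall_ext hU hδ').and ((eventually_forall_ext hU
    (Q := fun y => y.point.2 < 0) fun τ hτ => ?_).and
    (eventually_forall_ext hU (Q := fun y => 0 < (value F G H y).2) hη'))⟩
  have hτ1 : τ ∈ Ioo (0 : ℝ) 1 := ⟨hδ.1.trans_le hτ.1, hτ.2.trans_lt hη.2⟩
  have hneg : (u τ).point.2 < 0 := by
    obtain ⟨w, hw⟩ := hU0 τ (Ioo_subset_Icc_self hτ1)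
    rw [hw, point_zero]
    exact L.below _ ⟨mul_pos hS hτ1.1, mul_lt_of_lt_one_right hS hτ1.2⟩
  exact contDiff_point.continuous.snd.continuousAt.eventually (gt_mem_nhds hneg)

/-- Perturbed trajectories near the loop: up to the order `ε`, they end where `P` says. -/
theorem exists_lowerArc (L : VisibleLoop D F xv S) (hε₀ : 0 < ε₀)
    (hP : PeriodicPerturbation D ε₀ T G H) (θ ξ ρ : ℝ) :
    ∃ (P : ℝ × ℝ × ℝ × ℝ → Plane) (P' : ℝ × ℝ × ℝ × ℝ →L[ℝ] Plane),
      HasStrictFDerivAt P P' (0, θ, ξ, ρ) ∧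
      (∀ᶠ b : ℝ × ℝ × ℝ in 𝓝 (θ, ξ, ρ), P (0, b) =
        (b.2.2 * S + b.2.1 / (F (xv, 0)).1) • F (flow F D S (xv, 0)) +
          duhamel D F G S (xv, 0) b.1) ∧
      ∀ᶠ a in 𝓝 (0, θ, ξ, ρ), ∃ z,
        IsLowerArc D (perturb F G H a.1) a.2.1 (S * (1 + a.1 * a.2.2.2)) z ∧
        z 0 = (xv + a.1 * a.2.2.1, 0) ∧
        z (S * (1 + a.1 * a.2.2.2)) = flow F D S (xv, 0) + a.1 • P a := by
  have hS := L.pos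
  obtain ⟨h0, hγ⟩ := flow_spec L.isOpen L.contDiffOn L.pos.le L.defined
  have hm : ∀ s ∈ Icc (0 : ℝ) 1, S * s ∈ Icc 0 S :=
    fun s hs => ⟨mul_nonneg hS.le hs.1, mul_le_of_le_one_right hS.le hs.2⟩
  have hc : ∀ x ∈ D, ContDiffAt ℝ 1 F x := fun x hx =>
    (L.contDiffOn.contDiffAt (L.isOpen.mem_nhds hx)).of_le (by norm_num)
  have m0 : (0 : ℝ) ∈ Icc (0 : ℝ) 1 := ⟨le_rfl, zero_le_one⟩
  have m1 : (1 : ℝ) ∈ Icc (0 : ℝ) 1 := ⟨zero_le_one, le_rfl⟩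
  obtain ⟨U, U', hU, hU0, hU0d, hUe⟩ := L.exists_blowUp_family hε₀ hP θ ξ ρ
  -- Reads off the deviation `w` at the end of the arc: a continuous linear map, so `P` inherits
  -- strict differentiability from the family of curves.
  let Λ : C(unitInterval, BlowUp) →L[ℝ] Plane :=
    (.fst ℝ Plane (ℝ × ℝ × ℝ)) ∘L (.snd ℝ Plane (Plane × ℝ × ℝ × ℝ)) ∘L
      ContinuousMap.evalCLM ℝ (1 : unitInterval)
  have hΛ : ∀ a, Λ (U a) = (ext (U a) 1).2.1 := fun a => by
    rw [ext_of_mem _ m1]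
    rfl
  refine ⟨fun a => Λ (U a), Λ ∘L U', HasStrictFDerivAt.comp (0, θ, ξ, ρ) Λ.hasStrictFDerivAt hU,
    ?_, ?_⟩
  · have hi : ContinuousAt (fun b : ℝ × ℝ × ℝ => ((0 : ℝ), b)) (θ, ξ, ρ) := by fun_prop
    filter_upwards [hi.eventually hUe] with b hb
    simp only [hΛ]
    refine L.linear_value hP (w := fun τ => (ext (U (0, b)) τ).2.1) (θ := b.1) (ξ := b.2.1)
      (ρ := b.2.2) (by rw [(hb 0 m0).2.1]) fun τ hτ => ?_
    obtain ⟨h1, -, w, hw⟩ := hb τ hτ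
    have h2 : HasDerivWithinAt (fun t => (ext (U (0, b)) t).2.1)
        (field F G H S (ext (U (0, b)) τ)).2.1 (Icc 0 1) τ :=
      (ContinuousLinearMap.hasFDerivAt ((.fst ℝ Plane (ℝ × ℝ × ℝ)) ∘L
        .snd ℝ Plane (Plane × ℝ × ℝ × ℝ))).comp_hasDerivWithinAt τ h1
    refine h2.congr_deriv ?_
    rw [hw]
    simp [field, hadamard_zero (hc _ (hγ _ (hm τ hτ)).1), point_zero]
  · obtain ⟨δ, hδ, η, hη, hsign⟩ := L.eventually_lowerArc_signs hε₀ hP hU.continuousAt hU0 hU0d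
    have hUD : ∀ᶠ a in 𝓝 (0, θ, ξ, ρ), ∀ τ ∈ Icc (0 : ℝ) 1, (ext (U a) τ).point ∈ D := by
      refine eventually_forall_ext hU.continuousAt (Q := fun y => y.point ∈ D) fun τ hτ => ?_
      obtain ⟨w, hw⟩ := hU0 τ hτ
      refine contDiff_point.continuous.continuousAt.eventually (L.isOpen.mem_nhds ?_)
      rw [hw, point_zero]
      exact (hγ _ (hm τ hτ)).1
    have hUH : ∀ᶠ a in 𝓝 (0, θ, ξ, ρ), ∀ τ ∈ Icc (0 : ℝ) 1,
        F ((ext (U a) τ).1 + (ext (U a) τ).2.2.2.2 • (ext (U a) τ).2.1) = F (ext (U a) τ).1 +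
          (ext (U a) τ).2.2.2.2 •
            hadamard F ((ext (U a) τ).1, (ext (U a) τ).2.2.2.2, (ext (U a) τ).2.1) := by
      refine eventually_forall_ext hU.continuousAt (Q := fun y : BlowUp =>
        F (y.1 + y.2.2.2.2 • y.2.1) =
          F y.1 + y.2.2.2.2 • hadamard F (y.1, y.2.2.2.2, y.2.1)) fun τ hτ => ?_
      obtain ⟨w, hw⟩ := hU0 τ hτ
      rw [hw]
      have hcont : ContinuousAt (fun y : BlowUp => (y.1, y.2.2.2.2, y.2.1))
        (flow F D (S * τ) (xv, 0), w, θ + S * τ, ρ, 0) := by fun_prop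
      exact hcont.eventually (eventually_apply_add_smul (hc _ (hγ _ (hm τ hτ)).1) w)
    have hℓ : ∀ᶠ a : ℝ × ℝ × ℝ × ℝ in 𝓝 (0, θ, ξ, ρ), 0 < S * (1 + a.1 * a.2.2.2) := by
      have : ContinuousAt (fun a : ℝ × ℝ × ℝ × ℝ => S * (1 + a.1 * a.2.2.2)) (0, θ, ξ, ρ) := by
        fun_prop
      exact this.eventually (lt_mem_nhds (by simpa using hS))
    filter_upwards [hUe, hsign, hUD, hUH, hℓ] with a ha hs haD haH hℓ
    set ℓ := S * (1 + a.1 * a.2.2.2)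
    set u := ext (U a)
    have hε : ∀ τ ∈ Icc (0 : ℝ) 1, (u τ).2.2.2.2 = a.1 := fun τ hτ => by
      obtain ⟨-, -, w, hw⟩ := ha τ hτ
      rw [hw]
    have hρ : ∀ τ ∈ Icc (0 : ℝ) 1, (u τ).2.2.2.1 = a.2.2.2 := fun τ hτ => by
      obtain ⟨-, -, w, hw⟩ := ha τ hτ
      rw [hw]
    have ht : ∀ τ ∈ Icc (0 : ℝ) 1, (u τ).2.2.1 = a.2.1 + ℓ * τ := fun τ hτ => by
      obtain ⟨-, -, w, hw⟩ := ha τ hτ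
      rw [hw]
    have hpoint : ∀ τ ∈ Icc (0 : ℝ) 1, HasDerivWithinAt (fun t => (u t).point)
        (ℓ • value F G H (u τ)) (Icc 0 1) τ := fun τ hτ => by
      refine (hasDerivWithinAt_point (ha τ hτ).1 hε hτ).congr_deriv ?_
      rw [← hε τ hτ, field_point (haH τ hτ), hε τ hτ, hρ τ hτ]
    have hv : ∀ τ ∈ Icc (0 : ℝ) 1,
        value F G H (u τ) = perturb F G H a.1 (a.2.1 + ℓ * τ) (u τ).point := fun τ hτ => by
      rw [value, hε τ hτ, ht τ hτ]
    have hu0 : (u 0).point = (xv + a.1 * a.2.2.1, 0) := by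
      rw [(ha 0 m0).2.1]
      simp [point]
    have hdiv : ∀ s ∈ Icc 0 ℓ, s / ℓ ∈ Icc (0 : ℝ) 1 :=
      fun s hs => ⟨div_nonneg hs.1 hℓ.le, (div_le_one hℓ).2 hs.2⟩
    refine ⟨fun s => (u (s / ℓ)).point, ⟨hℓ, fun s hs => ⟨haD _ (hdiv s hs), ?_⟩, ?_, ?_, ?_⟩,
      ?_, ?_⟩
    · have := hasDerivWithinAt_comp_div hℓ (hpoint _ (hdiv s hs))
      rwa [smul_smul, inv_mul_cancel₀ hℓ.ne', one_smul, hv _ (hdiv s hs),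
        mul_div_cancel₀ _ hℓ.ne'] at this
    · simp [hu0]
    · simp only [zero_div, div_self hℓ.ne']
      intro hneg h1 r hr
      refine neg_of_fold (ζ := fun τ => (u τ).point.2) (χ := fun τ => (value F G H (u τ)).2)
        (χ' := fun τ => (fderiv ℝ (value F G H) (u τ) (field F G H S (u τ))).2)
        hℓ hδ hη (fun τ hτ => ?_) (fun τ hτ => ?_) (fun τ hτ => (hs.1 τ hτ).2) hs.2.1 hs.2.2
        (by simp [hu0]) ?_ h1 (r / ℓ)
        ⟨div_pos hr.1 hℓ, (div_lt_one hℓ).2 hr.2⟩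
      · exact (hasFDerivAt_snd (p := (u τ).point)).comp_hasDerivWithinAt τ (hpoint τ hτ)
      · have hτ1 : τ ∈ Icc (0 : ℝ) 1 := ⟨hτ.1, hτ.2.trans hδ.2.le⟩
        exact (hasFDerivAt_snd (p := value F G H (u τ))).comp_hasDerivWithinAt τ
          ((hs.1 τ hτ).1.hasFDerivAt.comp_hasDerivWithinAt τ (ha τ hτ1).1)
      · rw [hv 0 m0, mul_zero, add_zero]
        exact hneg
    · simp only [div_self hℓ.ne']
      have := hs.2.2 1 ⟨hη.2.le, le_rfl⟩
      rwa [hv 1 m1, mul_one] at this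
    · simp [hu0]
    · simp only [div_self hℓ.ne', hΛ]
      obtain ⟨-, -, w, hw⟩ := ha 1 m1
      simp only [u] at hw ⊢
      rw [hw]
      simp [point]

end VisibleLoop

end TwoFold

namespace TwoFold

/-! ### Implicit functions under strict differentiability -/

section Implicit

variable {E₁ E₂ E₃ : Type*} [NormedAddCommGroup E₁] [NormedSpace ℝ E₁] [NormedAddCommGroup E₂]
  [NormedSpace ℝ E₂] [NormedAddCommGroup E₃] [NormedSpace ℝ E₃]

/-- Strict differentiability at a point. -/
def StrictDiffAt (f : E₁ → E₂) (x : E₁) : Prop := ∃ f' : E₁ →L[ℝ] E₂, HasStrictFDerivAt f f' x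

namespace StrictDiffAt

theorem of_contDiffAt {f : E₁ → E₂} {x : E₁} (h : ContDiffAt ℝ 1 f x) : StrictDiffAt f x :=
  ⟨_, h.hasStrictFDerivAt (by simp)⟩

theorem comp {g : E₂ → E₃} {f : E₁ → E₂} (x : E₁) (hg : StrictDiffAt g (f x))
    (hf : StrictDiffAt f x) : StrictDiffAt (fun x => g (f x)) x := by
  obtain ⟨g', hg⟩ := hg
  obtain ⟨f', hf⟩ := hf
  exact ⟨_, HasStrictFDerivAt.comp x hg hf⟩

theorem prodMk {g : E₁ → E₃} {f : E₁ → E₂} {x : E₁} (hf : StrictDiffAt f x)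
    (hg : StrictDiffAt g x) : StrictDiffAt (fun x => (f x, g x)) x := by
  obtain ⟨g', hg⟩ := hg
  obtain ⟨f', hf⟩ := hf
  exact ⟨_, HasStrictFDerivAt.prodMk hf hg⟩

theorem continuousAt {f : E₁ → E₂} {x : E₁} (h : StrictDiffAt f x) : ContinuousAt f x := by
  obtain ⟨f', hf⟩ := h
  exact hf.continuousAt

end StrictDiffAt

/-- The unknown lives in a finite-dimensional space, where an injective partial derivative is
already invertible. -/
theorem exists_implicit [CompleteSpace E₁] [FiniteDimensional ℝ E₂] {Φ : E₁ × E₂ → E₂}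
    {Φ' : E₁ × E₂ →L[ℝ] E₂} {e₀ : E₁} {x₀ : E₂} (h : HasStrictFDerivAt Φ Φ' (e₀, x₀))
    (h0 : Φ (e₀, x₀) = 0) (hinj : ∀ v, Φ' (0, v) = 0 → v = 0) :
    ∃ ψ : E₁ → E₂, ψ e₀ = x₀ ∧ StrictDiffAt ψ e₀ ∧ ∀ᶠ e in 𝓝 e₀, Φ (e, ψ e) = 0 := by
  have : CompleteSpace E₂ := FiniteDimensional.complete ℝ E₂
  have hinv : (Φ' ∘L .inr ℝ E₁ E₂).IsInvertible := by
    let e := LinearEquiv.ofInjectiveEndo (Φ' ∘L .inr ℝ E₁ E₂ : E₂ →ₗ[ℝ] E₂)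
      ((injective_iff_map_eq_zero _).2 fun v hv => hinj v (by simpa using hv))
    refine ⟨e.toContinuousLinearEquiv, ?_⟩
    ext v
    rfl
  refine ⟨h.implicitFunctionOfProdDomain hinv,
    (h.eventually_apply_eq_iff_implicitFunctionOfProdDomain hinv).self_of_nhds.1 rfl,
    ⟨_, h.hasStrictFDerivAt_implicitFunctionOfProdDomain hinv⟩, ?_⟩
  filter_upwards [h.eventually_apply_implicitFunctionOfProdDomain hinv] with e he
  rw [he, h0]

end Implicit

/-! ### Reflection and time reversal -/

section Reversal

theorem R_add (a b : Plane) : R (a + b) = R a + R b := by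
  ext <;> simp [R]; ring

theorem R_smul (c : ℝ) (a : Plane) : R (c • a) = c • R a := by
  ext <;> simp [R]

theorem R_neg (a : Plane) : R (-a) = -R a := by
  ext <;> simp [R]

@[simp] theorem R_R (a : Plane) : R (R a) = a := by
  ext <;> simp [R]

@[simp] theorem R_snd (a : Plane) : (R a).2 = -a.2 := rfl

@[simp] theorem R_fst (a : Plane) : (R a).1 = a.1 := rfl

theorem R_of_snd_eq_zero {a : Plane} (h : a.2 = 0) : R a = a := by
  ext <;> simp [R, h]

theorem contDiff_R {n : WithTop ℕ∞} : ContDiff ℝ n R := by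
  unfold R
  fun_prop

/-- The time reversal `(t, z) ↦ -R G(-t, R z)` of a field. -/
def rev (G : ℝ → Plane → Plane) (t : ℝ) (z : Plane) : Plane := -R (G (-t) (R z))

/-- The time reversal of a field with a parameter. -/
def revParam (H : ℝ → Plane → ℝ → Plane) (t : ℝ) (z : Plane) (ε : ℝ) : Plane :=
  -R (H (-t) (R z) ε)

/-- Reversing the upper field gives back a perturbation of `F` itself, so upper arcs are covered by
the results on lower arcs. -/
theorem perturb_rev (F : Plane → Plane) (G : ℝ → Plane → Plane) (H : ℝ → Plane → ℝ → Plane)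
    (ε : ℝ) : perturb F (rev G) (revParam H) ε = rev (perturb (reversed F) G H ε) := by
  funext t z
  simp only [perturb, rev, revParam, reversed, R_add, R_smul, R_neg, R_R]
  module

theorem perturb_reversed_rev (F : Plane → Plane) (G : ℝ → Plane → Plane)
    (H : ℝ → Plane → ℝ → Plane) (ε : ℝ) :
    perturb (reversed F) (rev G) (revParam H) ε = rev (perturb F G H ε) := by
  funext t z
  simp only [perturb, rev, revParam, reversed, R_add, R_smul]
  module

theorem PeriodicPerturbation.rev {D : Set Plane} {ε₀ T : ℝ} {G : ℝ → Plane → Plane}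
    {H : ℝ → Plane → ℝ → Plane} (hRD : ∀ z ∈ D, R z ∈ D) (h : PeriodicPerturbation D ε₀ T G H) :
    PeriodicPerturbation D ε₀ T (TwoFold.rev G) (revParam H) where
  smooth_G := by
    refine (contDiff_R.comp_contDiffOn ?_).neg
    refine h.smooth_G.comp (g := fun p : ℝ × Plane => G p.1 p.2)
      (f := fun p : ℝ × Plane => (-p.1, R p.2)) ?_ fun p hp => ⟨mem_univ _, hRD _ hp.2⟩
    exact (contDiff_fst.neg.prodMk (contDiff_R.comp contDiff_snd)).contDiffOn
  smooth_H := by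
    refine (contDiff_R.comp_contDiffOn ?_).neg
    refine h.smooth_H.comp (g := fun p : ℝ × Plane × ℝ => H p.1 p.2.1 p.2.2)
      (f := fun p : ℝ × Plane × ℝ => (-p.1, R p.2.1, p.2.2)) ?_
      fun p hp => ⟨mem_univ _, hRD _ hp.2.1, hp.2.2⟩
    exact (contDiff_fst.neg.prodMk ((contDiff_R.comp (contDiff_fst.comp contDiff_snd)).prodMk
      (contDiff_snd.comp contDiff_snd))).contDiffOn
  periodic_G := fun t z hz => by
    have := h.periodic_G (-t - T) (R z) (hRD z hz)
    rw [sub_add_cancel] at this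
    simp only [TwoFold.rev, neg_add', this]
  periodic_H := fun t z hz ε hε => by
    have := h.periodic_H (-t - T) (R z) (hRD z hz) ε hε
    rw [sub_add_cancel] at this
    simp only [revParam, neg_add', this]

theorem PeriodicPerturbation.periodic_perturb {D : Set Plane} {ε₀ T ε : ℝ} {F : Plane → Plane}
    {G : ℝ → Plane → Plane} {H : ℝ → Plane → ℝ → Plane} (h : PeriodicPerturbation D ε₀ T G H)
    (hε : ε ∈ Ioo (-ε₀) ε₀) (t : ℝ) {z : Plane} (hz : z ∈ D) :
    perturb F G H ε (t + T) z = perturb F G H ε t z := by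
  simp only [perturb, h.periodic_G t z hz, h.periodic_H t z hz ε hε]

end Reversal

/-- This removes starting positions, durations and sliding time from the Melnikov equation, which at
`ε = 0` depends on the phase only. -/
theorem wedge_smul_add (a b : Plane) (c : ℝ) : wedge a (c • a + b) = wedge a b := by
  simp only [wedge, Prod.fst_add, Prod.snd_add, Prod.smul_fst, Prod.smul_snd, smul_eq_mul]
  ring

/-! ### Matching a lower arc with a reversed upper arc -/

namespace VisibleLoop

variable {D : Set Plane} {F : Plane → Plane} {Gp Gm : ℝ → Plane → Plane}
  {Hp Hm : ℝ → Plane → ℝ → Plane} {xv S ε₀ T : ℝ}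

/-- An arc of the lower field and a reversed arc of the upper field, that leave the line `y = 0` at
`xv + ε ξ₁` and `xv + ε ξ₂` and meet on it, the total duration being `2 S - ε η`. -/
structure Matching (D : Set Plane) (F : Plane → Plane) (Gp Gm : ℝ → Plane → Plane)
    (Hp Hm : ℝ → Plane → ℝ → Plane) (xv S ε t₀ ξ₁ ξ₂ η ℓ₁ ℓ₂ : ℝ) (z u : ℝ → Plane) : Prop where
  arc : IsLowerArc D (perturb F Gm Hm ε) t₀ ℓ₁ z
  arc_rev : IsLowerArc D (rev (perturb (reversed F) Gp Hp ε)) (-t₀ + ε * η) ℓ₂ u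
  start : z 0 = (xv + ε * ξ₁, 0)
  start_rev : u 0 = (xv + ε * ξ₂, 0)
  meet : z ℓ₁ = u ℓ₂
  meet_snd : (z ℓ₁).2 = 0
  length : ℓ₁ + ℓ₂ = 2 * S - ε * η

/-- Crossing and sliding orbits differ only in how `ξ₁, ξ₂, η` depend on the free parameter `κ`, so
these are left arbitrary. `hM` and `hB` are the limit equations for the phase and for `κ`; `hM'0`
and `hB'0` are their nondegeneracy. -/
theorem exists_matching (L : VisibleLoop D F xv S) (hRD : ∀ z ∈ D, R z ∈ D) (hε₀ : 0 < ε₀)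
    (hp : PeriodicPerturbation D ε₀ T Gp Hp) (hm : PeriodicPerturbation D ε₀ T Gm Hm)
    {θ κ₀ M' B' : ℝ}
    (hM : wedge (F (flow F D S (xv, 0)))
      (duhamel D F Gm S (xv, 0) θ - duhamel D F (rev Gp) S (xv, 0) (-θ)) = 0)
    (hM' : HasDerivAt (fun s => wedge (F (flow F D S (xv, 0)))
      (duhamel D F Gm S (xv, 0) s - duhamel D F (rev Gp) S (xv, 0) (-s))) M' θ) (hM'0 : M' ≠ 0)
    {ξ₁ ξ₂ η : ℝ × ℝ × ℝ → ℝ} (hξ₁ : StrictDiffAt ξ₁ (0, θ, κ₀))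
    (hξ₂ : StrictDiffAt ξ₂ (0, θ, κ₀)) (hη : StrictDiffAt η (0, θ, κ₀))
    (hB : (F (flow F D S (xv, 0))).2 *
      (-η (0, θ, κ₀) + (ξ₁ (0, θ, κ₀) + ξ₂ (0, θ, κ₀)) / (F (xv, 0)).1) +
      (duhamel D F Gm S (xv, 0) θ + duhamel D F (rev Gp) S (xv, 0) (-θ)).2 = 0)
    (hB' : HasDerivAt (fun κ => -η (0, θ, κ) + (ξ₁ (0, θ, κ) + ξ₂ (0, θ, κ)) / (F (xv, 0)).1)
      B' κ₀) (hB'0 : B' ≠ 0) :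
    ∃ ψ : ℝ → ℝ × ℝ, ψ 0 = (θ, κ₀) ∧ ContinuousAt ψ 0 ∧
      (∃ C > 0, ∀ᶠ ε in 𝓝 0, |(ψ ε).1 - θ| ≤ C * |ε|) ∧
      ∀ᶠ ε in 𝓝 0, ∃ ℓ₁ ℓ₂ z u, Matching D F Gp Gm Hp Hm xv S ε (ψ ε).1
        (ξ₁ (ε, ψ ε)) (ξ₂ (ε, ψ ε)) (η (ε, ψ ε)) ℓ₁ ℓ₂ z u := by
  set q := flow F D S (xv, 0)
  set a := (F (xv, 0)).1
  set I := duhamel D F Gm S (xv, 0)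
  set J := duhamel D F (rev Gp) S (xv, 0)
  have hS := L.pos
  have hq : 0 < (F q).2 := L.exit
  -- `ρ₀` puts the end of the lower arc on the line to first order.
  obtain ⟨ρ₀, hρ₀⟩ : ∃ ρ₀, (F q).2 * (ρ₀ * S + ξ₁ (0, θ, κ₀) / a) + (I θ).2 = 0 :=
    ⟨(-(I θ).2 / (F q).2 - ξ₁ (0, θ, κ₀) / a) / S, by
      rw [div_mul_cancel₀ _ hS.ne', sub_add_cancel, mul_div_cancel₀ _ hq.ne', neg_add_cancel]⟩
  obtain ⟨P, P', hP, hP0, hPe⟩ := L.exists_lowerArc hε₀ hm θ (ξ₁ (0, θ, κ₀)) ρ₀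
  -- The second time scale is forced by the total duration: `S (1 + ε ρ) + S (1 + ε (-ρ - η / S)) =
  -- 2 S - ε η`.
  obtain ⟨Q, Q', hQ, hQ0, hQe⟩ := L.exists_lowerArc hε₀ (hp.rev hRD) (-θ) (ξ₂ (0, θ, κ₀))
    (-ρ₀ - η (0, θ, κ₀) / S)
  let cP : ℝ × ℝ × ℝ × ℝ → ℝ × ℝ × ℝ × ℝ := fun x =>
    (x.1, x.2.1, ξ₁ (x.1, x.2.1, x.2.2.1), x.2.2.2)
  let cQ : ℝ × ℝ × ℝ × ℝ → ℝ × ℝ × ℝ × ℝ := fun x =>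
    (x.1, -x.2.1 + x.1 * η (x.1, x.2.1, x.2.2.1), ξ₂ (x.1, x.2.1, x.2.2.1),
      -x.2.2.2 - η (x.1, x.2.1, x.2.2.1) / S)
  set x₀ : ℝ × ℝ × ℝ × ℝ := (0, θ, κ₀, ρ₀)
  have hproj : StrictDiffAt (fun x : ℝ × ℝ × ℝ × ℝ => (x.1, x.2.1, x.2.2.1)) x₀ :=
    .of_contDiffAt (by fun_prop)
  have hξ₁' : StrictDiffAt (fun x : ℝ × ℝ × ℝ × ℝ => ξ₁ (x.1, x.2.1, x.2.2.1)) x₀ :=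
    .comp x₀ hξ₁ hproj
  have hξ₂' : StrictDiffAt (fun x : ℝ × ℝ × ℝ × ℝ => ξ₂ (x.1, x.2.1, x.2.2.1)) x₀ :=
    .comp x₀ hξ₂ hproj
  have hη' : StrictDiffAt (fun x : ℝ × ℝ × ℝ × ℝ => η (x.1, x.2.1, x.2.2.1)) x₀ :=
    .comp x₀ hη hproj
  have hid : StrictDiffAt (fun x : ℝ × ℝ × ℝ × ℝ => x) x₀ := .of_contDiffAt (by fun_prop)
  have hcP : StrictDiffAt cP x₀ :=
    StrictDiffAt.comp (g := fun p : (ℝ × ℝ × ℝ × ℝ) × ℝ => (p.1.1, p.1.2.1, p.2, p.1.2.2.2)) x₀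
      (.of_contDiffAt (by fun_prop)) (hid.prodMk hξ₁')
  have hcQ : StrictDiffAt cQ x₀ :=
    StrictDiffAt.comp (g := fun p : (ℝ × ℝ × ℝ × ℝ) × ℝ × ℝ =>
      (p.1.1, -p.1.2.1 + p.1.1 * p.2.2, p.2.1, -p.1.2.2.2 - p.2.2 / S)) x₀
      (.of_contDiffAt (by fun_prop)) (hid.prodMk (hξ₂'.prodMk hη'))
  have hcP0 : cP x₀ = (0, θ, ξ₁ (0, θ, κ₀), ρ₀) := rfl
  have hcQ0 : cQ x₀ = (0, -θ, ξ₂ (0, θ, κ₀), -ρ₀ - η (0, θ, κ₀) / S) := by simp [cQ, x₀]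
  -- The meeting conditions after division by `ε`, combined so that at `ε = 0` the first involves
  -- only the phase and the second only the phase and `κ`.
  let Φ : ℝ × ℝ × ℝ × ℝ → ℝ × ℝ × ℝ := fun x =>
    (wedge (F q) (P (cP x) - Q (cQ x)), (P (cP x) + Q (cQ x)).2, (P (cP x)).2)
  obtain ⟨Φ', hΦ⟩ : StrictDiffAt Φ x₀ := by
    have h1 : StrictDiffAt (fun x => P (cP x)) x₀ := .comp x₀ ⟨P', hcP0 ▸ hP⟩ hcP
    have h2 : StrictDiffAt (fun x => Q (cQ x)) x₀ := .comp x₀ ⟨Q', hcQ0 ▸ hQ⟩ hcQ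
    refine StrictDiffAt.comp (g := fun p : Plane × Plane =>
      (wedge (F q) (p.1 - p.2), (p.1 + p.2).2, p.1.2)) x₀ (.of_contDiffAt ?_) (h1.prodMk h2)
    unfold wedge
    fun_prop
  have hexp : ∀ᶠ y : ℝ × ℝ × ℝ in 𝓝 (θ, κ₀, ρ₀), Φ (0, y) =
      (wedge (F q) (I y.1 - J (-y.1)),
        (F q).2 * (-η (0, y.1, y.2.1) + (ξ₁ (0, y.1, y.2.1) + ξ₂ (0, y.1, y.2.1)) / a) +
          (I y.1 + J (-y.1)).2,
        (F q).2 * (y.2.2 * S + ξ₁ (0, y.1, y.2.1) / a) + (I y.1).2) := by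
    have hi : ContinuousAt (fun y : ℝ × ℝ × ℝ => ((0 : ℝ), y)) (θ, κ₀, ρ₀) := by fun_prop
    have e1 : ContinuousAt (fun y : ℝ × ℝ × ℝ => (cP (0, y)).2) (θ, κ₀, ρ₀) :=
      (ContinuousAt.comp (f := fun y : ℝ × ℝ × ℝ => ((0 : ℝ), y)) (x := (θ, κ₀, ρ₀))
        hcP.continuousAt hi).snd
    have e2 : ContinuousAt (fun y : ℝ × ℝ × ℝ => (cQ (0, y)).2) (θ, κ₀, ρ₀) :=
      (ContinuousAt.comp (f := fun y : ℝ × ℝ × ℝ => ((0 : ℝ), y)) (x := (θ, κ₀, ρ₀))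
        hcQ.continuousAt hi).snd
    have e2' : (cQ (0, θ, κ₀, ρ₀)).2 = (-θ, ξ₂ (0, θ, κ₀), -ρ₀ - η (0, θ, κ₀) / S) := by
      rw [show ((0 : ℝ), θ, κ₀, ρ₀) = x₀ from rfl, hcQ0]
    rw [← e2'] at hQ0
    filter_upwards [e1.eventually hP0, e2.eventually hQ0] with y hy1 hy2
    have f1 : P (cP (0, y)) = (y.2.2 * S + ξ₁ (0, y.1, y.2.1) / a) • F q + I y.1 := hy1
    have f2 : Q (cQ (0, y)) = ((-y.2.2 - η (0, y.1, y.2.1) / S) * S +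
        ξ₂ (0, y.1, y.2.1) / a) • F q + J (-y.1) := by
      have : cQ (0, y) = (0, (cQ (0, y)).2) := rfl
      rw [this, hy2]
      simp only [cQ, zero_mul, add_zero]
      rfl
    simp only [Φ, f1, f2]
    refine Prod.ext ?_ (Prod.ext ?_ ?_)
    · simp only
      rw [← wedge_smul_add (F q) (I y.1 - J (-y.1)) ((y.2.2 * S + ξ₁ (0, y.1, y.2.1) / a) -
        ((-y.2.2 - η (0, y.1, y.2.1) / S) * S + ξ₂ (0, y.1, y.2.1) / a))]
      congr 1
      module
    · simp only [Prod.snd_add, Prod.smul_snd, smul_eq_mul]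
      field_simp
      ring
    · simp only [Prod.snd_add, Prod.smul_snd, smul_eq_mul]
      ring
  have hline : ∀ v : ℝ × ℝ × ℝ, HasDerivAt (fun s : ℝ => Φ (0, (θ, κ₀, ρ₀) + s • v))
      (Φ' (0, v)) 0 := by
    intro v
    have h1 : HasDerivAt (fun s : ℝ => ((0 : ℝ), (θ, κ₀, ρ₀) + s • v)) (0, v) 0 := by
      have := ((hasDerivAt_id (0 : ℝ)).smul_const v).const_add (θ, κ₀, ρ₀)
      simpa using (hasDerivAt_const (0 : ℝ) (0 : ℝ)).prodMk this
    have h2 : HasFDerivAt Φ Φ' ((0 : ℝ), (θ, κ₀, ρ₀) + (0 : ℝ) • v) := by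
      simpa using hΦ.hasFDerivAt
    exact h2.comp_hasDerivAt 0 h1
  have hline' : ∀ v : ℝ × ℝ × ℝ, ∀ᶠ s : ℝ in 𝓝 0, Φ (0, (θ, κ₀, ρ₀) + s • v) =
      (wedge (F q) (I (θ + s * v.1) - J (-(θ + s * v.1))),
        (F q).2 * (-η (0, θ + s * v.1, κ₀ + s * v.2.1) + (ξ₁ (0, θ + s * v.1, κ₀ + s * v.2.1) +
          ξ₂ (0, θ + s * v.1, κ₀ + s * v.2.1)) / a) + (I (θ + s * v.1) + J (-(θ + s * v.1))).2,
        (F q).2 * ((ρ₀ + s * v.2.2) * S + ξ₁ (0, θ + s * v.1, κ₀ + s * v.2.1) / a) +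
          (I (θ + s * v.1)).2) := by
    intro v
    have hc : ContinuousAt (fun s : ℝ => (θ, κ₀, ρ₀) + s • v) 0 := by fun_prop
    have h2 : (θ, κ₀, ρ₀) + (0 : ℝ) • v = (θ, κ₀, ρ₀) := by simp
    have := hc.eventually (h2.symm ▸ hexp)
    exact this
  have hΦ0 : Φ x₀ = 0 := by
    have := hexp.self_of_nhds
    simp only at this
    rw [hM, hB, hρ₀] at this
    exact this
  have hv1 : (Φ' (0, (1, 0, 0))).1 = M' := by
    have h1 : HasDerivAt (fun s : ℝ => (Φ (0, (θ, κ₀, ρ₀) + s • (1, 0, 0))).1)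
        (Φ' (0, (1, 0, 0))).1 0 := (ContinuousLinearMap.fst ℝ ℝ (ℝ × ℝ)).hasFDerivAt.comp_hasDerivAt 0
        (hline _)
    have h2 : HasDerivAt (fun s : ℝ => wedge (F q) (I (θ + s) - J (-(θ + s)))) M' 0 := by
      have h3 : HasDerivAt (fun s => wedge (F q) (I s - J (-s))) M' (θ + 0) := by
        rwa [add_zero]
      exact h3.comp_const_add θ 0
    refine h1.unique (h2.congr_of_eventuallyEq ?_)
    filter_upwards [hline' (1, 0, 0)] with s hs
    rw [hs]
    simp
  have hv2 : (Φ' (0, (0, 1, 0))).1 = 0 ∧ (Φ' (0, (0, 1, 0))).2.1 = (F q).2 * B' := by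
    constructor
    · have h1 : HasDerivAt (fun s : ℝ => (Φ (0, (θ, κ₀, ρ₀) + s • (0, 1, 0))).1)
        (Φ' (0, (0, 1, 0))).1 0 := (ContinuousLinearMap.fst ℝ ℝ (ℝ × ℝ)).hasFDerivAt.comp_hasDerivAt 0
        (hline _)
      refine h1.unique ((hasDerivAt_const (0 : ℝ) (0 : ℝ)).congr_of_eventuallyEq ?_)
      filter_upwards [hline' (0, 1, 0)] with s hs
      rw [hs]
      simpa using hM
    · have h1 : HasDerivAt (fun s : ℝ => (Φ (0, (θ, κ₀, ρ₀) + s • (0, 1, 0))).2.1)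
        (Φ' (0, (0, 1, 0))).2.1 0 :=
        (ContinuousLinearMap.hasFDerivAt ((.fst ℝ ℝ ℝ) ∘L .snd ℝ ℝ (ℝ × ℝ))).comp_hasDerivAt 0
          (hline _)
      have h2 : HasDerivAt (fun s => (F q).2 * (-η (0, θ, κ₀ + s) + (ξ₁ (0, θ, κ₀ + s) +
          ξ₂ (0, θ, κ₀ + s)) / a) + (I θ + J (-θ)).2) ((F q).2 * B') 0 := by
        have h3 : HasDerivAt (fun κ => -η (0, θ, κ) + (ξ₁ (0, θ, κ) + ξ₂ (0, θ, κ)) / a) B'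
          (κ₀ + 0) := by rwa [add_zero]
        exact ((h3.comp_const_add κ₀ 0).const_mul _).add_const _
      refine h1.unique (h2.congr_of_eventuallyEq ?_)
      filter_upwards [hline' (0, 1, 0)] with s hs
      rw [hs]
      simp
  have hv3 : Φ' (0, (0, 0, 1)) = (0, 0, (F q).2 * S) := by
    have h2 : HasDerivAt (fun s : ℝ => ((0 : ℝ), (0 : ℝ), (F q).2 * (s * S)))
        (0, 0, (F q).2 * S) 0 := by
      have h3 : HasDerivAt (fun s : ℝ => (F q).2 * (s * S)) ((F q).2 * S) 0 := by
        simpa using ((hasDerivAt_id (0 : ℝ)).mul_const S).const_mul (F q).2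
      exact (hasDerivAt_const _ _).prodMk ((hasDerivAt_const _ _).prodMk h3)
    refine (hline (0, 0, 1)).unique (h2.congr_of_eventuallyEq ?_)
    filter_upwards [hline' (0, 0, 1)] with s hs
    rw [hs]
    simp only [mul_zero, add_zero, mul_one]
    refine Prod.ext hM (Prod.ext hB ?_)
    simp only
    linear_combination hρ₀
  -- The Jacobian is triangular with diagonal `M'`, `F₂(q) B'`, `F₂(q) S`; the coordinates of a
  -- kernel vector vanish one after another.
  have hinj : ∀ v : ℝ × ℝ × ℝ, Φ' (0, v) = 0 → v = 0 := by
    rintro ⟨v₁, v₂, v₃⟩ hv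
    have hdec : ((0 : ℝ), v₁, v₂, v₃) = v₁ • ((0 : ℝ), (1 : ℝ), (0 : ℝ), (0 : ℝ)) +
        v₂ • ((0 : ℝ), (0 : ℝ), (1 : ℝ), (0 : ℝ)) + v₃ • ((0 : ℝ), (0 : ℝ), (0 : ℝ), (1 : ℝ)) := by
      simp
    rw [hdec, map_add, map_add, map_smul, map_smul, map_smul, hv3] at hv
    have c1 := congrArg Prod.fst hv
    have c2 := congrArg (fun p => p.2.1) hv
    have c3 := congrArg (fun p => p.2.2) hv
    simp only [Prod.fst_add, Prod.snd_add, Prod.smul_fst, Prod.smul_snd, smul_eq_mul, hv1, hv2.1,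
      hv2.2, mul_zero, add_zero, Prod.fst_zero, Prod.snd_zero] at c1 c2 c3
    have d1 : v₁ = 0 := by simpa [hM'0] using c1
    subst d1
    have d2 : v₂ = 0 := by simpa [hB'0, hq.ne'] using c2
    subst d2
    have d3 : v₃ = 0 := by simpa [hS.ne', hq.ne'] using c3
    rw [d3]
    rfl
  obtain ⟨ψ, hψ0, ⟨ψ', hψ⟩, hψe⟩ := exists_implicit hΦ hΦ0 hinj
  have hψc : ContinuousAt (fun ε => (ε, ψ ε)) 0 := continuousAt_id.prodMk hψ.continuousAt
  refine ⟨fun ε => ((ψ ε).1, (ψ ε).2.1), by simp [hψ0],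
    hψ.continuousAt.fst.prodMk hψ.continuousAt.snd.fst, ?_, ?_⟩
  -- Differentiability of the solution branch at `ε = 0` yields the linear bound on the phase.
  · obtain ⟨C, hC, hb⟩ := hψ.hasFDerivAt.isBigO_sub.exists_pos
    refine ⟨C, hC, hb.bound.mono fun ε hε => ?_⟩
    have := (norm_fst_le (ψ ε - ψ 0)).trans hε
    simpa [hψ0] using this
  · have hψx : ((0 : ℝ), ψ 0) = x₀ := by rw [hψ0]
    have e1 : ContinuousAt (fun ε => cP (ε, ψ ε)) 0 :=
      ContinuousAt.comp (f := fun ε => (ε, ψ ε)) (x := 0) (hψx.symm ▸ hcP.continuousAt) hψc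
    have e2 : ContinuousAt (fun ε => cQ (ε, ψ ε)) 0 :=
      ContinuousAt.comp (f := fun ε => (ε, ψ ε)) (x := 0) (hψx.symm ▸ hcQ.continuousAt) hψc
    rw [← hcP0, ← hψx] at hPe
    rw [← hcQ0, ← hψx] at hQe
    filter_upwards [e1.eventually hPe, e2.eventually hQe, hψe] with ε ⟨z, hz, hz0, hz1⟩ ⟨u, hu, hu0, hu1⟩ hε
    rw [perturb_rev] at hu
    have c1 : wedge (F q) (P (cP (ε, ψ ε)) - Q (cQ (ε, ψ ε))) = 0 := congrArg Prod.fst hε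
    have c2 : (P (cP (ε, ψ ε)) + Q (cQ (ε, ψ ε))).2 = 0 := congrArg (fun p => p.2.1) hε
    have c3 : (P (cP (ε, ψ ε))).2 = 0 := congrArg (fun p => p.2.2) hε
    have c4 : (Q (cQ (ε, ψ ε))).2 = 0 := by simpa [c3] using c2
    -- Both ends lie on the line, so `P - Q` is horizontal; its wedge with `F(q)` vanishes and
    -- `F₂(q) ≠ 0`, hence `P - Q = 0`.
    have hPQ : P (cP (ε, ψ ε)) = Q (cQ (ε, ψ ε)) := by
      refine Prod.ext ?_ (c3.trans c4.symm)
      simp only [wedge, Prod.fst_sub, Prod.snd_sub, c3, c4, sub_zero, mul_zero, add_zero,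
        mul_eq_zero, neg_eq_zero, hq.ne', false_or] at c1
      exact sub_eq_zero.1 c1
    refine ⟨_, _, z, u, hz, hu, hz0, hu0, ?_, ?_, ?_⟩
    · rw [hz1, hu1, hPQ]
    · rw [hz1]
      simp only [Prod.snd_add, Prod.smul_snd, c3, smul_zero, add_zero]
      exact L.hit
    · simp only [cP, cQ]
      field_simp
      ring

end VisibleLoop

end TwoFold

namespace TwoFold

/-! ### Gluing arcs into periodic solutions -/

section Gluing

variable {Xp Xm : ℝ → Plane → Plane} {D : Set Plane} {v w : ℝ → Plane} {a b c T : ℝ}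

theorem IsArc.mono (h : IsArc Xp Xm v a b) {a' b' : ℝ} (ha : a ≤ a') (hb : b' ≤ b) :
    IsArc Xp Xm v a' b' := by
  have hs := Ioo_subset_Ioo ha hb
  rcases h with h | h | h
  · exact Or.inl fun t ht => h t (hs ht)
  · exact Or.inr (Or.inl fun t ht => h t (hs ht))
  · exact Or.inr (Or.inr fun t ht => h t (hs ht))

theorem SlidesDuring.translate (hXp : ∀ t, ∀ z ∈ D, Xp (t + c) z = Xp t z)
    (hXm : ∀ t, ∀ z ∈ D, Xm (t + c) z = Xm t z) (hD : ∀ t ∈ Ioo a b, v t ∈ D)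
    (hw : ∀ t ∈ Ioo (a + c) (b + c), w t = v (t - c)) (h : SlidesDuring Xp Xm v a b) :
    SlidesDuring Xp Xm w (a + c) (b + c) := by
  intro t ht
  have hs : t - c ∈ Ioo a b := ⟨by linarith [ht.1], by linarith [ht.2]⟩
  have e1 : Xp t (w t) = Xp (t - c) (v (t - c)) := by
    have := hXp (t - c) _ (hD _ hs)
    rw [sub_add_cancel] at this
    rw [hw t ht, this]
  have e2 : Xm t (w t) = Xm (t - c) (v (t - c)) := by
    have := hXm (t - c) _ (hD _ hs)
    rw [sub_add_cancel] at this
    rw [hw t ht, this]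
  obtain ⟨h1, h2⟩ := h _ hs
  refine ⟨?_, ?_⟩
  · simp only [slidingRegion, escapingRegion, mem_union, mem_ofPred_eq] at h1 ⊢
    rw [e1, e2, hw t ht]
    exact h1
  · simp only [slidingField] at h2 ⊢
    rw [e1, e2]
    exact (h2.comp_sub_const t c).congr_of_eventuallyEq
      (by filter_upwards [Ioo_mem_nhds ht.1 ht.2] with r hr using hw r hr)

theorem IsArc.translate (hXp : ∀ t, ∀ z ∈ D, Xp (t + c) z = Xp t z)
    (hXm : ∀ t, ∀ z ∈ D, Xm (t + c) z = Xm t z) (hD : ∀ t ∈ Ioo a b, v t ∈ D)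
    (hw : ∀ t ∈ Ioo (a + c) (b + c), w t = v (t - c)) (h : IsArc Xp Xm v a b) :
    IsArc Xp Xm w (a + c) (b + c) := by
  have hs : ∀ t ∈ Ioo (a + c) (b + c), t - c ∈ Ioo a b := fun t ht =>
    ⟨by linarith [ht.1], by linarith [ht.2]⟩
  have hd : ∀ t ∈ Ioo (a + c) (b + c), ∀ x, HasDerivAt v x (t - c) → HasDerivAt w x t :=
    fun t ht x hx => (hx.comp_sub_const t c).congr_of_eventuallyEq
      (by filter_upwards [Ioo_mem_nhds ht.1 ht.2] with r hr using hw r hr)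
  rcases h with h | h | h
  · refine Or.inl fun t ht => ?_
    obtain ⟨h1, h2⟩ := h _ (hs t ht)
    rw [hw t ht]
    have := hXp (t - c) _ (hD _ (hs t ht))
    rw [sub_add_cancel] at this
    exact ⟨h1, hd t ht _ (this ▸ h2)⟩
  · refine Or.inr (Or.inl fun t ht => ?_)
    obtain ⟨h1, h2⟩ := h _ (hs t ht)
    rw [hw t ht]
    have := hXm (t - c) _ (hD _ (hs t ht))
    rw [sub_add_cancel] at this
    exact ⟨h1, hd t ht _ (this ▸ h2)⟩
  · exact Or.inr (Or.inr (h.translate hXp hXm hD hw))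

theorem IsArc.congr (hD : ∀ t ∈ Ioo a b, v t ∈ D) (hw : ∀ t ∈ Ioo a b, w t = v t)
    (h : IsArc Xp Xm v a b) : IsArc Xp Xm w a b := by
  have := h.translate (c := 0) (D := D) (w := w) (by simp) (by simp) hD (by simpa using hw)
  simpa using this

theorem periodic_zsmul {X : ℝ → Plane → Plane} (h : ∀ t, ∀ z ∈ D, X (t + T) z = X t z) (n : ℤ) :
    ∀ t, ∀ z ∈ D, X (t + n • T) z = X t z := fun t z hz =>
  Function.Periodic.zsmul (f := fun t => X t z) (fun t => h t z hz) n t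

/-- A closed curve over one period that is made up of arcs extends to a periodic solution. -/
theorem exists_periodicSolution {t₀ : ℝ} (hT : 0 < T) (hXp : ∀ t, ∀ z ∈ D, Xp (t + T) z = Xp t z)
    (hXm : ∀ t, ∀ z ∈ D, Xm (t + T) z = Xm t z) (hv : ContinuousOn v (Icc t₀ (t₀ + T)))
    (hD : ∀ t ∈ Icc t₀ (t₀ + T), v t ∈ D) (hclosed : v t₀ = v (t₀ + T))
    (hr : ∀ a ∈ Ico t₀ (t₀ + T), ∃ b ∈ Ioc a (t₀ + T), IsArc Xp Xm v a b)
    (hl : ∀ a ∈ Ioc t₀ (t₀ + T), ∃ b ∈ Ico t₀ a, IsArc Xp Xm v b a) :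
    ∃ w, IsPeriodicSolution Xp Xm D T w ∧ ∀ t ∈ Icc t₀ (t₀ + T), w t = v t := by
  have : Fact (0 < T) := ⟨hT⟩
  -- Going through the circle gives continuity from equality at the two ends of the period.
  set w : ℝ → Plane := fun t => AddCircle.liftIco T t₀ v (t : AddCircle T) with hwdef
  have hper : Function.Periodic w T := fun t => by
    simp only [hwdef, AddCircle.coe_add_period]
  have hw0 : ∀ t ∈ Ico t₀ (t₀ + T), w t = v t := fun t ht => AddCircle.liftIco_coe_apply ht
  have hw : ∀ t ∈ Icc t₀ (t₀ + T), w t = v t := by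
    intro t ht
    rcases eq_or_lt_of_le ht.2 with h | h
    · rw [h, hper, hw0 t₀ ⟨le_rfl, by linarith⟩, hclosed]
    · exact hw0 t ⟨ht.1, h⟩
  have hshift : ∀ (n : ℤ), ∀ t ∈ Icc (t₀ + n • T) (t₀ + T + n • T), w t = v (t - n • T) := by
    intro n t ht
    rw [← hw _ ⟨by linarith [ht.1], by linarith [ht.2]⟩, hper.sub_zsmul_eq]
  refine ⟨w, ⟨?_, fun t => ?_, hper, fun a => ⟨?_, ?_⟩⟩, hw⟩
  · exact (AddCircle.liftIco_continuous hclosed hv).comp (AddCircle.continuous_mk' T)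
  · obtain ⟨y, hy, hyt⟩ := hper.exists_mem_Ico hT t t₀
    rw [hyt, hw0 y hy]
    exact hD y (Ico_subset_Icc_self hy)
  · have ha := toIcoMod_mem_Ico hT t₀ a
    obtain ⟨b, hb, hab⟩ := hr _ ha
    have hdecomp := toIcoMod_add_toIcoDiv_zsmul hT t₀ a
    set n := toIcoDiv hT t₀ a
    set a' := toIcoMod hT t₀ a
    refine ⟨b + n • T, by linarith [hb.1], ?_⟩
    rw [← hdecomp]
    exact hab.translate (periodic_zsmul hXp n) (periodic_zsmul hXm n)
      (fun t ht => hD t ⟨ha.1.trans ht.1.le, ht.2.le.trans hb.2⟩)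
      fun t ht => hshift n t ⟨by linarith [ht.1, ha.1], by linarith [ht.2, hb.2]⟩
  · have ha := toIocMod_mem_Ioc hT t₀ a
    obtain ⟨b, hb, hab⟩ := hl _ ha
    have hdecomp := toIocMod_add_toIocDiv_zsmul hT t₀ a
    set n := toIocDiv hT t₀ a
    set a' := toIocMod hT t₀ a
    refine ⟨b + n • T, by linarith [hb.2], ?_⟩
    rw [← hdecomp]
    exact hab.translate (periodic_zsmul hXp n) (periodic_zsmul hXm n)
      (fun t ht => hD t ⟨hb.1.trans ht.1.le, ht.2.le.trans ha.2⟩)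
      fun t ht => hshift n t ⟨by linarith [ht.1, hb.1], by linarith [ht.2, ha.2]⟩

theorem continuousOn_ite_le {f g : ℝ → Plane} (hab : a ≤ b) (hbc : b ≤ c)
    (hf : ContinuousOn f (Icc a b)) (hg : ContinuousOn g (Icc b c)) (h : f b = g b) :
    ContinuousOn (fun t => if t ≤ b then f t else g t) (Icc a c) := by
  have h1 : ContinuousOn (fun t => if t ≤ b then f t else g t) (Icc a b) :=
    hf.congr fun t ht => if_pos ht.2
  have h2 : ContinuousOn (fun t => if t ≤ b then f t else g t) (Icc b c) :=
    hg.congr fun t ht => by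
      rcases eq_or_lt_of_le ht.1 with e | e
      · simp [← e, h]
      · simp [not_le.2 e]
  rw [← Icc_union_Icc_eq_Icc hab hbc]
  exact h1.union_of_isClosed h2 isClosed_Icc isClosed_Icc

/-- A periodic solution glued from three arcs, the last one possibly trivial. -/
theorem exists_periodicSolution_of_arcs {t₀ c₁ c₂ : ℝ} {A B C : ℝ → Plane} (hT : 0 < T)
    (hXp : ∀ t, ∀ z ∈ D, Xp (t + T) z = Xp t z) (hXm : ∀ t, ∀ z ∈ D, Xm (t + T) z = Xm t z)
    (h₁ : t₀ < c₁) (h₂ : c₁ < c₂) (h₃ : c₂ ≤ t₀ + T)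
    (hA : ContinuousOn A (Icc t₀ c₁)) (hB : ContinuousOn B (Icc c₁ c₂))
    (hC : ContinuousOn C (Icc c₂ (t₀ + T)))
    (hAD : ∀ t ∈ Icc t₀ c₁, A t ∈ D) (hBD : ∀ t ∈ Icc c₁ c₂, B t ∈ D)
    (hCD : ∀ t ∈ Icc c₂ (t₀ + T), C t ∈ D)
    (hAB : A c₁ = B c₁) (hBC : B c₂ = C c₂) (hCA : C (t₀ + T) = A t₀)
    (arcA : IsArc Xp Xm A t₀ c₁) (arcB : IsArc Xp Xm B c₁ c₂) (arcC : IsArc Xp Xm C c₂ (t₀ + T)) :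
    ∃ w, IsPeriodicSolution Xp Xm D T w ∧ (∀ t ∈ Icc t₀ c₁, w t = A t) ∧
      (∀ t ∈ Icc c₁ c₂, w t = B t) ∧ ∀ t ∈ Icc c₂ (t₀ + T), w t = C t := by
  set v : ℝ → Plane := fun t => if t ≤ c₂ then (if t ≤ c₁ then A t else B t) else C t with hvdef
  have vA : ∀ t ∈ Icc t₀ c₁, v t = A t := fun t ht => by
    simp [hvdef, ht.2, ht.2.trans h₂.le]
  have vB : ∀ t ∈ Icc c₁ c₂, v t = B t := fun t ht => by
    rcases eq_or_lt_of_le ht.1 with e | e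
    · rw [← e, vA c₁ ⟨h₁.le, le_rfl⟩, hAB]
    · simp [hvdef, ht.2, not_le.2 e]
  have vC : ∀ t ∈ Icc c₂ (t₀ + T), v t = C t := fun t ht => by
    rcases eq_or_lt_of_le ht.1 with e | e
    · rw [← e, vB c₂ ⟨h₂.le, le_rfl⟩, hBC]
    · simp [hvdef, not_le.2 e]
  have arcA' : IsArc Xp Xm v t₀ c₁ := arcA.congr (fun t ht => hAD t (Ioo_subset_Icc_self ht))
    fun t ht => vA t (Ioo_subset_Icc_self ht)
  have arcB' : IsArc Xp Xm v c₁ c₂ := arcB.congr (fun t ht => hBD t (Ioo_subset_Icc_self ht))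
    fun t ht => vB t (Ioo_subset_Icc_self ht)
  have arcC' : IsArc Xp Xm v c₂ (t₀ + T) :=
    arcC.congr (fun t ht => hCD t (Ioo_subset_Icc_self ht))
      fun t ht => vC t (Ioo_subset_Icc_self ht)
  have hv : ContinuousOn v (Icc t₀ (t₀ + T)) :=
    continuousOn_ite_le (h₁.trans h₂).le h₃ (continuousOn_ite_le h₁.le h₂.le hA hB hAB) hC
      (by simp [not_le.2 h₂, hBC])
  have hvD : ∀ t ∈ Icc t₀ (t₀ + T), v t ∈ D := by
    intro t ht
    rcases le_total t c₁ with e | e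
    · rw [vA t ⟨ht.1, e⟩]; exact hAD t ⟨ht.1, e⟩
    rcases le_total t c₂ with e' | e'
    · rw [vB t ⟨e, e'⟩]; exact hBD t ⟨e, e'⟩
    · rw [vC t ⟨e', ht.2⟩]; exact hCD t ⟨e', ht.2⟩
  obtain ⟨w, hw, hwv⟩ := exists_periodicSolution hT hXp hXm hv hvD
    (by rw [vA t₀ ⟨le_rfl, h₁.le⟩, vC _ ⟨h₃, le_rfl⟩, hCA])
    (fun a ha => by
      rcases lt_or_ge a c₁ with e | e
      · exact ⟨c₁, ⟨e, h₂.le.trans h₃⟩, arcA'.mono ha.1 le_rfl⟩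
      rcases lt_or_ge a c₂ with e' | e'
      · exact ⟨c₂, ⟨e', h₃⟩, arcB'.mono e le_rfl⟩
      · exact ⟨t₀ + T, ⟨ha.2, le_rfl⟩, arcC'.mono e' le_rfl⟩)
    (fun a ha => by
      rcases le_or_gt a c₁ with e | e
      · exact ⟨t₀, ⟨le_rfl, ha.1⟩, arcA'.mono le_rfl e⟩
      rcases le_or_gt a c₂ with e' | e'
      · exact ⟨c₁, ⟨h₁.le, e⟩, arcB'.mono le_rfl e'⟩
      · exact ⟨c₂, ⟨(h₁.trans h₂).le, e'⟩, arcC'.mono le_rfl ha.2⟩)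
  exact ⟨w, hw, fun t ht => (hwv t ⟨ht.1, ht.2.trans (h₂.le.trans h₃)⟩).trans (vA t ht),
    fun t ht => (hwv t ⟨h₁.le.trans ht.1, ht.2.trans h₃⟩).trans (vB t ht),
    fun t ht => (hwv t ⟨(h₁.trans h₂).le.trans ht.1, ht.2⟩).trans (vC t ht)⟩

/-- Every time is congruent to one in a given period, with the same fields there. -/
theorem IsPeriodicSolution.exists_mem_Ico (h : IsPeriodicSolution Xp Xm D T w) (hT : 0 < T)
    (hXp : ∀ t, ∀ z ∈ D, Xp (t + T) z = Xp t z) (hXm : ∀ t, ∀ z ∈ D, Xm (t + T) z = Xm t z)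
    (t t₀ : ℝ) : ∃ s ∈ Ico t₀ (t₀ + T), w t = w s ∧ Xp t (w t) = Xp s (w s) ∧
      Xm t (w t) = Xm s (w s) := by
  have hdecomp := toIcoMod_add_toIcoDiv_zsmul hT t₀ t
  set n := toIcoDiv hT t₀ t
  set s := toIcoMod hT t₀ t with hs
  have e : w t = w s := by rw [← hdecomp, h.2.2.1.zsmul n s]
  refine ⟨s, toIcoMod_mem_Ico hT t₀ t, e, ?_, ?_⟩
  · rw [e, ← hdecomp, periodic_zsmul hXp n s _ (h.2.1 s)]
  · rw [e, ← hdecomp, periodic_zsmul hXm n s _ (h.2.1 s)]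

end Gluing

end TwoFold

namespace TwoFold

/-! ### The hypotheses in terms of the loop, and closing matched arcs -/

section Hypotheses

variable {D : Set Plane} {F : Plane → Plane} {xi xv : ℝ} {σ : ℝ → ℝ}

/-- The orbit reaches the line from below, so its final slope is nonnegative; transversality makes
it positive. -/
theorem VisibleLoop.of_returnTime (hD : IsOpen D) (hF : ContDiffOn ℝ 2 F D)
    (h₁ : TwoFolds D F xi xv) (h₂ : ReturnTime D F xi xv σ) : VisibleLoop D F xv (σ xv) := by
  have hxv : xv ∈ Ioc xi xv := ⟨h₁.lt, le_rfl⟩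
  have hS := h₂.pos xv hxv
  refine ⟨hD, hF, h₁.mem_v, h₁.tangent_v, h₁.visible, hS, h₂.defined xv hxv, h₂.below xv hxv,
    h₂.hit xv hxv, lt_of_le_of_ne ?_ (h₂.transverse xv hxv).symm⟩
  obtain ⟨-, hγ⟩ := flow_spec hD hF hS.le (h₂.defined xv hxv)
  have hd : HasDerivWithinAt (fun t => (flow F D t (xv, 0)).2)
      (F (flow F D (σ xv) (xv, 0))).2 (Icc 0 (σ xv)) (σ xv) :=
    (ContinuousLinearMap.snd ℝ ℝ ℝ).hasFDerivAt.comp_hasDerivWithinAt _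
      (hγ _ ⟨hS.le, le_rfl⟩).2
  rw [hasDerivWithinAt_iff_tendsto_slope, Icc_sdiff_right, nhdsWithin_Ico_eq_nhdsLT hS] at hd
  refine ge_of_tendsto hd ?_
  filter_upwards [Ioo_mem_nhdsLT hS] with t ht
  have h1 := h₂.below xv hxv t ht
  rw [slope_def_field, h₂.hit xv hxv, sub_zero]
  exact div_nonneg_of_nonpos h1.le (by linarith [ht.2])

end Hypotheses

namespace VisibleLoop

variable {D : Set Plane} {F : Plane → Plane} {Gp Gm : ℝ → Plane → Plane}
  {Hp Hm : ℝ → Plane → ℝ → Plane} {xv ε₀ T : ℝ} {σ : ℝ → ℝ}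

theorem intervalIntegrable_duhamel {S : ℝ} (L : VisibleLoop D F xv S)
    (hm : PeriodicPerturbation D ε₀ T Gm Hm) (θ : ℝ) :
    IntervalIntegrable (fun t => (flowDeriv F D t (xv, 0)).inverse
      (Gm (t + θ) (flow F D t (xv, 0)))) MeasureTheory.volume 0 S := by
  obtain ⟨Z, hZ⟩ := flowDeriv_spec L.isOpen L.contDiffOn L.pos L.defined
  have hc : ContinuousOn (fun t => Z t (Gm (t + θ) (flow F D t (xv, 0)))) (Icc 0 S) :=
    ContinuousOn.clm_apply (fun t ht => (hZ t ht).2.1.continuousWithinAt) (L.continuousOn_G hm θ)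
  refine ContinuousOn.intervalIntegrable ?_
  rw [uIcc_of_le L.pos.le]
  exact hc.congr fun t ht => by rw [(hZ t ht).1]

theorem rev_add_neg (G : ℝ → Plane → Plane) (t θ : ℝ) (z : Plane) :
    rev G (t + -θ) z = -R (G (-t + θ) (R z)) := by
  rw [rev, neg_add, neg_neg]

/-- The term `R Gp(-t + θ, R ·)` is minus `rev Gp` at time `t - θ`: the Melnikov integral is the
difference of the two first order deviations, and `gNumber` involves their sum. -/
theorem melnikov_eq (L : VisibleLoop D F xv (σ xv)) (hRD : ∀ z ∈ D, R z ∈ D)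
    (hp : PeriodicPerturbation D ε₀ T Gp Hp) (hm : PeriodicPerturbation D ε₀ T Gm Hm) (θ : ℝ) :
    melnikov D F Gp Gm σ θ xv = wedge (F (flow F D (σ xv) (xv, 0)))
      (duhamel D F Gm (σ xv) (xv, 0) θ - duhamel D F (rev Gp) (σ xv) (xv, 0) (-θ)) := by
  rw [melnikov, duhamel, duhamel, ← map_sub, ← intervalIntegral.integral_sub
    (L.intervalIntegrable_duhamel hm θ) (L.intervalIntegrable_duhamel (hp.rev hRD) (-θ))]
  simp only [rev_add_neg, ← map_sub, sub_neg_eq_add]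

theorem gNumber_eq (L : VisibleLoop D F xv (σ xv)) (hRD : ∀ z ∈ D, R z ∈ D)
    (hp : PeriodicPerturbation D ε₀ T Gp Hp) (hm : PeriodicPerturbation D ε₀ T Gm Hm) (θ : ℝ) :
    gNumber D F Gp Gm σ xv θ =
      (duhamel D F Gm (σ xv) (xv, 0) θ + duhamel D F (rev Gp) (σ xv) (xv, 0) (-θ)).2 := by
  rw [gNumber, duhamel, duhamel, ← map_add, ← intervalIntegral.integral_add
    (L.intervalIntegrable_duhamel hm θ) (L.intervalIntegrable_duhamel (hp.rev hRD) (-θ))]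
  simp only [rev_add_neg, ← map_add, sub_eq_add_neg]

end VisibleLoop

theorem hasDerivAt_R {v : ℝ → Plane} {v' : Plane} {t : ℝ} (h : HasDerivAt v v' t) :
    HasDerivAt (fun t => R (v t)) (R v') t :=
  ((hasFDerivAt_fst (p := v t)).comp_hasDerivAt t h).prodMk
    ((hasFDerivAt_snd (p := v t)).comp_hasDerivAt t h).neg

namespace VisibleLoop.Matching

variable {D : Set Plane} {F : Plane → Plane} {Gp Gm : ℝ → Plane → Plane}
  {Hp Hm : ℝ → Plane → ℝ → Plane} {xv S ε₀ ε t₀ ξ₁ ξ₂ η ℓ₁ ℓ₂ : ℝ} {z u : ℝ → Plane}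

/-- Matching arcs, closed by an arc from the landing point to the starting point. -/
theorem exists_periodicSolution
    (M : Matching D F Gp Gm Hp Hm xv S ε t₀ ξ₁ ξ₂ η ℓ₁ ℓ₂ z u) (hRD : ∀ z ∈ D, R z ∈ D)
    (hp : PeriodicPerturbation D ε₀ (2 * S) Gp Hp) (hm : PeriodicPerturbation D ε₀ (2 * S) Gm Hm)
    (hε : ε ∈ Ioo (-ε₀) ε₀) (hη : 0 ≤ ε * η)
    (h₁ : (perturb F Gm Hm ε t₀ (xv + ε * ξ₁, 0)).2 ≤ 0)
    (h₂ : (perturb (reversed F) Gp Hp ε (t₀ - ε * η) (xv + ε * ξ₂, 0)).2 ≤ 0)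
    {C : ℝ → Plane} (hC : ContinuousOn C (Icc (t₀ - ε * η + 2 * S) (t₀ + 2 * S)))
    (hCD : ∀ t ∈ Icc (t₀ - ε * η + 2 * S) (t₀ + 2 * S), C t ∈ D)
    (hC₁ : C (t₀ - ε * η + 2 * S) = (xv + ε * ξ₂, 0)) (hC₂ : C (t₀ + 2 * S) = (xv + ε * ξ₁, 0))
    (arcC : IsArc (perturb (reversed F) Gp Hp ε) (perturb F Gm Hm ε) C
      (t₀ - ε * η + 2 * S) (t₀ + 2 * S)) :
    ∃ (w : ℝ → Plane) (c : ℝ), c ∈ Ioo t₀ (t₀ - ε * η + 2 * S) ∧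
      IsPeriodicSolution (perturb (reversed F) Gp Hp ε) (perturb F Gm Hm ε) D (2 * S) w ∧
      w t₀ = (xv + ε * ξ₁, 0) ∧ (∀ t ∈ Ioo t₀ c, (w t).2 < 0) ∧
      (c, w c) ∈ crossingRegion (perturb (reversed F) Gp Hp ε) (perturb F Gm Hm ε) ∧
      (∀ t ∈ Ioo c (t₀ - ε * η + 2 * S), 0 < (w t).2) ∧
      ∀ t ∈ Icc (t₀ - ε * η + 2 * S) (t₀ + 2 * S), w t = C t := by
  have hℓ₁ := M.arc.pos
  have hℓ₂ := M.arc_rev.pos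
  have hlen := M.length
  have hper : ∀ t, ∀ z ∈ D,
      perturb (reversed F) Gp Hp ε (t + 2 * S) z = perturb (reversed F) Gp Hp ε t z :=
    fun t z hz => hp.periodic_perturb hε t hz
  have hz_neg : ∀ s ∈ Ioo 0 ℓ₁, (z s).2 < 0 := M.arc.below (by rw [M.start]; exact h₁) M.meet_snd
  have hu_neg : ∀ s ∈ Ioo 0 ℓ₂, (u s).2 < 0 := by
    refine M.arc_rev.below ?_ (by rw [← M.meet]; exact M.meet_snd)
    rw [M.start_rev, rev, R_of_snd_eq_zero (a := (xv + ε * ξ₂, 0)) rfl]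
    simp only [Prod.snd_neg, R_snd, neg_neg]
    rwa [neg_add, neg_neg, ← sub_eq_add_neg]
  set c₂ := t₀ - ε * η + 2 * S with hc₂
  have hcc : c₂ = t₀ + ℓ₁ + ℓ₂ := by rw [hc₂]; linarith
  have mA : ∀ t ∈ Icc t₀ (t₀ + ℓ₁), t - t₀ ∈ Icc 0 ℓ₁ := fun t ht =>
    ⟨by linarith [ht.1], by linarith [ht.2]⟩
  have mB : ∀ t ∈ Icc (t₀ + ℓ₁) c₂, c₂ - t ∈ Icc 0 ℓ₂ := fun t ht =>
    ⟨by linarith [ht.2], by linarith [ht.1]⟩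
  have hzc : ContinuousOn z (Icc 0 ℓ₁) := fun s hs => (M.arc.sol s hs).2.continuousWithinAt
  have huc : ContinuousOn u (Icc 0 ℓ₂) := fun s hs => (M.arc_rev.sol s hs).2.continuousWithinAt
  have arcA : ∀ t ∈ Ioo t₀ (t₀ + ℓ₁), (z (t - t₀)).2 < 0 ∧
      HasDerivAt (fun t => z (t - t₀)) (perturb F Gm Hm ε t (z (t - t₀))) t := by
    intro t ht
    have hs : t - t₀ ∈ Ioo 0 ℓ₁ := ⟨by linarith [ht.1], by linarith [ht.2]⟩
    refine ⟨hz_neg _ hs, ?_⟩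
    have := ((M.arc.sol _ (Ioo_subset_Icc_self hs)).2.hasDerivAt
      (Icc_mem_nhds hs.1 hs.2)).comp_sub_const t t₀
    rwa [add_sub_cancel] at this
  -- The reversed clock shows `2 S - t`, so the upper field is evaluated at `t - 2 S`; periodicity
  -- turns this into `t`.
  have hrev : ∀ t, ∀ y ∈ D, -R (rev (perturb (reversed F) Gp Hp ε) (-t₀ + ε * η + (c₂ - t)) y) =
      perturb (reversed F) Gp Hp ε t (R y) := by
    intro t y hy
    rw [rev, R_neg, neg_neg, R_R, ← hper _ _ (hRD y hy)]
    congr 1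
    rw [hc₂]
    ring
  have arcB : ∀ t ∈ Ioo (t₀ + ℓ₁) c₂, 0 < (R (u (c₂ - t))).2 ∧
      HasDerivAt (fun t => R (u (c₂ - t))) (perturb (reversed F) Gp Hp ε t (R (u (c₂ - t)))) t := by
    intro t ht
    have hs : c₂ - t ∈ Ioo 0 ℓ₂ := ⟨by linarith [ht.2], by linarith [ht.1]⟩
    refine ⟨by simpa using hu_neg _ hs, ?_⟩
    obtain ⟨h1, h2⟩ := M.arc_rev.sol _ (Ioo_subset_Icc_self hs)
    have h3 := (h2.hasDerivAt (Icc_mem_nhds hs.1 hs.2)).comp_const_sub c₂ t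
    rw [← hrev t _ h1]
    rw [← R_neg]
    exact hasDerivAt_R h3
  have hq : R (u ℓ₂) = z ℓ₁ := by rw [← M.meet, R_of_snd_eq_zero M.meet_snd]
  obtain ⟨w, hw, wA, wB, wC⟩ := exists_periodicSolution_of_arcs (D := D) (T := 2 * S)
    (A := fun t => z (t - t₀)) (B := fun t => R (u (c₂ - t))) (C := C) (c₁ := t₀ + ℓ₁) (c₂ := c₂)
    (t₀ := t₀) (by linarith) hper (fun t z hz => hm.periodic_perturb hε t hz) (by linarith)
    (by linarith) (by linarith) (hzc.comp (by fun_prop) mA)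
    ((contDiff_R (n := 0)).continuous.comp_continuousOn (huc.comp (by fun_prop) mB)) hC
    (fun t ht => (M.arc.sol _ (mA t ht)).1) (fun t ht => hRD _ (M.arc_rev.sol _ (mB t ht)).1) hCD
    (by simp only [hcc, add_sub_cancel_left, hq])
    (by simp only [sub_self, M.start_rev, hC₁]; simp [R])
    (by simp only [sub_self, M.start, hC₂])
    (Or.inr (Or.inl arcA)) (Or.inl arcB) arcC
  have hwc : w (t₀ + ℓ₁) = z ℓ₁ := by
    rw [wA _ ⟨by linarith, le_rfl⟩, add_sub_cancel_left]
  refine ⟨w, t₀ + ℓ₁, ⟨by linarith, by linarith⟩, hw, ?_, fun t ht => ?_, ⟨?_, ?_⟩, fun t ht => ?_,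
    wC⟩
  · rw [wA _ ⟨le_rfl, by linarith⟩, sub_self, M.start]
  · rw [wA t (Ioo_subset_Icc_self ht)]
    exact (arcA t ht).1
  · exact congrArg Prod.snd hwc |>.trans M.meet_snd
  -- Reversal preserves the vertical component, so both exit conditions say that the fields point
  -- upwards at the landing point.
  · simp only [hwc]
    refine mul_pos ?_ M.arc.exit
    have h1 := M.arc_rev.exit
    have h2 := hrev (t₀ + ℓ₁) (u ℓ₂) (M.arc_rev.sol _ ⟨hℓ₂.le, le_rfl⟩).1
    rw [show c₂ - (t₀ + ℓ₁) = ℓ₂ by linarith, hq] at h2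
    rw [← h2]
    simpa using h1
  · rw [wB t (Ioo_subset_Icc_self ht)]
    exact (arcB t ht).1

end VisibleLoop.Matching

/-! ### Vertical components on the switching line near the fold -/

/-- The blown up state of the point `(xv + ε ξ, 0)` at the time `t`, for `y = (ξ, t, κ, ε)`. -/
def onLine (xv : ℝ) (y : ℝ × ℝ × ℝ × ℝ) : BlowUp := ((xv, 0), (y.1, 0), y.2.1, 0, y.2.2.2)

theorem contDiff_onLine {n : WithTop ℕ∞} (xv : ℝ) : ContDiff ℝ n (onLine xv) := by
  unfold onLine
  fun_prop

theorem onLine_point (xv : ℝ) (y : ℝ × ℝ × ℝ × ℝ) :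
    (onLine xv y).point = (xv + y.2.2.2 * y.1, 0) := by
  simp [onLine, BlowUp.point]

/-- The vertical component of the perturbed field at `(xv + ε ξ, 0)`, divided by `ε`. -/
noncomputable def tilt (F : Plane → Plane) (G : ℝ → Plane → Plane) (H : ℝ → Plane → ℝ → Plane)
    (xv : ℝ) (y : ℝ × ℝ × ℝ × ℝ) : ℝ :=
  (BlowUp.field F G H 1 (onLine xv y)).2.1.2

/-- On the line, `F` and its reversal have the same vertical component, so `tilt` serves the upper
field too. -/
theorem perturb_reversed_snd (F : Plane → Plane) (G : ℝ → Plane → Plane)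
    (H : ℝ → Plane → ℝ → Plane) (ε t x : ℝ) :
    (perturb (reversed F) G H ε t (x, 0)).2 = (perturb F G H ε t (x, 0)).2 := by
  simp [perturb, reversed, R_of_snd_eq_zero]

namespace VisibleLoop

variable {D : Set Plane} {F : Plane → Plane} {G : ℝ → Plane → Plane}
  {H : ℝ → Plane → ℝ → Plane} {xv S ε₀ T : ℝ}

theorem contDiffAt_tilt (L : VisibleLoop D F xv S) (hε₀ : 0 < ε₀)
    (hP : PeriodicPerturbation D ε₀ T G H) (ξ t κ : ℝ) :
    ContDiffAt ℝ 1 (tilt F G H xv) (ξ, t, κ, 0) := by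
  have h1 : ContDiffAt ℝ 1 (BlowUp.field F G H 1) (onLine xv (ξ, t, κ, 0)) :=
    BlowUp.contDiffAt_field L.isOpen L.contDiffOn hε₀ hP L.mem _ _ _
  exact (h1.comp _ (contDiff_onLine xv).contDiffAt).snd.fst.snd

theorem tilt_zero (L : VisibleLoop D F xv S) (ξ t κ : ℝ) :
    tilt F G H xv (ξ, t, κ, 0) = dxF₂ F xv * ξ + (G t (xv, 0)).2 := by
  have h1 : ContDiffAt ℝ 1 F (xv, 0) :=
    (L.contDiffOn.contDiffAt (L.isOpen.mem_nhds L.mem)).of_le (by norm_num)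
  have h2 : ((ξ, 0) : Plane) = ξ • ((1, 0) : Plane) := by simp
  simp only [tilt, BlowUp.field, onLine, BlowUp.point_zero, hadamard_zero h1, zero_mul, zero_smul,
    add_zero, one_smul, Prod.snd_add, L.dxF₂_eq]
  rw [h2, map_smul, Prod.smul_snd, smul_eq_mul, mul_comm]

/-- As `F₂` vanishes at the fold, the whole vertical component is of order `ε`. The division is
already done in the blown up field, which makes `tilt` a `C¹` function at `ε = 0`. -/
theorem eventually_perturb_snd (L : VisibleLoop D F xv S) (ξ t κ : ℝ) :
    ∀ᶠ y : ℝ × ℝ × ℝ × ℝ in 𝓝 (ξ, t, κ, 0),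
      (perturb F G H y.2.2.2 y.2.1 (xv + y.2.2.2 * y.1, 0)).2 = y.2.2.2 * tilt F G H xv y := by
  have h1 : ContDiffAt ℝ 1 F (xv, 0) :=
    (L.contDiffOn.contDiffAt (L.isOpen.mem_nhds L.mem)).of_le (by norm_num)
  have hc : ContinuousAt (fun y : ℝ × ℝ × ℝ × ℝ => (((xv, 0) : Plane), y.2.2.2, ((y.1, 0) : Plane)))
    (ξ, t, κ, 0) := by fun_prop
  filter_upwards [hc.eventually (eventually_apply_add_smul h1 (ξ, 0))] with y hy
  have h2 := congrArg Prod.snd (BlowUp.field_point (F := F) (G := G) (H := H) (S := 1)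
    (y := onLine xv y) hy)
  simp only [Prod.snd_add, Prod.smul_snd, smul_eq_mul, BlowUp.value, onLine_point] at h2
  simp only [onLine, mul_zero, add_zero, one_mul] at h2
  rw [← h2]
  simp only [tilt, onLine, BlowUp.field, one_smul, L.tangent, zero_add]

end VisibleLoop

theorem hasDerivAt_of_deriv_ne_zero {f : ℝ → ℝ} {x : ℝ} (h : deriv f x ≠ 0) :
    HasDerivAt f (deriv f x) x :=
  (differentiableAt_of_deriv_ne_zero h).hasDerivAt

/-! ### Crossing periodic solutions -/

section Crossing

variable {D : Set Plane} {F : Plane → Plane} {Gp Gm : ℝ → Plane → Plane}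
  {Hp Hm : ℝ → Plane → ℝ → Plane} {xv ε₀ θ : ℝ} {σ : ℝ → ℝ}

/-- Both arcs leave from one point `xv + ε κ` at the same phase, so that `B' = 2 / a`. The gap
condition makes both fields point downwards there; at the landing point both point upwards. -/
theorem VisibleLoop.exists_crossing (L : VisibleLoop D F xv (σ xv)) (hRD : ∀ z ∈ D, R z ∈ D)
    (hε₀ : 0 < ε₀) (hp : PeriodicPerturbation D ε₀ (2 * σ xv) Gp Hp)
    (hm : PeriodicPerturbation D ε₀ (2 * σ xv) Gm Hm) (hM : melnikov D F Gp Gm σ θ xv = 0)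
    (hM' : deriv (fun s => melnikov D F Gp Gm σ s xv) θ ≠ 0)
    (hg : gNumber D F Gp Gm σ xv θ < threshold D F Gp Gm σ xv θ) :
    ∃ C > 0, ∃ ε₁ > 0, ∀ ε, 0 < ε → ε < ε₁ →
      ∃ (t₀ : ℝ) (w : ℝ → Plane),
        |t₀ - θ| ≤ C * ε ∧ ‖w t₀ - (xv, 0)‖ ≤ C * ε ∧
        IsCrossingPeriodicSolution (perturb (reversed F) Gp Hp ε) (perturb F Gm Hm ε) D
          (2 * σ xv) w := by
  have hq := L.exit
  have hab := L.visible
  have ha := L.field_ne_zero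
  rw [threshold] at hg
  set q := flow F D (σ xv) (xv, 0)
  set a := (F (xv, 0)).1
  set b := dxF₂ F xv
  set g := gNumber D F Gp Gm σ xv θ with hgdef
  set mx := max (Gp θ (xv, 0)).2 (Gm θ (xv, 0)).2
  -- The solution of the limit equation `F₂(q) (2 κ / a) + g = 0`.
  set κ₀ := -(a * g / (2 * (F q).2)) with hκ₀
  -- `b κ₀ + G₂^±` are the limits of the two tilts at the starting point; dividing by `a b < 0`
  -- turns negativity of the larger one into `g < τ`.
  have hneg : b * κ₀ + mx < 0 := by
    have hab' : a * b < 0 := by linarith [mul_comm a b]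
    have h1 : 2 * (F q).2 * mx < g * (a * b) := by
      rw [div_mul_eq_mul_div] at hg
      exact (lt_div_iff_of_neg hab').1 hg
    have h2 : b * κ₀ + mx = (2 * (F q).2 * mx - g * (a * b)) / (2 * (F q).2) := by
      rw [hκ₀]
      field_simp
      ring
    rw [h2]
    exact div_neg_of_neg_of_pos (by linarith) (by linarith)
  simp only [L.melnikov_eq hRD hp hm] at hM hM'
  rw [L.gNumber_eq hRD hp hm] at hgdef
  obtain ⟨ψ, hψ0, hψc, ⟨C, hC, hψC⟩, hψ⟩ := L.exists_matching hRD hε₀ hp hm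
    (θ := θ) (κ₀ := κ₀) (B' := 2 / a) (ξ₁ := fun e => e.2.2) (ξ₂ := fun e => e.2.2)
    (η := fun _ => 0) hM (hasDerivAt_of_deriv_ne_zero hM') hM' (.of_contDiffAt (by fun_prop))
    (.of_contDiffAt (by fun_prop)) (.of_contDiffAt (by fun_prop))
    (by
      rw [← hgdef]
      change (F q).2 * (-0 + (κ₀ + κ₀) / a) + g = 0
      rw [hκ₀]
      field_simp
      ring)
    (by
      have := (((hasDerivAt_id κ₀).add (hasDerivAt_id κ₀)).div_const a).const_add (-0)
      refine this.congr_deriv ?_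
      norm_num)
    (by positivity)
  have hy : Tendsto (fun ε => ((ψ ε).2, (ψ ε).1, (0 : ℝ), ε)) (𝓝 0) (𝓝 (κ₀, θ, 0, 0)) := by
    have h0 : ContinuousAt (fun ε => ((ψ ε).2, (ψ ε).1, (0 : ℝ), ε)) 0 := by fun_prop
    simpa [ContinuousAt, hψ0] using h0
  have hsgn : ∀ {G H}, PeriodicPerturbation D ε₀ (2 * σ xv) G H → (G θ (xv, 0)).2 ≤ mx →
      ∀ᶠ ε in 𝓝[>] 0, (perturb F G H ε (ψ ε).1 (xv + ε * (ψ ε).2, 0)).2 < 0 := by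
    intro G H hP hle
    have h1 : tilt F G H xv (κ₀, θ, 0, 0) < 0 := by
      rw [L.tilt_zero]
      linarith
    have h2 := (L.contDiffAt_tilt hε₀ hP κ₀ θ 0).continuousAt.eventually (gt_mem_nhds h1)
    filter_upwards [(hy.eventually h2).filter_mono nhdsWithin_le_nhds,
      (hy.eventually (L.eventually_perturb_snd (G := G) (H := H) κ₀ θ 0)).filter_mono
        nhdsWithin_le_nhds, self_mem_nhdsWithin] with ε e1 e2 e3
    rw [e2]
    exact mul_neg_of_pos_of_neg e3 e1
  have hbd : ∀ᶠ ε in 𝓝 0, |(ψ ε).2| < |κ₀| + 1 := by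
    have : ContinuousAt (fun ε => |(ψ ε).2|) 0 := hψc.snd.abs
    refine this.eventually (gt_mem_nhds ?_)
    simp [hψ0]
  obtain ⟨ε₁, hε₁, hall⟩ := mem_nhdsGT_iff_exists_Ioo_subset.1 ((hsgn hp (le_max_left _ _)).and
    ((hsgn hm (le_max_right _ _)).and ((hψC.and (hψ.and (hbd.and (Ioo_mem_nhds (neg_lt_zero.2 hε₀)
      hε₀)))).filter_mono nhdsWithin_le_nhds)))
  refine ⟨C + (|κ₀| + 1), by positivity, ε₁, hε₁, fun ε hε hεε₁ => ?_⟩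
  obtain ⟨s1, s2, e1, ⟨ℓ₁, ℓ₂, z, u, M⟩, e2, e3⟩ := hall ⟨hε, hεε₁⟩
  rw [abs_of_pos hε] at e1
  have hc₂ : (ψ ε).1 - ε * 0 + 2 * σ xv = (ψ ε).1 + 2 * σ xv := by ring
  -- With `η = 0` the closing arc lives on an empty open interval, so any constant curve at the
  -- starting point will do.
  obtain ⟨w, c, hc, hw, hw0, w1, w2, w3, -⟩ := M.exists_periodicSolution hRD hp hm e3 (by simp)
    s2.le (by rw [perturb_reversed_snd, mul_zero, sub_zero]; exact s1.le)
    (C := fun _ => (xv + ε * (ψ ε).2, 0)) continuousOn_const (fun t _ => by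
      have := (M.arc.sol 0 ⟨le_rfl, M.arc.pos.le⟩).1
      rwa [M.start] at this) rfl rfl (Or.inl fun t ht => by
      rw [hc₂] at ht
      exact absurd (ht.1.trans ht.2) (lt_irrefl _))
  refine ⟨(ψ ε).1, w, e1.trans ?_, ?_, hw, ⟨(ψ ε).1, by rw [hw0]⟩, fun t ht => ?_⟩
  · gcongr
    linarith [abs_nonneg κ₀]
  · rw [hw0]
    have : ((xv + ε * (ψ ε).2, 0) : Plane) - (xv, 0) = (ε * (ψ ε).2, 0) := by simp
    rw [this, Prod.norm_def]
    simp only [norm_zero, Real.norm_eq_abs, abs_mul, abs_of_pos hε]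
    rw [max_eq_left (by positivity), mul_comm]
    gcongr
    linarith
  · obtain ⟨s, hs, h1, h2, h3⟩ := hw.exists_mem_Ico (by linarith [L.pos])
      (fun t z hz => hp.periodic_perturb e3 t hz) (fun t z hz => hm.periodic_perturb e3 t hz)
      t (ψ ε).1
    have key : (s, w s) ∈ crossingRegion (perturb (reversed F) Gp Hp ε) (perturb F Gm Hm ε) := by
      rw [h1] at ht
      rcases eq_or_lt_of_le hs.1 with e | e
      · refine ⟨ht, ?_⟩
        rw [← e, hw0]
        exact mul_pos_of_neg_of_neg (by rw [perturb_reversed_snd]; exact s1) s2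
      rcases lt_trichotomy s c with e' | e' | e'
      · exact absurd ht (w1 s ⟨e, e'⟩).ne
      · rw [e']
        exact w2
      · exact absurd ht (w3 s ⟨e', by rw [hc₂]; exact hs.2⟩).ne'
    refine ⟨ht, ?_⟩
    simp only
    rw [h2, h3]
    exact key.2

end Crossing

end TwoFold

/-! ### The blown up sliding motion -/

namespace TwoFold

/-- The blown up speed of the sliding motion at `(xv + ε ξ, 0)`, for `y = (ξ, t, κ, ε)`. -/
noncomputable def slideSpeed (F : Plane → Plane) (Gp Gm : ℝ → Plane → Plane)
    (Hp Hm : ℝ → Plane → ℝ → Plane) (xv : ℝ) (y : ℝ × ℝ × ℝ × ℝ) : ℝ :=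
  (tilt F Gm Hm xv y * (BlowUp.value (reversed F) Gp Hp (onLine xv y)).1 -
    tilt F Gp Hp xv y * (BlowUp.value F Gm Hm (onLine xv y)).1) /
    (tilt F Gm Hm xv y - tilt F Gp Hp xv y)

/-- The sliding motion backwards in time, for a slow time `κ`. -/
noncomputable def slideField (F : Plane → Plane) (Gp Gm : ℝ → Plane → Plane)
    (Hp Hm : ℝ → Plane → ℝ → Plane) (xv : ℝ) (y : ℝ × ℝ × ℝ × ℝ) : ℝ × ℝ × ℝ × ℝ :=
  (-(y.2.2.1 * slideSpeed F Gp Gm Hp Hm xv y), -(y.2.2.1 * y.2.2.2), 0, 0)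

/-- The solution of the limit of the sliding motion that starts at the fold. -/
noncomputable def slideSol (a b gp gm κ τ : ℝ) : ℝ :=
  -gm / b + (gm - gp) / (2 * b) * (1 - Real.exp (2 * a * b * κ * τ / (gm - gp)))

theorem slideSol_zero (a b gp gm κ : ℝ) : slideSol a b gp gm κ 0 = -gm / b := by
  simp [slideSol]

theorem hasDerivAt_slideSol {a b gp gm : ℝ} (hb : b ≠ 0) (hm : gm - gp ≠ 0) (κ τ : ℝ) :
    HasDerivAt (slideSol a b gp gm κ)
      (-(a * κ * Real.exp (2 * a * b * κ * τ / (gm - gp)))) τ := by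
  have h1 : HasDerivAt (fun τ => 2 * a * b * κ * τ / (gm - gp)) (2 * a * b * κ / (gm - gp)) τ := by
    simpa using ((hasDerivAt_id τ).const_mul (2 * a * b * κ)).div_const (gm - gp)
  have h2 := ((h1.exp.const_sub 1).const_mul ((gm - gp) / (2 * b))).const_add (-gm / b)
  refine h2.congr_deriv ?_
  field_simp

theorem hasDerivAt_slideSol_one {a b gp gm : ℝ} (hb : b ≠ 0) (hm : gm - gp ≠ 0) (κ : ℝ) :
    HasDerivAt (fun κ => slideSol a b gp gm κ 1)
      (-(a * Real.exp (2 * a * b * κ / (gm - gp)))) κ := by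
  refine ((hasDerivAt_slideSol (a := a) hb hm 1 κ).congr_of_eventuallyEq
    (Eventually.of_forall fun κ => ?_)).congr_deriv ?_ <;> simp [slideSol]

/-- This is the limit tilt of the lower field along the slide. For `a b < 0`, `κ > 0` and `gp < gm`
it grows from `0` at the fold as `τ` increases. -/
theorem mul_slideSol {a b gp gm : ℝ} (hb : b ≠ 0) (κ τ : ℝ) :
    b * slideSol a b gp gm κ τ + gm =
      (gm - gp) / 2 * (1 - Real.exp (2 * a * b * κ * τ / (gm - gp))) := by
  rw [slideSol]
  field_simp
  ring

namespace VisibleLoop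

variable {D : Set Plane} {F : Plane → Plane} {Gp Gm : ℝ → Plane → Plane}
  {Hp Hm : ℝ → Plane → ℝ → Plane} {xv S ε₀ T : ℝ}

theorem dxF₂_ne_zero (L : VisibleLoop D F xv S) : dxF₂ F xv ≠ 0 := fun h => by
  have := L.visible
  simp [h] at this

theorem contDiffOn_reversed (L : VisibleLoop D F xv S) (hRD : ∀ z ∈ D, R z ∈ D) :
    ContDiffOn ℝ 2 (reversed F) D :=
  (contDiff_R.comp_contDiffOn (L.contDiffOn.comp contDiff_R.contDiffOn hRD)).neg

theorem contDiffAt_slideField (L : VisibleLoop D F xv S) (hRD : ∀ z ∈ D, R z ∈ D) (hε₀ : 0 < ε₀)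
    (hp : PeriodicPerturbation D ε₀ T Gp Hp) (hm : PeriodicPerturbation D ε₀ T Gm Hm)
    (ξ t κ : ℝ) (h : (Gp t (xv, 0)).2 < (Gm t (xv, 0)).2) :
    ContDiffAt ℝ 1 (slideField F Gp Gm Hp Hm xv) (ξ, t, κ, 0) := by
  have h1 := L.contDiffAt_tilt hε₀ hp ξ t κ
  have h2 := L.contDiffAt_tilt hε₀ hm ξ t κ
  have h3 : ContDiffAt ℝ 1 (fun y => (BlowUp.value F Gm Hm (onLine xv y)).1) (ξ, t, κ, 0) :=
    ((BlowUp.contDiffAt_value L.isOpen L.contDiffOn hε₀ hm L.mem _ _ _).comp (ξ, t, κ, (0 : ℝ))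
      (contDiff_onLine xv).contDiffAt).fst
  have h4 : ContDiffAt ℝ 1 (fun y => (BlowUp.value (reversed F) Gp Hp (onLine xv y)).1)
      (ξ, t, κ, 0) :=
    ((BlowUp.contDiffAt_value L.isOpen (L.contDiffOn_reversed hRD) hε₀ hp L.mem _ _ _).comp
      (ξ, t, κ, (0 : ℝ)) (contDiff_onLine xv).contDiffAt).fst
  have h5 : ContDiffAt ℝ 1 (slideSpeed F Gp Gm Hp Hm xv) (ξ, t, κ, 0) := by
    refine ((h2.mul h4).sub (h1.mul h3)).div (h2.sub h1) ?_
    rw [L.tilt_zero, L.tilt_zero]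
    linarith
  have h6 : ContDiffAt ℝ 1 (fun y : ℝ × ℝ × ℝ × ℝ => y.2.2.1) (ξ, t, κ, (0 : ℝ)) := by fun_prop
  exact (h6.mul h5).neg.prodMk (by fun_prop)

/-- On the line the horizontal components are `-a` above and `a` below, so at `ε = 0` the slow
equation is `ξ' = κ a (2 b ξ + gp + gm) / (gm - gp)`, linear in `ξ`. -/
theorem hasDerivAt_limit_slide (L : VisibleLoop D F xv S) (κ τ θ : ℝ)
    (h : (Gp θ (xv, 0)).2 < (Gm θ (xv, 0)).2) :
    HasDerivAt (fun τ => (slideSol (F (xv, 0)).1 (dxF₂ F xv) (Gp θ (xv, 0)).2 (Gm θ (xv, 0)).2 κ τ,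
      θ, κ, (0 : ℝ)))
      (slideField F Gp Gm Hp Hm xv (slideSol (F (xv, 0)).1 (dxF₂ F xv) (Gp θ (xv, 0)).2
        (Gm θ (xv, 0)).2 κ τ, θ, κ, 0)) τ := by
  have hb := L.dxF₂_ne_zero
  have hm : (Gm θ (xv, 0)).2 - (Gp θ (xv, 0)).2 ≠ 0 := (sub_pos.2 h).ne'
  refine ((hasDerivAt_slideSol hb hm κ τ).prodMk (hasDerivAt_const τ (θ, κ, (0 : ℝ)))).congr_deriv ?_
  have h1 := mul_slideSol (a := (F (xv, 0)).1) (gp := (Gp θ (xv, 0)).2) (gm := (Gm θ (xv, 0)).2)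
    hb κ τ
  simp only [slideField, slideSpeed, L.tilt_zero, onLine, BlowUp.value_zero, mul_zero, neg_zero,
    reversed, R_of_snd_eq_zero, Prod.fst_neg, R_fst]
  refine Prod.ext ?_ rfl
  simp only
  generalize slideSol (F (xv, 0)).1 (dxF₂ F xv) (Gp θ (xv, 0)).2 (Gm θ (xv, 0)).2 κ τ = s at h1 ⊢
  generalize Real.exp _ = E at h1 ⊢
  have h2 : dxF₂ F xv * s + (Gm θ (xv, 0)).2 - (dxF₂ F xv * s + (Gp θ (xv, 0)).2) =
    (Gm θ (xv, 0)).2 - (Gp θ (xv, 0)).2 := by ring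
  rw [h2]
  field_simp
  linear_combination (-2 * (F (xv, 0)).1 * κ) * h1

/-- The fold of the perturbed lower field. -/
theorem exists_fold (L : VisibleLoop D F xv S) (hε₀ : 0 < ε₀)
    (hm : PeriodicPerturbation D ε₀ T Gm Hm) (θ : ℝ) :
    ∃ φ : ℝ × ℝ → ℝ, φ (0, θ) = -(Gm θ (xv, 0)).2 / dxF₂ F xv ∧ StrictDiffAt φ (0, θ) ∧
      ∀ᶠ e in 𝓝 (0, θ), ∀ κ, tilt F Gm Hm xv (φ e, e.2, κ, e.1) = 0 := by
  have hb := L.dxF₂_ne_zero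
  set b := dxF₂ F xv
  set g := (Gm θ (xv, 0)).2
  let Φ : (ℝ × ℝ) × ℝ → ℝ := fun p => tilt F Gm Hm xv (p.2, p.1.2, 0, p.1.1)
  obtain ⟨Φ', hΦ⟩ : StrictDiffAt Φ ((0, θ), -g / b) :=
    StrictDiffAt.comp (g := tilt F Gm Hm xv)
      (f := fun p : (ℝ × ℝ) × ℝ => (p.2, p.1.2, (0 : ℝ), p.1.1)) ((0, θ), -g / b)
      (.of_contDiffAt (L.contDiffAt_tilt hε₀ hm _ _ _)) (.of_contDiffAt (by fun_prop))
  have hinj : ∀ v, Φ' (0, v) = b * v := by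
    intro v
    have h1 : HasDerivAt (fun s : ℝ => (((0 : ℝ), θ), -g / b + s * v)) (0, v) 0 := by
      have := ((hasDerivAt_id (0 : ℝ)).mul_const v).const_add (-g / b)
      simpa using (hasDerivAt_const (0 : ℝ) ((0 : ℝ), θ)).prodMk this
    have h2 : HasFDerivAt Φ Φ' ((0, θ), -g / b + 0 * v) := by simpa using hΦ.hasFDerivAt
    have h3 := h2.comp_hasDerivAt 0 h1
    have h4 : HasDerivAt (fun s : ℝ => b * (-g / b + s * v) + g) (b * v) 0 := by
      simpa using ((((hasDerivAt_id (0 : ℝ)).mul_const v).const_add (-g / b)).const_mul b).add_const g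
    refine h3.unique (h4.congr_of_eventuallyEq (Eventually.of_forall fun s => ?_))
    exact L.tilt_zero _ _ _
  obtain ⟨φ, h1, h2, h3⟩ := exists_implicit hΦ (by
    have : Φ ((0, θ), -g / b) = b * (-g / b) + g := L.tilt_zero _ _ _
    rw [this, mul_div_cancel₀ _ hb, neg_add_cancel]) (fun v hv => by
      rw [hinj] at hv
      exact (mul_eq_zero.1 hv).resolve_left hb)
  exact ⟨φ, h1, h2, h3.mono fun e he κ => he⟩

/-- Blown up sliding motions starting near the fold. -/
theorem exists_slide_family (L : VisibleLoop D F xv S) (hRD : ∀ z ∈ D, R z ∈ D) (hε₀ : 0 < ε₀)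
    (hp : PeriodicPerturbation D ε₀ T Gp Hp) (hm : PeriodicPerturbation D ε₀ T Gm Hm)
    {θ κ₀ : ℝ} (h : (Gp θ (xv, 0)).2 < (Gm θ (xv, 0)).2) (hκ₀ : 0 < κ₀) :
    ∃ U : ℝ × ℝ × ℝ × ℝ → C(unitInterval, ℝ × ℝ × ℝ × ℝ),
      StrictDiffAt U (-(Gm θ (xv, 0)).2 / dxF₂ F xv, θ, κ₀, 0) ∧
      (∀ᶠ κ in 𝓝 κ₀, (ext (U (-(Gm θ (xv, 0)).2 / dxF₂ F xv, θ, κ, 0)) 1).1 =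
        slideSol (F (xv, 0)).1 (dxF₂ F xv) (Gp θ (xv, 0)).2 (Gm θ (xv, 0)).2 κ 1) ∧
      ∀ᶠ y in 𝓝 (-(Gm θ (xv, 0)).2 / dxF₂ F xv, θ, κ₀, 0), ext (U y) 0 = y ∧
        ∀ τ ∈ Icc (0 : ℝ) 1,
          HasDerivWithinAt (ext (U y)) (slideField F Gp Gm Hp Hm xv (ext (U y) τ)) (Icc 0 1) τ ∧
          (ext (U y) τ).2 = (y.2.1 - y.2.2.1 * y.2.2.2 * τ, y.2.2) ∧
          DifferentiableAt ℝ (tilt F Gm Hm xv) (ext (U y) τ) ∧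
          0 < fderiv ℝ (tilt F Gm Hm xv) (ext (U y) τ)
            (slideField F Gp Gm Hp Hm xv (ext (U y) τ)) ∧
          tilt F Gp Hp xv (ext (U y) τ) < 0 ∧
          ((xv + y.2.2.2 * (ext (U y) τ).1, 0) : Plane) ∈ D ∧
          (perturb F Gm Hm y.2.2.2 (ext (U y) τ).2.1 (xv + y.2.2.2 * (ext (U y) τ).1, 0)).2 =
            y.2.2.2 * tilt F Gm Hm xv (ext (U y) τ) ∧
          (perturb F Gp Hp y.2.2.2 (ext (U y) τ).2.1 (xv + y.2.2.2 * (ext (U y) τ).1, 0)).2 =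
            y.2.2.2 * tilt F Gp Hp xv (ext (U y) τ) := by
  have hb := L.dxF₂_ne_zero
  have hab := L.visible
  have hsol : ∀ κ τ, HasDerivAt _ _ τ := fun κ τ =>
    L.hasDerivAt_limit_slide (Hp := Hp) (Hm := Hm) κ τ θ h
  have htilt : ∀ κ τ, tilt F Gm Hm xv (slideSol (F (xv, 0)).1 (dxF₂ F xv) (Gp θ (xv, 0)).2
      (Gm θ (xv, 0)).2 κ τ, θ, κ, 0) = _ := fun κ τ =>
    (L.tilt_zero _ _ _).trans (mul_slideSol hb κ τ)
  have hcd : ∀ ξ κ, ContDiffAt ℝ 1 (slideField F Gp Gm Hp Hm xv) (ξ, θ, κ, 0) := fun ξ κ =>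
    L.contDiffAt_slideField hRD hε₀ hp hm ξ θ κ h
  have hpos : 0 < (Gm θ (xv, 0)).2 - (Gp θ (xv, 0)).2 := sub_pos.2 h
  set a := (F (xv, 0)).1
  set b := dxF₂ F xv
  set gp := (Gp θ (xv, 0)).2 with hgp
  set gm := (Gm θ (xv, 0)).2
  set V := slideField F Gp Gm Hp Hm xv with hV
  obtain ⟨U, U', hU, hU0, -, -, hUe⟩ := exists_solution_family (V := V)
    (w := fun τ => (slideSol a b gp gm κ₀ τ, θ, κ₀, (0 : ℝ)))
    (fun τ _ => (hsol κ₀ τ).hasDerivWithinAt) (fun τ _ => hcd _ _)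
  simp only [slideSol_zero] at hU hU0 hUe
  have hUs : ∀ {Q : ℝ × ℝ × ℝ × ℝ → Prop},
      (∀ τ ∈ Icc (0 : ℝ) 1, ∀ᶠ x in 𝓝 (slideSol a b gp gm κ₀ τ, θ, κ₀, (0 : ℝ)), Q x) →
      ∀ᶠ y in 𝓝 (-gm / b, θ, κ₀, (0 : ℝ)), ∀ τ ∈ Icc (0 : ℝ) 1, Q (ext (U y) τ) := by
    intro Q hQ
    refine eventually_forall_ext hU.continuousAt fun τ hτ => ?_
    rw [hU0 τ hτ]
    exact hQ τ hτ
  have E1 := hUs (Q := fun x => ContDiffAt ℝ 1 V x) fun τ hτ => eventually_contDiffAt_one (hcd _ _)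
  have hmd : ∀ ξ, ContDiffAt ℝ 1 (tilt F Gm Hm xv) (ξ, θ, κ₀, 0) := fun ξ =>
    L.contDiffAt_tilt hε₀ hm ξ θ κ₀
  have E2 := hUs (Q := fun x => DifferentiableAt ℝ (tilt F Gm Hm xv) x) fun τ hτ =>
    (eventually_contDiffAt_one (hmd _)).mono fun x hx => hx.differentiableAt (by simp)
  -- A strict sign of the derivative persists for small `ε`, whereas the tilt itself vanishes at the
  -- fold; its positivity is recovered later by monotonicity.
  have E3 := hUs (Q := fun x => 0 < fderiv ℝ (tilt F Gm Hm xv) x (V x)) fun τ hτ => by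
    have hc : ContinuousAt (fun x => fderiv ℝ (tilt F Gm Hm xv) x (V x))
        (slideSol a b gp gm κ₀ τ, θ, κ₀, 0) :=
      (continuousAt_fderiv_of_contDiffAt (hmd _)).clm_apply (hcd _ _).continuousAt
    refine hc.eventually (lt_mem_nhds ?_)
    have d1 := ((hmd (slideSol a b gp gm κ₀ τ)).differentiableAt
      (by simp)).hasFDerivAt.comp_hasDerivAt τ (hsol κ₀ τ)
    have h1 : HasDerivAt (fun τ => 2 * a * b * κ₀ * τ / (gm - gp)) (2 * a * b * κ₀ / (gm - gp)) τ := by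
      simpa using ((hasDerivAt_id τ).const_mul (2 * a * b * κ₀)).div_const (gm - gp)
    have d2 := ((h1.exp.const_sub 1).const_mul ((gm - gp) / 2)).congr_of_eventuallyEq
      (Eventually.of_forall (htilt κ₀))
    beta_reduce
    rw [d1.unique d2]
    have : (gm - gp) / 2 * -(Real.exp (2 * a * b * κ₀ * τ / (gm - gp)) *
        (2 * a * b * κ₀ / (gm - gp))) =
        -(b * a) * κ₀ * Real.exp (2 * a * b * κ₀ * τ / (gm - gp)) := by
      field_simp
    rw [this]
    have : 0 < -(b * a) := by linarith
    positivity
  have E4 := hUs (Q := fun x => tilt F Gp Hp xv x < 0) fun τ hτ => by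
    refine (L.contDiffAt_tilt hε₀ hp _ θ κ₀).continuousAt.eventually (gt_mem_nhds ?_)
    have h1 : tilt F Gp Hp xv (slideSol a b gp gm κ₀ τ, θ, κ₀, 0) = _ := L.tilt_zero _ _ _
    have h2 := mul_slideSol (a := a) (gp := gp) (gm := gm) hb κ₀ τ
    rw [h1, ← hgp]
    have h3 := mul_pos hpos (Real.exp_pos (2 * a * b * κ₀ * τ / (gm - gp)))
    linarith
  have E5 := hUs (Q := fun x => ((xv + x.2.2.2 * x.1, 0) : Plane) ∈ D) fun τ hτ => by
    have hc : ContinuousAt (fun x : ℝ × ℝ × ℝ × ℝ => ((xv + x.2.2.2 * x.1, 0) : Plane))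
      (slideSol a b gp gm κ₀ τ, θ, κ₀, 0) := by fun_prop
    refine hc.eventually (L.isOpen.mem_nhds ?_)
    simpa using L.mem
  have E6 := hUs fun τ _ => L.eventually_perturb_snd (G := Gm) (H := Hm)
    (slideSol a b gp gm κ₀ τ) θ κ₀
  have E7 := hUs fun τ _ => L.eventually_perturb_snd (G := Gp) (H := Hp)
    (slideSol a b gp gm κ₀ τ) θ κ₀
  refine ⟨U, ⟨U', hU⟩, ?_, ?_⟩
  · have hc : Tendsto (fun κ : ℝ => (-gm / b, θ, κ, (0 : ℝ))) (𝓝 κ₀) (𝓝 (-gm / b, θ, κ₀, 0)) := by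
      have : Continuous fun κ : ℝ => (-gm / b, θ, κ, (0 : ℝ)) := by fun_prop
      exact this.tendsto κ₀
    filter_upwards [hc.eventually hUe, hc.eventually E1] with κ hκ hκ1
    have := eq_of_contDiffAt (w₂ := fun τ => (slideSol a b gp gm κ τ, θ, κ, (0 : ℝ)))
      hκ1 (fun τ _ => hcd _ _) hκ.2 (fun τ _ => (hsol κ τ).hasDerivWithinAt)
      (by rw [hκ.1, slideSol_zero]) ⟨zero_le_one, le_rfl⟩
    rw [this]
  · filter_upwards [hUe, E2, E3, E4, E5, E6, E7] with y hy e2 e3 e4 e5 e6 e7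
    refine ⟨hy.1, fun τ hτ => ?_⟩
    set u := ext (U y) with hu
    have hd : ∀ t ∈ Icc (0 : ℝ) 1, HasDerivWithinAt u (V (u t)) (Icc 0 1) t := hy.2
    have c2 : ∀ t ∈ Icc (0 : ℝ) 1, (u t).2.2 = y.2.2 := by
      refine eq_of_linear (B := fun _ => 0) (g := fun _ => 0) (w₂ := fun _ => y.2.2)
        continuousOn_const (fun t ht => ?_) (fun t _ => ?_) (by rw [hy.1])
      · have := (ContinuousLinearMap.hasFDerivAt ((.snd ℝ ℝ (ℝ × ℝ)) ∘L
          .snd ℝ ℝ (ℝ × ℝ × ℝ))).comp_hasDerivWithinAt t (hd t ht)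
        refine this.congr_deriv ?_
        simp [hV, slideField]
      · simpa using hasDerivWithinAt_const t _ y.2.2
    have c1 := eq_add_mul_of_hasDerivWithinAt (f := fun t => (u t).2.1)
      (c := -(y.2.2.1 * y.2.2.2)) (fun t ht => by
        have := (ContinuousLinearMap.hasFDerivAt ((.fst ℝ ℝ (ℝ × ℝ)) ∘L
          .snd ℝ ℝ (ℝ × ℝ × ℝ))).comp_hasDerivWithinAt t (hd t ht)
        refine this.congr_deriv ?_
        simp [hV, slideField, c2 t ht]) τ hτ
    have c3 : (u τ).2.2.2 = y.2.2.2 := by rw [c2 τ hτ]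
    have h5 := e5 τ hτ
    have h6 := e6 τ hτ
    have h7 := e7 τ hτ
    rw [c3] at h5 h6 h7
    refine ⟨hd τ hτ, Prod.ext ?_ (c2 τ hτ), e2 τ hτ, e3 τ hτ, e4 τ hτ, h5, h6, h7⟩
    simp only at c1 ⊢
    rw [c1, hy.1]
    ring

/-- The sliding field is homogeneous of degree zero in the two vertical components, so their common
factor `ε` cancels. The speed is of order one, and distances of order `ε` take times of order `ε`.
-/
theorem slidingField_eq {y : ℝ × ℝ × ℝ × ℝ} {ε : ℝ} (hy : y.2.2.2 = ε) (hε : ε ≠ 0)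
    (hne : tilt F Gm Hm xv y - tilt F Gp Hp xv y ≠ 0)
    (h₁ : (perturb F Gm Hm ε y.2.1 (xv + ε * y.1, 0)).2 = ε * tilt F Gm Hm xv y)
    (h₂ : (perturb F Gp Hp ε y.2.1 (xv + ε * y.1, 0)).2 = ε * tilt F Gp Hp xv y) :
    slidingField (perturb (reversed F) Gp Hp ε) (perturb F Gm Hm ε) y.2.1 (xv + ε * y.1, 0) =
      (slideSpeed F Gp Gm Hp Hm xv y, 0) := by
  rw [slidingField, perturb_reversed_snd, h₁, h₂]
  refine Prod.ext ?_ ?_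
  · simp only [slideSpeed, BlowUp.value, onLine_point, Prod.smul_fst, Prod.fst_sub, smul_eq_mul, hy]
    simp only [onLine, hy, ← mul_sub]
    field_simp
  · simp only [Prod.smul_snd, Prod.snd_sub, smul_eq_mul, perturb_reversed_snd, h₁, h₂]
    ring

end VisibleLoop

end TwoFold

namespace TwoFold

/-- During `[t₁, t₂]` the curve `C` slides on the sliding region from `x₁` to the fold `x₂` of
the lower field. -/
structure IsSlideToFold (D : Set Plane) (Xp Xm : ℝ → Plane → Plane) (t₁ t₂ x₁ x₂ : ℝ)
    (C : ℝ → Plane) : Prop where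
  continuousOn : ContinuousOn C (Icc t₁ t₂)
  mem : ∀ s ∈ Icc t₁ t₂, C s ∈ D
  start : C t₁ = (x₁, 0)
  finish : C t₂ = (x₂, 0)
  region : ∀ s ∈ Ico t₁ t₂, (s, C s) ∈ slidingRegion Xp Xm
  slides : SlidesDuring Xp Xm C t₁ t₂
  fold : (Xm t₂ (x₂, 0)).2 = 0

namespace VisibleLoop

variable {D : Set Plane} {F : Plane → Plane} {Gp Gm : ℝ → Plane → Plane}
  {Hp Hm : ℝ → Plane → ℝ → Plane} {xv S ε₀ T : ℝ}

/-- Sliding is integrated backwards from the fold, so that it ends at the fold by construction. The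
landing position and the departure position become strictly differentiable functions of `ε`, the
phase and the slow duration `κ`. -/
theorem exists_slideToFold (L : VisibleLoop D F xv S) (hRD : ∀ z ∈ D, R z ∈ D) (hε₀ : 0 < ε₀)
    (hp : PeriodicPerturbation D ε₀ T Gp Hp) (hm : PeriodicPerturbation D ε₀ T Gm Hm)
    {θ κ₀ : ℝ} (h : (Gp θ (xv, 0)).2 < (Gm θ (xv, 0)).2) (hκ₀ : 0 < κ₀) :
    ∃ ξ₁ ξ₂ : ℝ × ℝ × ℝ → ℝ, StrictDiffAt ξ₁ (0, θ, κ₀) ∧ StrictDiffAt ξ₂ (0, θ, κ₀) ∧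
      (∀ κ, ξ₁ (0, θ, κ) = -(Gm θ (xv, 0)).2 / dxF₂ F xv) ∧
      (∀ᶠ κ in 𝓝 κ₀, ξ₂ (0, θ, κ) =
        slideSol (F (xv, 0)).1 (dxF₂ F xv) (Gp θ (xv, 0)).2 (Gm θ (xv, 0)).2 κ 1) ∧
      ∀ᶠ e in 𝓝 (0, θ, κ₀), 0 < e.1 → 0 < e.2.2 ∧
        ∃ C, IsSlideToFold D (perturb (reversed F) Gp Hp e.1) (perturb F Gm Hm e.1)
          (e.2.1 - e.1 * e.2.2) e.2.1 (xv + e.1 * ξ₂ e) (xv + e.1 * ξ₁ e) C := by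
  obtain ⟨φ, hφ0, hφ, hφe⟩ := L.exists_fold hε₀ hm θ
  obtain ⟨U, hU, hUsol, hUe⟩ := L.exists_slide_family hRD hε₀ hp hm h hκ₀
  rw [← hφ0] at hU hUsol hUe
  let ini : ℝ × ℝ × ℝ → ℝ × ℝ × ℝ × ℝ := fun e => (φ (e.1, e.2.1), e.2.1, e.2.2, e.1)
  have hproj : StrictDiffAt (fun e : ℝ × ℝ × ℝ => (e.1, e.2.1)) (0, θ, κ₀) :=
    .of_contDiffAt (by fun_prop)
  have hφ' : StrictDiffAt (fun e : ℝ × ℝ × ℝ => φ (e.1, e.2.1)) (0, θ, κ₀) :=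
    .comp (0, θ, κ₀) hφ hproj
  have hini : StrictDiffAt ini (0, θ, κ₀) := hφ'.prodMk (.of_contDiffAt (by fun_prop))
  have hini0 : ini (0, θ, κ₀) = (φ (0, θ), θ, κ₀, 0) := rfl
  refine ⟨fun e => φ (e.1, e.2.1), fun e => (ext (U (ini e)) 1).1, hφ', ?_, fun κ => hφ0, hUsol, ?_⟩
  · have h1 : StrictDiffAt (fun u : C(unitInterval, ℝ × ℝ × ℝ × ℝ) => (ext u 1).1)
        (U (ini (0, θ, κ₀))) := by
      have := (ContinuousLinearMap.fst ℝ ℝ (ℝ × ℝ × ℝ) ∘L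
        ContinuousMap.evalCLM ℝ (1 : unitInterval)).hasStrictFDerivAt (x := U (ini (0, θ, κ₀)))
      refine ⟨_, this.congr_of_eventuallyEq (Eventually.of_forall fun u => ?_)⟩
      simp only [ext_of_mem u (s := 1) ⟨zero_le_one, le_rfl⟩]
      rfl
    exact StrictDiffAt.comp (g := fun u : C(unitInterval, ℝ × ℝ × ℝ × ℝ) => (ext u 1).1)
      (0, θ, κ₀) h1 (.comp (0, θ, κ₀) hU hini)
  filter_upwards [hini.continuousAt.eventually hUe, hproj.continuousAt.eventually hφe,
    continuousAt_snd.snd.eventually (lt_mem_nhds hκ₀)] with e he hfold hκ hε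
  refine ⟨hκ, ?_⟩
  obtain ⟨hstart, hu⟩ := he
  set u := ext (U (ini e))
  set ε := e.1
  set t := e.2.1
  set κ := e.2.2
  have hεκ : 0 < ε * κ := mul_pos hε hκ
  have hu1 : ∀ τ ∈ Icc (0 : ℝ) 1, HasDerivWithinAt u (slideField F Gp Gm Hp Hm xv (u τ))
    (Icc 0 1) τ := fun τ hτ => (hu τ hτ).1
  have hu2 : ∀ τ ∈ Icc (0 : ℝ) 1, (u τ).2 = (t - κ * ε * τ, κ, ε) := fun τ hτ => (hu τ hτ).2.1
  have h0 : tilt F Gm Hm xv (u 0) = 0 := by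
    rw [hstart]
    exact hfold κ
  -- The lower tilt vanishes at the fold and increases backwards in time, so the slide stays in the
  -- sliding region until its last instant.
  have hmono : StrictMonoOn (fun τ => tilt F Gm Hm xv (u τ)) (Icc 0 1) := by
    have hd : ∀ τ ∈ Icc (0 : ℝ) 1, HasDerivWithinAt (fun τ => tilt F Gm Hm xv (u τ))
        (fderiv ℝ (tilt F Gm Hm xv) (u τ) (slideField F Gp Gm Hp Hm xv (u τ))) (Icc 0 1) τ :=
      fun τ hτ => (hu τ hτ).2.2.1.hasFDerivAt.comp_hasDerivWithinAt τ (hu1 τ hτ)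
    refine strictMonoOn_of_hasDerivWithinAt_pos (convex_Icc _ _)
      (fun τ hτ => (hd τ hτ).continuousWithinAt) (fun τ hτ => ?_) (fun τ hτ => ?_)
      (f' := fun τ => fderiv ℝ (tilt F Gm Hm xv) (u τ) (slideField F Gp Gm Hp Hm xv (u τ)))
    · exact (hd τ (interior_subset hτ)).mono interior_subset
    · exact (hu τ (interior_subset hτ)).2.2.2.1
  have hpos : ∀ τ ∈ Ioc (0 : ℝ) 1, 0 < tilt F Gm Hm xv (u τ) := fun τ hτ => by
    rw [← h0]
    exact hmono ⟨le_rfl, zero_le_one⟩ (Ioc_subset_Icc_self hτ) hτ.1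
  -- The slow time runs backwards: `0` at the fold, `1` at the landing.
  set c : ℝ → ℝ := fun s => (t - s) / (ε * κ) with hc
  have hcm : ∀ s ∈ Icc (t - ε * κ) t, c s ∈ Icc (0 : ℝ) 1 := fun s hs =>
    ⟨div_nonneg (by linarith [hs.2]) hεκ.le, (div_le_one hεκ).2 (by linarith [hs.1])⟩
  have hct : ∀ s, t - κ * ε * c s = s := fun s => by
    rw [hc, mul_comm κ ε, mul_div_cancel₀ _ hεκ.ne', sub_sub_cancel]
  have hu3 : ∀ s ∈ Icc (t - ε * κ) t, (u (c s)).2.1 = s ∧ (u (c s)).2.2.2 = ε := fun s hs => by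
    rw [hu2 _ (hcm s hs)]
    exact ⟨hct s, rfl⟩
  have hmP : ∀ s ∈ Icc (t - ε * κ) t, (perturb F Gm Hm ε s (xv + ε * (u (c s)).1, 0)).2 =
      ε * tilt F Gm Hm xv (u (c s)) := fun s hs => by
    have := (hu _ (hcm s hs)).2.2.2.2.2.2.1
    rwa [(hu3 s hs).1] at this
  have hpP : ∀ s ∈ Icc (t - ε * κ) t, (perturb F Gp Hp ε s (xv + ε * (u (c s)).1, 0)).2 =
      ε * tilt F Gp Hp xv (u (c s)) := fun s hs => by
    have := (hu _ (hcm s hs)).2.2.2.2.2.2.2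
    rwa [(hu3 s hs).1] at this
  have hctt : c t = 0 := by simp [hc]
  have hct0 : c (t - ε * κ) = 1 := by simp [hc, hεκ.ne']
  have hreg : ∀ s ∈ Ico (t - ε * κ) t, (s, ((xv + ε * (u (c s)).1, 0) : Plane)) ∈
      slidingRegion (perturb (reversed F) Gp Hp ε) (perturb F Gm Hm ε) := by
    intro s hs
    have hs' := Ico_subset_Icc_self hs
    refine ⟨rfl, ?_, ?_⟩
    · simp only
      rw [perturb_reversed_snd, hpP s hs']
      exact mul_neg_of_pos_of_neg hε (hu _ (hcm s hs')).2.2.2.2.1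
    · simp only
      rw [hmP s hs']
      exact mul_pos hε (hpos _ ⟨div_pos (by linarith [hs.2]) hεκ, (hcm s hs').2⟩)
  refine ⟨fun s => (xv + ε * (u (c s)).1, 0), ?_, fun s hs => (hu _ (hcm s hs)).2.2.2.2.2.1, ?_, ?_,
    hreg, fun s hs => ⟨Or.inl (hreg s (Ioo_subset_Ico_self hs)), ?_⟩, ?_⟩
  · have : Continuous u := continuous_ext _
    have hcc : Continuous c := by fun_prop
    fun_prop
  · simp only [hct0]
  · simp only [hctt, hstart]
    rfl
  · have hs' := Ioo_subset_Icc_self hs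
    have hτ : c s ∈ Ioo (0 : ℝ) 1 := ⟨div_pos (by linarith [hs.2]) hεκ,
      (div_lt_one hεκ).2 (by linarith [hs.1])⟩
    have h1 : HasDerivAt c (-(ε * κ)⁻¹) s := by
      have := ((hasDerivAt_id s).const_sub t).div_const (ε * κ)
      refine this.congr_deriv ?_
      rw [neg_div, one_div]
    have h2 := ((hu1 _ (hcm s hs')).hasDerivAt (Icc_mem_nhds hτ.1 hτ.2)).scomp s h1
    have h3 : HasDerivAt (fun s => (u (c s)).1) _ s :=
      (hasFDerivAt_fst (p := u (c s))).comp_hasDerivAt s h2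
    have h4 := slidingField_eq (F := F) (Gp := Gp) (Gm := Gm) (Hp := Hp) (Hm := Hm) (xv := xv)
      (y := u (c s)) (hu3 s hs').2 hε.ne'
      (sub_pos.2 ((hu _ (hcm s hs')).2.2.2.2.1.trans (hpos _ (Ioo_subset_Ioc_self hτ)))).ne'
      (by rw [(hu3 s hs').1]; exact hmP s hs') (by rw [(hu3 s hs').1]; exact hpP s hs')
    rw [(hu3 s hs').1] at h4
    rw [h4]
    refine HasDerivAt.prodMk (((h3.const_mul ε).const_add xv).congr_deriv ?_) (hasDerivAt_const _ _)
    have h5 : (u (c s)).2.2.1 = κ := by rw [hu2 _ (hcm s hs')]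
    simp only [slideField, h5, ContinuousLinearMap.coe_fst', Prod.smul_fst, smul_eq_mul]
    field_simp
  · have := hmP t ⟨by linarith, le_rfl⟩
    simp only [hctt] at this
    rw [h0, hstart, mul_zero] at this
    exact this

end VisibleLoop

/-! ### Sliding periodic solutions -/

section Sliding

variable {D : Set Plane} {F : Plane → Plane} {Gp Gm : ℝ → Plane → Plane}
  {Hp Hm : ℝ → Plane → ℝ → Plane} {xv ε₀ θ : ℝ} {σ : ℝ → ℝ}

/-- The slow time of the sliding motion of the limit problem. -/
theorem exists_slide_time {a b gp gm Δ : ℝ} (hab : b * a < 0) (h : gp < gm) (hΔ : 0 < Δ) :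
    ∃ κ > 0, b * slideSol a b gp gm κ 1 + gm - a * b * κ = Δ := by
  have hb : b ≠ 0 := fun e => by simp [e] at hab
  have hm : 0 < gm - gp := sub_pos.2 h
  have hab' : 0 < -(a * b) := by linarith [mul_comm a b]
  set f : ℝ → ℝ := fun κ => b * slideSol a b gp gm κ 1 + gm - a * b * κ with hf
  have hfe : ∀ κ, f κ = (gm - gp) / 2 * (1 - Real.exp (2 * a * b * κ * 1 / (gm - gp))) - a * b * κ :=
    fun κ => by rw [hf, ← mul_slideSol hb]
  have hfc : Continuous f := by
    have : f = _ := funext hfe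
    rw [this]
    fun_prop
  have h0 : f 0 = 0 := by simp [hfe]
  -- At `κ₁` the linear term alone equals `Δ`, and the exponential term adds something nonnegative.
  set κ₁ := Δ / -(a * b)
  have hκ₁ : 0 < κ₁ := div_pos hΔ hab'
  have h1 : Δ ≤ f κ₁ := by
    have e1 : Real.exp (2 * a * b * κ₁ * 1 / (gm - gp)) ≤ 1 := by
      refine Real.exp_le_one_iff.2 (div_nonpos_of_nonpos_of_nonneg ?_ hm.le)
      nlinarith
    have e2 : -(a * b) * κ₁ = Δ := mul_div_cancel₀ _ hab'.ne'
    rw [hfe]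
    nlinarith
  obtain ⟨κ, hκ, hκe⟩ := intermediate_value_Icc hκ₁.le hfc.continuousOn ⟨h0.trans_le hΔ.le, h1⟩
  refine ⟨κ, lt_of_le_of_ne hκ.1 fun e => ?_, hκe⟩
  rw [← e, h0] at hκe
  exact hΔ.ne hκe

/-- The free parameter is now the slow sliding time: `η = κ`, `ξ₁` is the position of the lower fold
and `ξ₂` that of the landing. -/
theorem VisibleLoop.exists_sliding (L : VisibleLoop D F xv (σ xv)) (hRD : ∀ z ∈ D, R z ∈ D)
    (hε₀ : 0 < ε₀) (hp : PeriodicPerturbation D ε₀ (2 * σ xv) Gp Hp)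
    (hm : PeriodicPerturbation D ε₀ (2 * σ xv) Gm Hm) (hM : melnikov D F Gp Gm σ θ xv = 0)
    (hM' : deriv (fun s => melnikov D F Gp Gm σ s xv) θ ≠ 0)
    (h : (Gp θ (xv, 0)).2 < (Gm θ (xv, 0)).2)
    (hg : threshold D F Gp Gm σ xv θ < gNumber D F Gp Gm σ xv θ) :
    ∃ C > 0, ∃ ε₁ > 0, ∀ ε, 0 < ε → ε < ε₁ →
      ∃ (t₀ : ℝ) (w : ℝ → Plane),
        |t₀ - θ| ≤ C * ε ∧ ‖w t₀ - (xv, 0)‖ ≤ C * ε ∧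
        IsSlidingPeriodicSolution (perturb (reversed F) Gp Hp ε) (perturb F Gm Hm ε) D
          (2 * σ xv) w ∧
        SlidesOn (perturb (reversed F) Gp Hp ε) (perturb F Gm Hm ε)
          (slidingRegion (perturb (reversed F) Gp Hp ε) (perturb F Gm Hm ε)) w := by
  have hq := L.exit
  have hab := L.visible
  have ha := L.field_ne_zero
  have hb := L.dxF₂_ne_zero
  have hS := L.pos
  rw [threshold, max_eq_right h.le] at hg
  -- Twice the limit of the lower tilt at the candidate starting point of a crossing orbit.
  -- Multiplying the limit matching equation by `a b / F₂(q)` leaves this number as the right-hand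
  -- side for the sliding time.
  have hΔ : 0 < 2 * (dxF₂ F xv * -((F (xv, 0)).1 * gNumber D F Gp Gm σ xv θ /
      (2 * (F (flow F D (σ xv) (xv, 0))).2)) + (Gm θ (xv, 0)).2) := by
    have hab' : (F (xv, 0)).1 * dxF₂ F xv < 0 := by linarith [mul_comm (F (xv, 0)).1 (dxF₂ F xv)]
    rw [div_mul_eq_mul_div, div_lt_iff_of_neg hab'] at hg
    have h2 : dxF₂ F xv * -((F (xv, 0)).1 * gNumber D F Gp Gm σ xv θ /
        (2 * (F (flow F D (σ xv) (xv, 0))).2)) + (Gm θ (xv, 0)).2 =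
        (2 * (F (flow F D (σ xv) (xv, 0))).2 * (Gm θ (xv, 0)).2 -
          gNumber D F Gp Gm σ xv θ * ((F (xv, 0)).1 * dxF₂ F xv)) /
          (2 * (F (flow F D (σ xv) (xv, 0))).2) := by
      field_simp
      ring
    rw [h2]
    exact mul_pos two_pos (div_pos (by linarith) (by linarith))
  obtain ⟨κ₀, hκ₀, hκe⟩ := exists_slide_time (gp := (Gp θ (xv, 0)).2) hab h hΔ
  obtain ⟨ξ₁, ξ₂, hξ₁, hξ₂, hξ₁0, hξ₂0, hslide⟩ := L.exists_slideToFold hRD hε₀ hp hm h hκ₀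
  set g := gNumber D F Gp Gm σ xv θ with hgdef
  simp only [L.melnikov_eq hRD hp hm] at hM hM'
  rw [L.gNumber_eq hRD hp hm] at hgdef
  obtain ⟨ψ, hψ0, hψc, ⟨C, hC, hψC⟩, hψ⟩ := L.exists_matching hRD hε₀ hp hm
    (θ := θ) (κ₀ := κ₀) (ξ₁ := ξ₁) (ξ₂ := ξ₂)
    -- This is `-1` minus an exponential, hence nonzero.
    (B' := -1 + -((F (xv, 0)).1 * Real.exp (2 * (F (xv, 0)).1 * dxF₂ F xv * κ₀ /
      ((Gm θ (xv, 0)).2 - (Gp θ (xv, 0)).2))) / (F (xv, 0)).1)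
    (η := fun e => e.2.2) hM (hasDerivAt_of_deriv_ne_zero hM') hM' hξ₁ hξ₂
    (.of_contDiffAt (by fun_prop))
    (by
      rw [← hgdef]
      simp only [hξ₁0, hξ₂0.self_of_nhds]
      generalize slideSol (F (xv, 0)).1 (dxF₂ F xv) (Gp θ (xv, 0)).2 (Gm θ (xv, 0)).2 κ₀ 1 = s at hκe ⊢
      generalize (F (flow F D (σ xv) (xv, 0))).2 = Q at hq hκe ⊢
      field_simp at hκe ⊢
      linear_combination hκe)
    (by
      refine HasDerivAt.congr_of_eventuallyEq (f := fun κ => -κ + (-(Gm θ (xv, 0)).2 / dxF₂ F xv +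
        slideSol (F (xv, 0)).1 (dxF₂ F xv) (Gp θ (xv, 0)).2 (Gm θ (xv, 0)).2 κ 1) /
          (F (xv, 0)).1) ?_ (hξ₂0.mono fun κ hκ => by simp only [hξ₁0, hκ])
      exact (hasDerivAt_id κ₀).neg.add
        (((hasDerivAt_slideSol_one hb (sub_pos.2 h).ne' κ₀).const_add _).div_const _))
    (by
      rw [neg_div, mul_div_cancel_left₀ _ ha]
      have := Real.exp_pos (2 * (F (xv, 0)).1 * dxF₂ F xv * κ₀ /
        ((Gm θ (xv, 0)).2 - (Gp θ (xv, 0)).2))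
      linarith)
  have hy : Tendsto (fun ε => (ε, ψ ε)) (𝓝 0) (𝓝 (0, θ, κ₀)) := by
    have h0 : ContinuousAt (fun ε => (ε, ψ ε)) 0 := by fun_prop
    simpa [ContinuousAt, hψ0] using h0
  have hbd : ∀ᶠ ε in 𝓝 0, |ξ₁ (ε, ψ ε)| < |ξ₁ (0, θ, κ₀)| + 1 :=
    hy.eventually (hξ₁.continuousAt.abs.eventually (gt_mem_nhds (by linarith)))
  obtain ⟨ε₁, hε₁, hall⟩ := mem_nhdsGT_iff_exists_Ioo_subset.1
    ((hψC.and (hψ.and (hbd.and ((hy.eventually hslide).and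
      (Ioo_mem_nhds (neg_lt_zero.2 hε₀) hε₀))))).filter_mono (nhdsWithin_le_nhds (s := Ioi 0)))
  refine ⟨C + (|ξ₁ (0, θ, κ₀)| + 1), by positivity, ε₁, hε₁, fun ε hε hεε₁ => ?_⟩
  obtain ⟨e1, ⟨ℓ₁, ℓ₂, z, u, M⟩, e2, e3, e4⟩ := hall ⟨hε, hεε₁⟩
  obtain ⟨hκ, A, hA⟩ := e3 hε
  rw [abs_of_pos hε] at e1
  set t₀ := (ψ ε).1
  set κ := (ψ ε).2
  have hεκ : 0 < ε * κ := mul_pos hε hκ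
  have hperp : ∀ t, ∀ z ∈ D, perturb (reversed F) Gp Hp ε (t + 2 * σ xv) z =
    perturb (reversed F) Gp Hp ε t z := fun t z hz => hp.periodic_perturb e4 t hz
  have hperm : ∀ t, ∀ z ∈ D, perturb F Gm Hm ε (t + 2 * σ xv) z =
    perturb F Gm Hm ε t z := fun t z hz => hm.periodic_perturb e4 t hz
  have hmemA : ∀ t ∈ Icc (t₀ - ε * κ + 2 * σ xv) (t₀ + 2 * σ xv),
      t - 2 * σ xv ∈ Icc (t₀ - ε * κ) t₀ := fun t ht => ⟨by linarith [ht.1], by linarith [ht.2]⟩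
  have hsl : SlidesDuring (perturb (reversed F) Gp Hp ε) (perturb F Gm Hm ε)
      (fun t => A (t - 2 * σ xv)) (t₀ - ε * κ + 2 * σ xv) (t₀ + 2 * σ xv) :=
    hA.slides.translate hperp hperm (fun t ht => hA.mem t (Ioo_subset_Icc_self ht))
      fun t _ => rfl
  -- The landing instant belongs to the sliding region, so `X⁺` points downwards there: the sign
  -- that the reversed upper arc needs at its start.
  have hstart := hA.region _ ⟨le_rfl, show t₀ - ε * κ < t₀ by linarith⟩
  rw [hA.start] at hstart
  obtain ⟨w, c, hc, hw, hw0, w1, w2, w3, w4⟩ := M.exists_periodicSolution hRD hp hm e4 hεκ.le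
    hA.fold.le hstart.2.1.le (C := fun t => A (t - 2 * σ xv))
    (hA.continuousOn.comp (by fun_prop) hmemA) (fun t ht => hA.mem _ (hmemA t ht))
    (by rw [add_sub_cancel_right, hA.start]) (by rw [add_sub_cancel_right, hA.finish])
    (Or.inr (Or.inr hsl))
  refine ⟨t₀, w, e1.trans ?_, ?_, ⟨hw, ⟨t₀ - ε * κ + 2 * σ xv, t₀ + 2 * σ xv, by linarith, ?_⟩,
    ⟨(c + (t₀ - ε * κ + 2 * σ xv)) / 2, w3 _ ⟨by linarith [hc.2], by linarith [hc.2]⟩⟩,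
    ⟨(t₀ + c) / 2, w1 _ ⟨by linarith [hc.1], by linarith [hc.1]⟩⟩⟩, fun t ht => ?_⟩
  · gcongr
    linarith [abs_nonneg (ξ₁ (0, θ, κ₀))]
  · rw [hw0]
    have : ((xv + ε * ξ₁ (ε, ψ ε), 0) : Plane) - (xv, 0) = (ε * ξ₁ (ε, ψ ε), 0) := by simp
    rw [this, Prod.norm_def]
    simp only [norm_zero, Real.norm_eq_abs, abs_mul, abs_of_pos hε]
    rw [max_eq_left (by positivity), mul_comm]
    gcongr
    linarith
  · have := hsl.translate (c := 0) (D := D) (w := w) (by simp) (by simp)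
      (fun t ht => hA.mem _ (hmemA t (Ioo_subset_Icc_self ht)))
      (by
        simp only [add_zero, sub_zero]
        exact fun t ht => w4 t (Ioo_subset_Icc_self ht))
    simpa using this
  · obtain ⟨s, hs, h1, h2, h3⟩ := hw.exists_mem_Ico (by linarith) hperp hperm t t₀
    simp only [slidingRegion, escapingRegion, mem_union, mem_ofPred_eq] at ht ⊢
    rw [h2, h3, h1] at ht ⊢
    -- At `t₀` the lower field is tangent to the line, so the fold lies in neither region; at the
    -- other contact before sliding both fields point upwards.
    rcases eq_or_lt_of_le hs.1 with e | e
    · have hf := hA.fold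
      rw [← e, hw0] at ht
      rw [hf] at ht
      exact absurd ht (by simp)
    rcases lt_trichotomy s c with e' | e' | e'
    · have := w1 s ⟨e, e'⟩
      rcases ht with ht | ht <;> exact absurd ht.1 this.ne
    · rw [e'] at ht
      have := w2.2
      simp only at this
      rcases ht with ht | ht <;> nlinarith [ht.2.1, ht.2.2]
    rcases lt_or_ge s (t₀ - ε * κ + 2 * σ xv) with e'' | e''
    · have := w3 s ⟨e', e''⟩
      rcases ht with ht | ht <;> exact absurd ht.1 this.ne'
    · have hs' : s ∈ Icc (t₀ - ε * κ + 2 * σ xv) (t₀ + 2 * σ xv) := ⟨e'', hs.2.le⟩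
      have h4 := hA.region (s - 2 * σ xv) ⟨(hmemA s hs').1, by linarith [hs.2]⟩
      have h5 := hA.mem _ (hmemA s hs')
      rw [w4 s hs']
      have h6 := hperp (s - 2 * σ xv) _ h5
      have h7 := hperm (s - 2 * σ xv) _ h5
      rw [sub_add_cancel] at h6 h7
      rw [h6, h7]
      exact h4

end Sliding

end TwoFold

namespace TwoFold

/-! ### The symmetry `(t, z) ↦ (-t, R z)` -/

section Mirror

variable {Xp Xm : ℝ → Plane → Plane} {D : Set Plane} {w : ℝ → Plane} {a b T : ℝ}

theorem rev_neg (X : ℝ → Plane → Plane) (t : ℝ) (z : Plane) : rev X (-t) z = -R (X t (R z)) := by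
  rw [rev, neg_neg]

/-- Reversal exchanges the two fields and keeps vertical components up to relabelling; hence the
sliding field is reversed as well and the sliding and escaping regions are exchanged. -/
theorem slidingField_rev (Xp Xm : ℝ → Plane → Plane) (t : ℝ) (z : Plane) :
    slidingField (rev Xm) (rev Xp) (-t) z = -R (slidingField Xp Xm t (R z)) := by
  simp only [slidingField, rev_neg, Prod.snd_neg, R_snd, neg_neg, R_smul]
  rw [← neg_sub (Xm t (R z)).2, inv_neg, sub_eq_add_neg (_ • Xp t (R z)), R_add, R_neg, R_smul,
    R_smul]
  module

theorem hasDerivAt_mirror {v : Plane} {t : ℝ} (h : HasDerivAt w (-R v) (-t)) :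
    HasDerivAt (fun t => R (w (-t))) v t := by
  have h1 := hasDerivAt_R (h.scomp t (hasDerivAt_neg t))
  refine h1.congr_deriv ?_
  rw [neg_smul, one_smul, neg_neg, R_R]

theorem mem_region_mirror {t : ℝ} (h : (-t, w (-t)) ∈ slidingRegion (rev Xm) (rev Xp)) :
    (t, R (w (-t))) ∈ escapingRegion Xp Xm := by
  obtain ⟨h1, h2, h3⟩ := h
  simp only [rev_neg, Prod.snd_neg, R_snd, neg_neg] at h1 h2 h3
  exact ⟨by simp [h1], h3, h2⟩

theorem SlidesDuring.mirror (h : SlidesDuring (rev Xm) (rev Xp) w a b) :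
    SlidesDuring Xp Xm (fun t => R (w (-t))) (-b) (-a) := by
  intro t ht
  obtain ⟨h1, h2⟩ := h (-t) ⟨by linarith [ht.2], by linarith [ht.1]⟩
  rw [slidingField_rev] at h2
  refine ⟨?_, hasDerivAt_mirror h2⟩
  rcases h1 with h1 | h1
  · exact Or.inr (mem_region_mirror h1)
  · obtain ⟨h1, h2, h3⟩ := h1
    simp only [rev_neg, Prod.snd_neg, R_snd, neg_neg] at h1 h2 h3
    exact Or.inl ⟨by simp [h1], h3, h2⟩

theorem IsArc.mirror (h : IsArc (rev Xm) (rev Xp) w a b) :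
    IsArc Xp Xm (fun t => R (w (-t))) (-b) (-a) := by
  have hs : ∀ t ∈ Ioo (-b) (-a), -t ∈ Ioo a b := fun t ht =>
    ⟨by linarith [ht.2], by linarith [ht.1]⟩
  rcases h with h | h | h
  · refine Or.inr (Or.inl fun t ht => ?_)
    obtain ⟨h1, h2⟩ := h _ (hs t ht)
    rw [rev_neg] at h2
    exact ⟨by simpa using h1, hasDerivAt_mirror h2⟩
  · refine Or.inl fun t ht => ?_
    obtain ⟨h1, h2⟩ := h _ (hs t ht)
    rw [rev_neg] at h2
    exact ⟨by simpa using h1, hasDerivAt_mirror h2⟩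
  · exact Or.inr (Or.inr h.mirror)

theorem IsSlidingPeriodicSolution.mirror (hRD : ∀ z ∈ D, R z ∈ D)
    (h : IsSlidingPeriodicSolution (rev Xm) (rev Xp) D T w) :
    IsSlidingPeriodicSolution Xp Xm D T fun t => R (w (-t)) := by
  obtain ⟨⟨hc, hD, hper, harc⟩, ⟨a, b, hab, hsl⟩, ⟨t₁, ht₁⟩, t₂, ht₂⟩ := h
  refine ⟨⟨(contDiff_R (n := 0)).continuous.comp (hc.comp continuous_neg), fun t => hRD _ (hD _),
    fun t => ?_, fun a => ?_⟩, ⟨-b, -a, neg_lt_neg hab, hsl.mirror⟩, ⟨-t₂, ?_⟩, -t₁, ?_⟩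
  · simp only [neg_add', hper.sub_eq]
  · obtain ⟨⟨b, hb, h1⟩, b', hb', h2⟩ := harc (-a)
    refine ⟨⟨-b', by linarith, ?_⟩, -b, by linarith, ?_⟩
    · simpa using h2.mirror
    · simpa using h1.mirror
  · simpa using ht₂
  · simpa using ht₁

theorem SlidesOn.mirror (h : SlidesOn (rev Xm) (rev Xp) (slidingRegion (rev Xm) (rev Xp)) w) :
    SlidesOn Xp Xm (escapingRegion Xp Xm) fun t => R (w (-t)) := by
  intro t ht
  refine mem_region_mirror (h (-t) ?_)
  simp only [slidingRegion, escapingRegion, mem_union, mem_ofPred_eq, rev_neg, Prod.snd_neg, R_snd,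
    neg_neg, neg_eq_zero] at ht ⊢
  tauto

variable {F : Plane → Plane} {Gp Gm : ℝ → Plane → Plane} {σ : ℝ → ℝ} {xv θ : ℝ}

/-- The sum of the two perturbation terms is odd under the exchange, their difference is even: hence
a sign here and none in `gNumber_mirror`. Simple zeros are preserved either way. -/
theorem melnikov_mirror (D : Set Plane) (F : Plane → Plane) (Gp Gm : ℝ → Plane → Plane)
    (σ : ℝ → ℝ) (θ x : ℝ) :
    melnikov D F (rev Gm) (rev Gp) σ θ x = -melnikov D F Gp Gm σ (-θ) x := by
  have h : ∀ t z, rev Gp (t + θ) z + R (rev Gm (-t + θ) (R z)) =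
      -(Gm (t + -θ) z + R (Gp (-t + -θ) (R z))) := by
    intro t z
    simp only [rev, R_neg, R_R, neg_add, neg_neg]
    abel
  have h2 : ∀ u v : Plane, wedge u (-v) = -wedge u v := by
    intro u v
    simp only [wedge, Prod.fst_neg, Prod.snd_neg]
    ring
  simp only [melnikov, h, map_neg, intervalIntegral.integral_neg, h2]

theorem gNumber_mirror (D : Set Plane) (F : Plane → Plane) (Gp Gm : ℝ → Plane → Plane)
    (σ : ℝ → ℝ) (xv θ : ℝ) :
    gNumber D F (rev Gm) (rev Gp) σ xv θ = gNumber D F Gp Gm σ xv (-θ) := by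
  have h : ∀ t z, rev Gp (t + θ) z - R (rev Gm (-t + θ) (R z)) =
      Gm (t + -θ) z - R (Gp (-t + -θ) (R z)) := by
    intro t z
    simp only [rev, R_neg, R_R, neg_add, neg_neg]
    abel
  simp only [gNumber, h]

theorem rev_snd (G : ℝ → Plane → Plane) (θ x : ℝ) : (rev G θ (x, 0)).2 = (G (-θ) (x, 0)).2 := by
  simp [rev, R_of_snd_eq_zero (a := (x, 0)) rfl]

theorem threshold_mirror (D : Set Plane) (F : Plane → Plane) (Gp Gm : ℝ → Plane → Plane)
    (σ : ℝ → ℝ) (xv θ : ℝ) :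
    threshold D F (rev Gm) (rev Gp) σ xv θ = threshold D F Gp Gm σ xv (-θ) := by
  simp only [threshold, rev_snd, max_comm]

end Mirror

/-! ### The escaping case by reversal -/

section Escaping

variable {D : Set Plane} {F : Plane → Plane} {Gp Gm : ℝ → Plane → Plane}
  {Hp Hm : ℝ → Plane → ℝ → Plane} {xv ε₀ θ : ℝ} {σ : ℝ → ℝ}

/-- The mirrored system has `rev Gm` above, `rev Gp` below and phase `-θ`, which reverses the
inequality between the vertical perturbations at the fold. `exists_sliding` applies to it, and
mirroring back turns sliding into escaping. -/
theorem VisibleLoop.exists_escaping (L : VisibleLoop D F xv (σ xv)) (hRD : ∀ z ∈ D, R z ∈ D)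
    (hε₀ : 0 < ε₀) (hp : PeriodicPerturbation D ε₀ (2 * σ xv) Gp Hp)
    (hm : PeriodicPerturbation D ε₀ (2 * σ xv) Gm Hm) (hM : melnikov D F Gp Gm σ θ xv = 0)
    (hM' : deriv (fun s => melnikov D F Gp Gm σ s xv) θ ≠ 0)
    (h : (Gm θ (xv, 0)).2 < (Gp θ (xv, 0)).2)
    (hg : threshold D F Gp Gm σ xv θ < gNumber D F Gp Gm σ xv θ) :
    ∃ C > 0, ∃ ε₁ > 0, ∀ ε, 0 < ε → ε < ε₁ →
      ∃ (t₀ : ℝ) (w : ℝ → Plane),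
        |t₀ - θ| ≤ C * ε ∧ ‖w t₀ - (xv, 0)‖ ≤ C * ε ∧
        IsSlidingPeriodicSolution (perturb (reversed F) Gp Hp ε) (perturb F Gm Hm ε) D
          (2 * σ xv) w ∧
        SlidesOn (perturb (reversed F) Gp Hp ε) (perturb F Gm Hm ε)
          (escapingRegion (perturb (reversed F) Gp Hp ε) (perturb F Gm Hm ε)) w := by
  obtain ⟨C, hC, ε₁, hε₁, hall⟩ := L.exists_sliding hRD hε₀ (hm.rev hRD) (hp.rev hRD)
    (θ := -θ) (by rw [melnikov_mirror, neg_neg, hM, neg_zero])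
    (by
      simp only [melnikov_mirror, deriv.fun_neg]
      rw [deriv_comp_neg (f := fun s => melnikov D F Gp Gm σ s xv), neg_neg, neg_neg]
      exact hM')
    (by simpa only [rev_snd, neg_neg] using h)
    (by simpa only [threshold_mirror, gNumber_mirror, neg_neg] using hg)
  refine ⟨C, hC, ε₁, hε₁, fun ε hε hεε₁ => ?_⟩
  obtain ⟨t₀, w, h1, h2, h3, h4⟩ := hall ε hε hεε₁
  rw [perturb_reversed_rev, perturb_rev] at h3 h4
  refine ⟨-t₀, fun t => R (w (-t)), ?_, ?_, h3.mirror hRD, h4.mirror⟩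
  · rwa [abs_sub_comm, sub_neg_eq_add, add_comm, ← sub_neg_eq_add]
  · refine le_trans (le_of_eq ?_) h2
    simp only [neg_neg, Prod.norm_def, Prod.fst_sub, Prod.snd_sub, R_fst, R_snd, sub_zero, norm_neg]

end Escaping

end TwoFold

theorem theoremB
    (D : Set Plane) (hD : IsOpen D) (hRD : ∀ z ∈ D, R z ∈ D)
    (F : Plane → Plane) (hF : ContDiffOn ℝ 2 F D)
    (xi xv : ℝ) (h₁ : TwoFolds D F xi xv)
    (σ : ℝ → ℝ) (h₂ : ReturnTime D F xi xv σ)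
    (ε₀ : ℝ) (hε₀ : 0 < ε₀)
    (Gp Gm : ℝ → Plane → Plane) (Hp Hm : ℝ → Plane → ℝ → Plane)
    (hp : PeriodicPerturbation D ε₀ (2 * σ xv) Gp Hp)
    (hm : PeriodicPerturbation D ε₀ (2 * σ xv) Gm Hm)
    (θ : ℝ) (hM : melnikov D F Gp Gm σ θ xv = 0)
    (hM' : deriv (fun s => melnikov D F Gp Gm σ s xv) θ ≠ 0) :
    ((Gp θ (xv, 0)).2 ≠ (Gm θ (xv, 0)).2 →
      threshold D F Gp Gm σ xv θ < gNumber D F Gp Gm σ xv θ →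
      ∃ C > 0, ∃ ε₁ > 0, ∀ ε, 0 < ε → ε < ε₁ →
        ∃ (t₀ : ℝ) (w : ℝ → Plane),
          |t₀ - θ| ≤ C * ε ∧ ‖w t₀ - (xv, 0)‖ ≤ C * ε ∧
          IsSlidingPeriodicSolution (perturb (reversed F) Gp Hp ε) (perturb F Gm Hm ε) D
            (2 * σ xv) w ∧
          ((Gp θ (xv, 0)).2 < (Gm θ (xv, 0)).2 →
            SlidesOn (perturb (reversed F) Gp Hp ε) (perturb F Gm Hm ε)
              (slidingRegion (perturb (reversed F) Gp Hp ε) (perturb F Gm Hm ε)) w) ∧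
          ((Gm θ (xv, 0)).2 < (Gp θ (xv, 0)).2 →
            SlidesOn (perturb (reversed F) Gp Hp ε) (perturb F Gm Hm ε)
              (escapingRegion (perturb (reversed F) Gp Hp ε) (perturb F Gm Hm ε)) w)) ∧
    (gNumber D F Gp Gm σ xv θ < threshold D F Gp Gm σ xv θ →
      ∃ C > 0, ∃ ε₁ > 0, ∀ ε, 0 < ε → ε < ε₁ →
        ∃ (t₀ : ℝ) (w : ℝ → Plane),
          |t₀ - θ| ≤ C * ε ∧ ‖w t₀ - (xv, 0)‖ ≤ C * ε ∧
          IsCrossingPeriodicSolution (perturb (reversed F) Gp Hp ε) (perturb F Gm Hm ε) D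
            (2 * σ xv) w) := by
  have L : VisibleLoop D F xv (σ xv) := .of_returnTime hD hF h₁ h₂
  refine ⟨fun hne hg => ?_, L.exists_crossing hRD hε₀ hp hm hM hM'⟩
  rcases lt_or_gt_of_ne hne with h | h
  · obtain ⟨C, hC, ε₁, hε₁, hall⟩ := L.exists_sliding hRD hε₀ hp hm hM hM' h hg
    refine ⟨C, hC, ε₁, hε₁, fun ε hε hεε₁ => ?_⟩
    obtain ⟨t₀, w, h1, h2, h3, h4⟩ := hall ε hε hεε₁
    exact ⟨t₀, w, h1, h2, h3, fun _ => h4, fun h' => absurd h h'.not_gt⟩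
  · obtain ⟨C, hC, ε₁, hε₁, hall⟩ := L.exists_escaping hRD hε₀ hp hm hM hM' h hg
    refine ⟨C, hC, ε₁, hε₁, fun ε hε hεε₁ => ?_⟩
    obtain ⟨t₀, w, h1, h2, h3, h4⟩ := hall ε hε hεε₁
    exact ⟨t₀, w, h1, h2, h3, fun h' => absurd h h'.not_gt, fun _ => h4⟩
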